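/- \textbf{Theorem (Hi-WRAC is solvable in polynomial time).} \emph{Input.} Axis-aligned boxes $B_1,\dots,B_n$, where $B_i$ has a given rational width $w_i>0$ and height $h_i>0$, and a plane embedded directed graph $G$ with vertex set $\{B_1,\dots,B_n\}$ that is acyclic and has exactly one sink (vertex without outgoing edges). Such a $G$ is connected, and its plane embedding is given combinatorially: by the clockwise cyclic order of the neighbours around every vertex (this rotation system has Euler genus $0$) and by its outer face. All numbers are encoded in binary, rationals as fractions of integers. \emph{Task.} A \emph{representation} places each $B_i$ in the plane, by translation, so that no two boxes overlap (their interiors are disjoint); two boxes \emph{touch} if their boundaries share a segment of positive length. A representation \emph{hierarchically realizes} $G$ if (i) two distinct boxes touch if and only if they are adjacent in $G$; (ii) for every directed edge $B_i\to B_j$ of $G$, the top side of $B_i$ and the bottom side of $B_j$ share a segment of positive length (so every contact is horizontal, with the head of the edge on top); (iii) the contacts induce the given embedding: going clockwise around the boundary of each box, one meets its contacts in the given clockwise cyclic order of its neighbours, and the unbounded face of the contact graph is the given outer face. The task is to find a representation that hierarchically realizes $G$, or to report that there is none. \emph{Claim.} There is a deterministic Turing machine that, on every such input, halts after a number of steps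 bounded by a fixed polynomial in the length of the input, and outputs rational coordinates of the bottom-left corners of the boxes in a representation that hierarchically realizes $G$ if such a representation (with real coordinates) exists, and otherwise outputs that none exists. -/

import Mathlib

namespace HiWRAC

/-- A rational number written as a fraction, not necessarily in lowest terms. -/
structure Fraction where
  num : ℤ
  den : ℕ
  den_pos : 0 < den

/-- The value of a fraction. -/
noncomputable def Fraction.val (q : Fraction) : ℝ := (q.num : ℝ) / (q.den : ℝ)

/-- Vertices `0, …, n - 1`, an arc relation, and at every vertex the clockwise list of its
neighbours (only its cyclic order matters). -/
structure RotationSystem (n : ℕ) where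
  arc : Fin n → Fin n → Bool
  rot : Fin n → List (Fin n)
  rot_nodup : ∀ v, (rot v).Nodup
  mem_rot : ∀ v w, w ∈ rot v ↔ (arc v w = true ∨ arc w v = true)

namespace RotationSystem

variable {n : ℕ} (R : RotationSystem n)

/-- `(v, w)` is a dart: an edge traversed from `v` to `w`. -/
def IsDart (d : Fin n × Fin n) : Prop := d.2 ∈ R.rot d.1

/-- The boundary walk of the face on the left of a dart: after `u → v` continue with `v → w`, where
`w` is the clockwise successor of `u` around `v`. -/
def faceNext (d : Fin n × Fin n) : Fin n × Fin n := (d.2, (R.rot d.2).formPerm d.1)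

/-- The darts whose left side is the face on the left of `d`. -/
def faceOf (d : Fin n × Fin n) : Set (Fin n × Fin n) := {e | ∃ k : ℕ, R.faceNext^[k] d = e}

open Classical in
/-- The number of faces; a graph without edges on one vertex has one face. -/
noncomputable def numFaces : ℕ :=
  if ∃ d, R.IsDart d then {F | ∃ d, R.IsDart d ∧ R.faceOf d = F}.ncard else 1

/-- The number of edges. -/
def numEdges : ℕ := (Finset.univ.filter fun d : Fin n × Fin n => R.arc d.1 d.2 = true).card

end RotationSystem

/-- An input: boxes with positive rational width and height, and a plane embedded digraph on them
that is acyclic and has a unique sink. Such a graph is connected, so a plane embedding is, up to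
homeomorphism of the plane, a rotation system of Euler genus `0` together with its outer face. The
outer face is given by a dart that has it on its left (`none` if there is no edge). -/
structure Instance where
  n : ℕ
  width : Fin n → Fraction
  height : Fin n → Fraction
  width_pos : ∀ v, 0 < (width v).num
  height_pos : ∀ v, 0 < (height v).num
  graph : RotationSystem n
  acyclic : ∀ v, ¬ Relation.TransGen (fun a b => graph.arc a b = true) v v
  unique_sink : ∃! v, ∀ w, graph.arc v w = false
  planar : n + graph.numFaces = graph.numEdges + 2
  outer : Option (Fin n × Fin n)
  outer_some : ∀ d, outer = some d → graph.IsDart d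
  outer_none : outer = none → ∀ d, ¬ graph.IsDart d

namespace Instance

variable (I : Instance)

/-! A placement `p` gives the bottom-left corner of each box. -/

/-- The `x`-coordinate of the left side. -/
def left (p : Fin I.n → ℝ × ℝ) (v : Fin I.n) : ℝ := (p v).1

/-- The `x`-coordinate of the right side. -/
noncomputable def right (p : Fin I.n → ℝ × ℝ) (v : Fin I.n) : ℝ := (p v).1 + (I.width v).val

/-- The `y`-coordinate of the bottom side. -/
def low (p : Fin I.n → ℝ × ℝ) (v : Fin I.n) : ℝ := (p v).2

/-- The `y`-coordinate of the top side. -/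
noncomputable def high (p : Fin I.n → ℝ × ℝ) (v : Fin I.n) : ℝ := (p v).2 + (I.height v).val

/-- The interior of a box. -/
def openBox (p : Fin I.n → ℝ × ℝ) (v : Fin I.n) : Set (ℝ × ℝ) :=
  Set.Ioo (I.left p v) (I.right p v) ×ˢ Set.Ioo (I.low p v) (I.high p v)

/-- No two boxes overlap. -/
def IsRepresentation (p : Fin I.n → ℝ × ℝ) : Prop :=
  ∀ v w, v ≠ w → Disjoint (I.openBox p v) (I.openBox p w)

/-- The top side of `v` and the bottom side of `w` share a segment of positive length. -/
def TopContact (p : Fin I.n → ℝ × ℝ) (v w : Fin I.n) : Prop :=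
  I.high p v = I.low p w ∧ max (I.left p v) (I.left p w) < min (I.right p v) (I.right p w)

/-- The right side of `v` and the left side of `w` share a segment of positive length. -/
def SideContact (p : Fin I.n → ℝ × ℝ) (v w : Fin I.n) : Prop :=
  I.right p v = I.left p w ∧ max (I.low p v) (I.low p w) < min (I.high p v) (I.high p w)

/-- Two boxes touch: their boundaries share a segment of positive length. -/
def Touch (p : Fin I.n → ℝ × ℝ) (v w : Fin I.n) : Prop :=
  I.TopContact p v w ∨ I.TopContact p w v ∨ I.SideContact p v w ∨ I.SideContact p w v

/-- The cyclic list `l` is the list of contacts met when going clockwise around the boundary of the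
box `v`, all contacts being horizontal: the top side from left to right, then the bottom side from
right to left. -/
def ClockwiseContacts (p : Fin I.n → ℝ × ℝ) (v : Fin I.n) (l : List (Fin I.n)) : Prop :=
  ∃ above below : List (Fin I.n), l.IsRotated (above ++ below) ∧
    (∀ w ∈ above, I.TopContact p v w) ∧
    above.Pairwise (fun a b => I.left p a < I.left p b) ∧
    (∀ w ∈ below, I.TopContact p w v) ∧
    below.Pairwise (fun a b => I.left p b < I.left p a)

/-- The dart `d` has the unbounded region on its left: it leaves a highest box through the rightmost
contact on its bottom side. (Going clockwise around this box, the corner just before this contact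
contains the top side, above which there is no box.) -/
def IsUnboundedDart (p : Fin I.n → ℝ × ℝ) (d : Fin I.n × Fin I.n) : Prop :=
  (∀ u, I.high p u ≤ I.high p d.1) ∧ I.TopContact p d.2 d.1 ∧
    ∀ u, I.TopContact p u d.1 → I.left p u ≤ I.left p d.2

/-- The placement hierarchically realizes the embedded digraph: no two boxes overlap, the contact
graph is the given graph, every arc `v → w` is a contact of the top side of `v` with `w`, and the
contacts induce the given clockwise orders and the given outer face. -/
structure HierarchicallyRealizes (p : Fin I.n → ℝ × ℝ) : Prop where
  representation : I.IsRepresentation p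
  contact_graph : ∀ v w, v ≠ w →
    (I.Touch p v w ↔ (I.graph.arc v w = true ∨ I.graph.arc w v = true))
  upward : ∀ v w, I.graph.arc v w = true → I.TopContact p v w
  rotation : ∀ v, I.ClockwiseContacts p v (I.graph.rot v)
  outer_face : ∀ d, I.outer = some d → ∃ e, I.IsUnboundedDart p e ∧ e ∈ I.graph.faceOf d

end Instance

/-! Encodings as words over the three-letter alphabet `{0, 1, separator}`. -/

/-- A list of natural numbers in binary, each followed by the separator `none`. -/
def encodeNats (l : List ℕ) : List (Option Bool) :=
  l.flatMap fun k => k.bits.map some ++ [none]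

/-- Sign, absolute value of the numerator, denominator. -/
def Fraction.toNats (q : Fraction) : List ℕ :=
  [if q.num < 0 then 1 else 0, q.num.natAbs, q.den]

/-- For every vertex: width, height, degree, and the clockwise list of neighbours, each with a bit
that tells whether the edge is outgoing. -/
def Instance.vertexToNats (I : Instance) (v : Fin I.n) : List ℕ :=
  (I.width v).toNats ++ (I.height v).toNats ++ [(I.graph.rot v).length] ++
    (I.graph.rot v).flatMap fun w => [w.val, (I.graph.arc v w).toNat]

/-- The encoding of an input: number of vertices, the vertex data, the dart of the outer face. -/
def encodeInstance (I : Instance) : List (Option Bool) :=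
  encodeNats ([I.n] ++ (List.finRange I.n).flatMap I.vertexToNats ++
    (match I.outer with
      | none => []
      | some d => [d.1.val, d.2.val]))

/-- The encoding of an output: `0` for "not realizable", or `1` followed by the coordinates of the
bottom-left corners of the boxes. -/
def encodeOutput (o : Option (List (Fraction × Fraction))) : List (Option Bool) :=
  encodeNats
    (match o with
      | none => [0]
      | some l => [1] ++ l.flatMap fun q => q.1.toNats ++ q.2.toNats)

/-- The output `o` is correct for the input `I`: a placement that hierarchically realizes it, or
`none` if there is no such placement, even with real coordinates. -/
def IsCorrectOutput (I : Instance) : Option (List (Fraction × Fraction)) → Prop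
  | some l => ∃ q : Fin I.n → Fraction × Fraction, l = List.ofFn q ∧
      I.HierarchicallyRealizes fun v => ((q v).1.val, (q v).2.val)
  | none => ¬ ∃ p : Fin I.n → ℝ × ℝ, I.HierarchicallyRealizes p

end HiWRAC

/-!
In a realization an arc `u → v` puts the bottom of `v` at the top of `u`, so the ordinates of all
boxes are forced by the paths of first out-neighbours that lead to the sink. Boxes whose vertical
extents meet lie side by side, and which of the two is on the left can be read off the rotation
system at the vertex where their paths meet, once it is known which contact of the sink is the
rightmost one. Hence each of the `n` guesses for that contact leaves a system of difference
constraints for the abscissae. After scaling the widths to multiples of `n`, which makes room for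
the strict inequalities, a real solution can be rounded to an integral one, so Bellman–Ford
relaxations over the natural numbers find a solution if there is one. Every candidate is checked, so
the answers are sound; and for the correct guess every solution of the constraints passes the check.

To see that a Turing machine does this in polynomial time, all data is encoded by binary trees, and
the functions computed by structured stack programs in polynomial time are shown to be closed under
composition, pairing, case distinction, and folds whose intermediate values stay polynomially small.
-/

open Turing

namespace HiWRAC

/-! ### Structured programs on stacks -/

/-- Structured programs on stacks indexed by `κ` over the alphabet `Γ`, with one register that holds
the letter popped last (`none` if the stack was empty). They are the language in which all
algorithms below are written; `Prog.machine` compiles them to Turing machines. -/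
inductive Prog (κ Γ : Type)
  | push (k : κ) (g : Option Γ → Γ)
  | pop (k : κ)
  | seq (p q : Prog κ Γ)
  | ite (c : Option Γ → Bool) (p q : Prog κ Γ)
  | loop (c : Option Γ → Bool) (p : Prog κ Γ)

namespace Prog

variable {κ Γ L : Type}

/-- The labels of the compiled program. -/
def Label : Prog κ Γ → Type
  | push _ _ => Unit
  | pop _ => Unit
  | seq p q => p.Label ⊕ q.Label
  | ite _ p q => Option (p.Label ⊕ q.Label)
  | loop _ p => Option p.Label

/-- The compiled program has finitely many labels. -/
@[reducible] def labelFintype : (p : Prog κ Γ) → Fintype p.Label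
  | push _ _ => inferInstanceAs (Fintype Unit)
  | pop _ => inferInstanceAs (Fintype Unit)
  | seq p q => @instFintypeSum _ _ p.labelFintype q.labelFintype
  | ite _ p q => @instFintypeOption _ (@instFintypeSum _ _ p.labelFintype q.labelFintype)
  | loop _ p => @instFintypeOption _ p.labelFintype

/-- The label where the compiled program starts. -/
def entry : (p : Prog κ Γ) → p.Label
  | push _ _ => ()
  | pop _ => ()
  | seq p _ => Sum.inl p.entry
  | ite _ _ _ => none
  | loop _ _ => none

/-- The statements of the compiled program, as a part of a machine with labels `L`: its own labels
are embedded by `ι`, and it leaves to the label `e`. -/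
def code : (p : Prog κ Γ) → (p.Label → L) → L → p.Label → TM2.Stmt (fun _ : κ => Γ) L (Option Γ)
  | push k g, _, e, _ => .push k g (.goto fun _ => e)
  | pop k, _, e, _ => .pop k (fun _ s => s) (.goto fun _ => e)
  | seq p q, ι, e, l => match l with
    | Sum.inl l => p.code (fun a => ι (Sum.inl a)) (ι (Sum.inr q.entry)) l
    | Sum.inr l => q.code (fun a => ι (Sum.inr a)) e l
  | ite c p q, ι, e, l => match l with
    | none => .goto fun v => cond (c v) (ι (some (Sum.inl p.entry))) (ι (some (Sum.inr q.entry)))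
    | some (Sum.inl l) => p.code (fun a => ι (some (Sum.inl a))) e l
    | some (Sum.inr l) => q.code (fun a => ι (some (Sum.inr a))) e l
  | loop c p, ι, e, l => match l with
    | none => .goto fun v => cond (c v) (ι (some p.entry)) e
    | some l => p.code (fun a => ι (some a)) (ι none) l

variable [DecidableEq κ]

/-- Big-step semantics: `Exec p v S n v' S'` says that `p` leads from the register `v` and the
stacks `S` to `v'` and `S'` in exactly `n` steps. -/
inductive Exec :
    Prog κ Γ → Option Γ → (κ → List Γ) → ℕ → Option Γ → (κ → List Γ) → Prop
  | push (k g v S) : Exec (push k g) v S 1 v (Function.update S k (g v :: S k))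
  | pop (k v S) : Exec (pop k) v S 1 (S k).head? (Function.update S k (S k).tail)
  | seq {p q v S n v' S' m v'' S''} : Exec p v S n v' S' → Exec q v' S' m v'' S'' →
      Exec (seq p q) v S (n + m) v'' S''
  | ite_true {c p q v S n v' S'} : c v = true → Exec p v S n v' S' →
      Exec (ite c p q) v S (1 + n) v' S'
  | ite_false {c p q v S n v' S'} : c v = false → Exec q v S n v' S' →
      Exec (ite c p q) v S (1 + n) v' S'
  | loop_false {c p v S} : c v = false → Exec (loop c p) v S 1 v S
  | loop_true {c p v S n v' S' m v'' S''} : c v = true → Exec p v S n v' S' →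
      Exec (loop c p) v' S' m v'' S'' → Exec (loop c p) v S (1 + (n + m)) v'' S''

/-- `n` steps of the machine `M` lead from one configuration to the other. -/
def Steps (M : L → TM2.Stmt (fun _ : κ => Γ) L (Option Γ)) (n : ℕ)
    (c c' : TM2.Cfg (fun _ : κ => Γ) L (Option Γ)) : Prop :=
  (flip bind (TM2.step M))^[n] (some c) = some c'

section Steps

variable {M : L → TM2.Stmt (fun _ : κ => Γ) L (Option Γ)}

theorem Steps.trans {n m : ℕ} {c c' c'' : TM2.Cfg (fun _ : κ => Γ) L (Option Γ)}
    (h : Steps M n c c') (h' : Steps M m c' c'') : Steps M (n + m) c c'' := by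
  unfold Steps at *
  rw [add_comm, Function.iterate_add_apply, h, h']

theorem steps_one {l : L} {v : Option Γ} {S : κ → List Γ}
    {c : TM2.Cfg (fun _ : κ => Γ) L (Option Γ)} (h : TM2.stepAux (M l) v S = c) :
    Steps M 1 ⟨some l, v, S⟩ c :=
  congrArg some h

theorem steps_goto {l e : L} {f : Option Γ → L} {v : Option Γ} {S : κ → List Γ}
    (h : M l = .goto f) (he : f v = e) : Steps M 1 ⟨some l, v, S⟩ ⟨some e, v, S⟩ :=
  steps_one (by simp only [h, TM2.stepAux, he])

end Steps

variable {p : Prog κ Γ} {S S' : κ → List Γ} {v v' : Option Γ} {n : ℕ}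

theorem Exec.steps (h : Exec p v S n v' S') :
    ∀ {L : Type} (M : L → TM2.Stmt (fun _ : κ => Γ) L (Option Γ)) (ι : p.Label → L) (e : L),
      (∀ l, M (ι l) = p.code ι e l) → Steps M n ⟨some (ι p.entry), v, S⟩ ⟨some e, v', S'⟩ := by
  induction h with
  | push k g v S =>
    exact fun M ι e hM => steps_one (by rw [hM]; rfl)
  | pop k v S =>
    exact fun M ι e hM => steps_one (by rw [hM]; rfl)
  | seq _ _ ih₁ ih₂ =>
    exact fun M ι e hM => (ih₁ M (fun a => ι (Sum.inl a)) _ fun l => hM (Sum.inl l)).trans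
      (ih₂ M (fun a => ι (Sum.inr a)) e fun l => hM (Sum.inr l))
  | ite_true hc _ ih =>
    exact fun M ι e hM => (steps_goto (hM none) (by rw [hc, cond_true])).trans
      (ih M (fun a => ι (some (Sum.inl a))) e fun l => hM (some (Sum.inl l)))
  | ite_false hc _ ih =>
    exact fun M ι e hM => (steps_goto (hM none) (by rw [hc, cond_false])).trans
      (ih M (fun a => ι (some (Sum.inr a))) e fun l => hM (some (Sum.inr l)))
  | loop_false hc =>
    exact fun M ι e hM => steps_goto (hM none) (by rw [hc, cond_false])
  | loop_true hc _ _ ih₁ ih₂ =>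
    exact fun M ι e hM => (steps_goto (hM none) (by rw [hc, cond_true])).trans
      ((ih₁ M (fun a => ι (some a)) (ι none) fun l => hM (some l)).trans (ih₂ M ι e hM))

/-- The Turing machine of a program, with input stack `i` and output stack `o`. The additional label
`none` halts: a configuration without label cannot be the target of a `goto`. -/
def machine [Fintype κ] [Fintype Γ] (p : Prog κ Γ) (i o : κ) : FinTM2 where
  K := κ
  k₀ := i
  k₁ := o
  Γ := fun _ => Γ
  Λ := Option p.Label
  main := some p.entry
  ΛFin := @instFintypeOption _ p.labelFintype
  σ := Option Γ
  initialState := none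
  m := fun l => match l with
    | none => .halt
    | some l => p.code some none l

theorem dite_cast_eq_update {k i : κ} (w : List Γ) :
    (if h : k = i then (by rw [h]; exact w) else [] : (fun _ : κ => List Γ) k) =
      Function.update (fun _ => []) i w k := by
  by_cases h : k = i
  · subst h; simp
  · simp [h]

theorem Exec.tm2OutputsInTime_machine [Fintype κ] [Fintype Γ] {i o : κ} {w w' : List Γ}
    (h : Exec p none (Function.update (fun _ => []) i w) n none
      (Function.update (fun _ => []) o w')) :
    Nonempty (TM2OutputsInTime (p.machine i o) w (some w') (n + 1)) := by
  have initList_eq : initList (p.machine i o) w =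
      ⟨some (some p.entry), none, Function.update (fun _ => []) i w⟩ :=
    congrArg (TM2.Cfg.mk _ _) (funext fun _ => dite_cast_eq_update w)
  have haltList_eq : haltList (p.machine i o) w' =
      ⟨none, none, Function.update (fun _ => []) o w'⟩ :=
    congrArg (TM2.Cfg.mk _ _) (funext fun _ => dite_cast_eq_update w')
  have run := (h.steps (p.machine i o).m some none fun l => rfl).trans (m := 1)
    (c'' := ⟨none, none, Function.update (fun _ => []) o w'⟩) (steps_one rfl)
  have evals : (flip bind (p.machine i o).step)^[n + 1] (initList (p.machine i o) w) =
      some (haltList (p.machine i o) w') := by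
    rw [initList_eq, haltList_eq]
    exact run
  exact ⟨⟨⟨n + 1, evals⟩, le_rfl⟩⟩

theorem sum_length_update_le [Fintype κ] (S : κ → List Γ) (k : κ) {l : List Γ}
    (hl : l.length ≤ (S k).length + 1) :
    ∑ j, (Function.update S k l j).length ≤ ∑ j, (S j).length + 1 := by
  have off_k : ∑ j ∈ Finset.univ.erase k, (Function.update S k l j).length =
      ∑ j ∈ Finset.univ.erase k, (S j).length :=
    Finset.sum_congr rfl fun j hj => by rw [Function.update_of_ne (Finset.ne_of_mem_erase hj)]
  rw [← Finset.add_sum_erase _ _ (Finset.mem_univ k), off_k, Function.update_self,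
    ← Finset.add_sum_erase _ (fun j => (S j).length) (Finset.mem_univ k)]
  omega

theorem Exec.sum_length_le [Fintype κ] (h : Exec p v S n v' S') :
    ∑ k, (S' k).length ≤ ∑ k, (S k).length + n := by
  induction h with
  | push k _ _ S => exact sum_length_update_le _ _ (by simp)
  | pop k _ S => exact sum_length_update_le _ _ (by simp; omega)
  | _ => omega

/-- `p` leads from the stacks `S` to `S'` in at most `n` steps, whatever the register holds. -/
def Run (p : Prog κ Γ) (S : κ → List Γ) (n : ℕ) (S' : κ → List Γ) : Prop :=
  ∀ v, ∃ v', ∃ m ≤ n, Exec p v S m v' S'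

/-- `p` leads from `S` to `S'` in at most `n` steps and leaves `v'` in the register, whatever the
register holds at the start. -/
def RunTo (p : Prog κ Γ) (S : κ → List Γ) (n : ℕ) (v' : Option Γ) (S' : κ → List Γ) : Prop :=
  ∀ v, ∃ m ≤ n, Exec p v S m v' S'

variable {q q' : Prog κ Γ} {S'' T T' : κ → List Γ} {m : ℕ} {c : Option Γ → Bool}

theorem RunTo.run (h : RunTo p S n v S') : Run p S n S' :=
  fun w => ⟨v, h w⟩

theorem Run.mono (h : Run p S n S') (hm : n ≤ m) : Run p S m S' := fun v =>
  let ⟨v', k, hk, e⟩ := h v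
  ⟨v', k, hk.trans hm, e⟩

theorem RunTo.mono (h : RunTo p S n v S') (hm : n ≤ m) : RunTo p S m v S' := fun w =>
  let ⟨k, hk, e⟩ := h w
  ⟨k, hk.trans hm, e⟩

theorem Run.seq (h : Run p S n S') (h' : Run q S' m S'') : Run (.seq p q) S (n + m) S'' := fun v =>
  let ⟨_, _, hk, e⟩ := h v
  let ⟨v'', _, hk', e'⟩ := h' _
  ⟨v'', _, add_le_add hk hk', e.seq e'⟩

theorem Run.seqTo (h : Run p S n S') (h' : RunTo q S' m v S'') :
    RunTo (.seq p q) S (n + m) v S'' := fun w =>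
  let ⟨_, _, hk, e⟩ := h w
  let ⟨_, hk', e'⟩ := h' _
  ⟨_, add_le_add hk hk', e.seq e'⟩

theorem RunTo.seq_exec (h : RunTo p S n v S') (h' : ∃ v', ∃ k ≤ m, Exec q v S' k v' S'') :
    Run (.seq p q) S (n + m) S'' := fun w =>
  let ⟨_, hk, e⟩ := h w
  let ⟨v'', _, hk', e'⟩ := h'
  ⟨v'', _, add_le_add hk hk', e.seq e'⟩

theorem RunTo.seq_ite_true (h : RunTo p S n v S') (hc : c v = true) (h' : Run q S' m S'') :
    Run (.seq p (.ite c q q')) S (n + (1 + m)) S'' :=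
  h.seq_exec (let ⟨v', k, hk, e⟩ := h' v; ⟨v', 1 + k, by omega, e.ite_true hc⟩)

theorem RunTo.seq_ite_false (h : RunTo p S n v S') (hc : c v = false) (h' : Run q' S' m S'') :
    Run (.seq p (.ite c q q')) S (n + (1 + m)) S'' :=
  h.seq_exec (let ⟨v', k, hk, e⟩ := h' v; ⟨v', 1 + k, by omega, e.ite_false hc⟩)

theorem exec_loop_of_forall_lt {S : ℕ → κ → List Γ} {r : ℕ → Option Γ} {N : ℕ}
    (hp : ∀ i < N, RunTo p (S i) m (r (i + 1)) (S (i + 1))) (htrue : ∀ i < N, c (r i) = true)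
    (hfalse : c (r N) = false) :
    ∃ v', ∃ k ≤ N * (1 + m) + 1, Exec (.loop c p) (r 0) (S 0) k v' (S N) := by
  induction N generalizing S r with
  | zero => exact ⟨_, 1, by omega, .loop_false hfalse⟩
  | succ N ih =>
    obtain ⟨k, hk, first⟩ := hp 0 (by omega) (r 0)
    obtain ⟨v', k', hk', rest⟩ := ih (S := fun i => S (i + 1)) (r := fun i => r (i + 1))
      (fun i hi => hp (i + 1) (by omega)) (fun i hi => htrue (i + 1) (by omega)) hfalse
    exact ⟨v', _, by rw [add_mul]; omega, .loop_true (htrue 0 (by omega)) first rest⟩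

theorem Run.cast (h : Run p S n S') (hS : S = T) (hn : n ≤ m) (hS' : S' = T') : Run p T m T' := by
  subst hS hS'
  exact h.mono hn

theorem Exec.cast {w w' : Option Γ} (h : Exec p v S n v' S') (hv : v = w) (hS : S = T)
    (hn : n = m) (hv' : v' = w') (hS' : S' = T') : Exec p w T m w' T' := by
  subst hv hS hn hv' hS'
  exact h

theorem Exec.push_eq {k : κ} {g : Option Γ → Γ} (h : Function.update S k (g v :: S k) = S') :
    Exec (.push k g) v S 1 v S' :=
  h ▸ .push k g v S

theorem Exec.pop_eq {k : κ} (hv : (S k).head? = v') (h : Function.update S k (S k).tail = S') :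
    Exec (.pop k) v S 1 v' S' :=
  h ▸ hv ▸ .pop k v S

theorem run_push (k : κ) (s : Γ) (S : κ → List Γ) :
    Run (.push k fun _ => s) S 1 (Function.update S k (s :: S k)) :=
  fun v => ⟨v, 1, le_rfl, .push k _ v S⟩

/-- Empty the stack `i` onto the stack `j`. -/
def pour [Inhabited Γ] (i j : κ) : Prog κ Γ :=
  .seq (.pop i) (.loop Option.isSome (.seq (.push j fun v => v.getD default) (.pop i)))

theorem exec_pour_loop [Inhabited Γ] {i j : κ} (hij : i ≠ j) (l : List Γ) (S : κ → List Γ)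
    (hS : S i = l) :
    Exec (.loop Option.isSome (.seq (.push j fun v => v.getD default) (.pop i)))
      l.head? (Function.update S i l.tail) (3 * l.length + 1) none
      (Function.update (Function.update S i []) j (l.reverse ++ S j)) := by
  induction l generalizing S with
  | nil =>
    refine (Exec.loop_false rfl).cast rfl rfl rfl rfl ?_
    rw [List.reverse_nil, List.nil_append, List.tail_nil, eq_comm, Function.update_eq_self_iff,
      Function.update_of_ne hij.symm]
  | cons s l ih =>
    have push : Exec (.push j fun v => v.getD default) (some s) (Function.update S i l) 1 (some s)
        (Function.update (Function.update S i l) j (s :: S j)) :=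
      .push_eq (by rw [Function.update_of_ne hij.symm]; rfl)
    have top : Function.update (Function.update S i l) j (s :: S j) i = l := by
      rw [Function.update_of_ne hij, Function.update_self]
    have pop := Exec.pop i (some s) (Function.update (Function.update S i l) j (s :: S j))
    rw [top] at pop
    refine (Exec.loop_true (c := Option.isSome) rfl (push.seq pop) (ih _ top)).cast rfl rfl
      (by simp only [List.length_cons]; omega) rfl (funext fun k => ?_)
    simp only [Function.update_apply]
    split_ifs <;> simp_all

theorem runTo_pour [Inhabited Γ] {i j : κ} (hij : i ≠ j) (S : κ → List Γ) :
    RunTo (pour i j) S (3 * (S i).length + 2) none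
      (Function.update (Function.update S i []) j ((S i).reverse ++ S j)) := fun v =>
  ⟨_, le_rfl, ((Exec.pop i v S).seq (exec_pour_loop hij _ S rfl)).cast rfl rfl (by omega) rfl rfl⟩

/-- Empty the stack `i`. -/
def clear (i : κ) : Prog κ Γ := .seq (.pop i) (.loop Option.isSome (.pop i))

theorem exec_clear_loop (i : κ) (l : List Γ) (S : κ → List Γ) :
    Exec (.loop Option.isSome (.pop i)) l.head? (Function.update S i l.tail) (2 * l.length + 1) none
      (Function.update S i []) := by
  induction l generalizing S with
  | nil => exact .loop_false rfl
  | cons s l ih =>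
    have pop := Exec.pop i (some s) (Function.update S i l)
    rw [Function.update_self] at pop
    have rest := Exec.loop_true (c := Option.isSome) rfl pop (ih (Function.update S i l))
    rw [Function.update_idem] at rest
    exact rest.cast rfl rfl (by simp only [List.length_cons]; omega) rfl rfl

theorem runTo_clear (i : κ) (S : κ → List Γ) :
    RunTo (clear i) S (2 * (S i).length + 2) none (Function.update S i []) := fun v =>
  ⟨_, le_rfl, ((Exec.pop i v S).seq (exec_clear_loop i _ S)).cast rfl rfl (by omega) rfl rfl⟩

end Prog

/-! ### Binary trees on the stacks -/

/-- The letters on the stacks: in the word of a tree, `none` stands for an inner node and `some b`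
for a leaf; in the input and the output, `none` is the separator. -/
abbrev Letter := Option Bool

/-- Binary trees with a bit at every leaf; all data of the algorithm is encoded by such trees. -/
inductive BTree
  | leaf (b : Bool)
  | node (l r : BTree)

/-- The word of a tree, in preorder. -/
def BTree.word : BTree → List Letter
  | leaf b => [some b]
  | node l r => none :: (l.word ++ r.word)

/-- Programs on trees. Between two operations all trees are on stack `0`; the other three stacks are
empty. -/
abbrev TreeProg := Prog (Fin 4) Letter

/-- The stacks between two operations. -/
abbrev mainStack (m : List Letter) : Fin 4 → List Letter := ![m, [], [], []]

namespace Prog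

section Update

variable {α : Type} (a b c d x : α)

theorem update_vec_zero : Function.update ![a, b, c, d] 0 x = ![x, b, c, d] := by
  funext k; fin_cases k <;> rfl

theorem update_vec_one : Function.update ![a, b, c, d] 1 x = ![a, x, c, d] := by
  funext k; fin_cases k <;> rfl

theorem update_vec_two : Function.update ![a, b, c, d] 2 x = ![a, b, x, d] := by
  funext k; fin_cases k <;> rfl

theorem update_vec_three : Function.update ![a, b, c, d] 3 x = ![a, b, c, x] := by
  funext k; fin_cases k <;> rfl

end Update

section Stacks

variable (a b c d : List Letter)

theorem run_pour_one_zero :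
    Run (pour 1 0) ![a, b, c, d] (3 * b.length + 2) ![b.reverse ++ a, [], c, d] := by
  have pour := (runTo_pour (i := 1) (j := 0) (by decide) ![a, b, c, d]).run
  rwa [update_vec_one, update_vec_zero] at pour

theorem run_pour_one_two :
    Run (pour 1 2) ![a, b, c, d] (3 * b.length + 2) ![a, [], b.reverse ++ c, d] := by
  have pour := (runTo_pour (i := 1) (j := 2) (by decide) ![a, b, c, d]).run
  rwa [update_vec_one, update_vec_two] at pour

theorem run_pour_two_three :
    Run (pour 2 3) ![a, b, c, d] (3 * c.length + 2) ![a, b, [], c.reverse ++ d] := by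
  have pour := (runTo_pour (i := 2) (j := 3) (by decide) ![a, b, c, d]).run
  rwa [update_vec_two, update_vec_three] at pour

theorem run_pour_three_zero :
    Run (pour 3 0) ![a, b, c, d] (3 * d.length + 2) ![d.reverse ++ a, b, c, []] := by
  have pour := (runTo_pour (i := 3) (j := 0) (by decide) ![a, b, c, d]).run
  rwa [update_vec_three, update_vec_zero] at pour

end Stacks

/-- Does the letter stand for an inner node? -/
def isNode (v : Option Letter) : Bool := v == some none

/-- The loop of `take`: stack `3` counts the trees that remain after the current one. -/
def takeLoop : TreeProg :=
  .loop Option.isSome (.seq (.pop 0) (.seq (.push 1 fun v => v.getD none)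
    (.ite isNode (.push 3 fun _ => none) (.pop 3))))

theorem exec_takeLoop (t : BTree) (m x y d : List Letter) (s : Letter) (k : ℕ) (v : Option Letter)
    (S : Fin 4 → List Letter)
    (h : Exec takeLoop d.head? ![m, t.word.reverse ++ x, y, d.tail] k v S) :
    Exec takeLoop (some s) ![t.word ++ m, x, y, d] (k + 5 * t.word.length) v S := by
  induction t generalizing m x y d s k v S with
  | leaf b =>
    have pop : Exec (.pop 0) (some s) ![some b :: m, x, y, d] 1 (some (some b)) ![m, x, y, d] :=
      .pop_eq rfl (update_vec_zero ..)
    have move : Exec (.push 1 fun v => v.getD none) (some (some b)) ![m, x, y, d] 1 (some (some b))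
        ![m, some b :: x, y, d] := .push_eq (update_vec_one ..)
    have count : Exec (.pop 3) (some (some b)) ![m, some b :: x, y, d] 1 d.head?
        ![m, some b :: x, y, d.tail] := .pop_eq rfl (update_vec_three ..)
    refine (Exec.loop_true (c := Option.isSome) (v := some s) rfl
      (pop.seq (move.seq (count.ite_false (c := isNode) (p := .push 3 fun _ => none) rfl))) h).cast
      rfl rfl ?_ rfl rfl
    simp only [BTree.word, List.length_singleton]
    omega
  | node l r ihl ihr =>
    have pop : Exec (.pop 0) (some s) ![none :: (l.word ++ (r.word ++ m)), x, y, d] 1 (some none)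
        ![l.word ++ (r.word ++ m), x, y, d] := .pop_eq rfl (update_vec_zero ..)
    have move : Exec (.push 1 fun v => v.getD none) (some none) ![l.word ++ (r.word ++ m), x, y, d]
        1 (some none) ![l.word ++ (r.word ++ m), none :: x, y, d] := .push_eq (update_vec_one ..)
    have count : Exec (.push 3 fun _ => none) (some none)
        ![l.word ++ (r.word ++ m), none :: x, y, d] 1 (some none)
        ![l.word ++ (r.word ++ m), none :: x, y, none :: d] := .push_eq (update_vec_three ..)
    have right := ihr m (l.word.reverse ++ none :: x) y d none k v S (by simpa [BTree.word] using h)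
    have left := ihl (r.word ++ m) (none :: x) y (none :: d) none _ v S right
    refine (Exec.loop_true (c := Option.isSome) (v := some s) rfl
      (pop.seq (move.seq (count.ite_true (c := isNode) (q := .pop 3) rfl))) left).cast
      rfl (by simp [BTree.word]) ?_ rfl rfl
    simp only [BTree.word, List.length_cons, List.length_append]
    omega

/-- Move the top tree, reversed, from stack `0` to stack `1`. -/
def take : TreeProg := .seq (.push 3 fun _ => none) (.seq (.pop 3) takeLoop)

theorem run_take (t : BTree) (m x y : List Letter) :
    Run take ![t.word ++ m, x, y, []] (5 * t.word.length + 3) ![m, t.word.reverse ++ x, y, []] := by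
  have push := run_push 3 none ![t.word ++ m, x, y, []]
  rw [update_vec_three] at push
  have pop : RunTo (.pop 3) ![t.word ++ m, x, y, [none]] 1 (some none) ![t.word ++ m, x, y, []] :=
    fun v => ⟨1, le_rfl, .pop_eq rfl (update_vec_three ..)⟩
  exact (push.seq (pop.seq_exec
    ⟨none, _, le_rfl, exec_takeLoop t m x y [] none 1 none _ (.loop_false rfl)⟩)).mono (by omega)

/-- Remove the top tree. -/
def drop : TreeProg := .seq take (clear 1)

theorem run_drop (t : BTree) (m : List Letter) :
    Run drop (mainStack (t.word ++ m)) (10 * t.word.length + 10) (mainStack m) := by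
  have clear := (runTo_clear 1 ![m, t.word.reverse ++ [], [], []]).run
  rw [update_vec_one] at clear
  refine ((run_take t m [] []).seq clear).mono ?_
  simp only [Matrix.cons_val_one, Matrix.cons_val_zero, List.append_nil, List.length_reverse]
  omega

/-- Exchange the two top trees. -/
def swap : TreeProg :=
  .seq take (.seq (pour 1 2) (.seq take (.seq (pour 2 3) (.seq (pour 3 0) (pour 1 0)))))

theorem run_swap (t u : BTree) (m : List Letter) :
    Run swap (mainStack (t.word ++ (u.word ++ m))) (30 * (t.word.length + u.word.length + 1))
      (mainStack (u.word ++ (t.word ++ m))) := by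
  have take_t := run_take t (u.word ++ m) [] []
  have pour_t := run_pour_one_two (u.word ++ m) (t.word.reverse ++ []) [] []
  have take_u := run_take u m [] t.word
  have pour_t' := run_pour_two_three m (u.word.reverse ++ []) t.word []
  have return_t := run_pour_three_zero m (u.word.reverse ++ []) [] (t.word.reverse ++ [])
  have return_u := run_pour_one_zero (t.word ++ m) (u.word.reverse ++ []) [] []
  simp only [List.append_nil, List.reverse_reverse, List.length_reverse] at *
  exact (take_t.seq (pour_t.seq (take_u.seq (pour_t'.seq (return_t.seq return_u))))).mono (by omega)

/-- Empty stack `1` onto the stacks `0` and `2`. -/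
def fork : TreeProg :=
  .seq (.pop 1) (.loop Option.isSome
    (.seq (.push 0 fun v => v.getD none) (.seq (.push 2 fun v => v.getD none) (.pop 1))))

theorem exec_fork_loop (l m y : List Letter) :
    Exec (.loop Option.isSome
      (.seq (.push 0 fun v => v.getD none) (.seq (.push 2 fun v => v.getD none) (.pop 1))))
      l.head? ![m, l.tail, y, []] (4 * l.length + 1) none
      ![l.reverse ++ m, [], l.reverse ++ y, []] := by
  induction l generalizing m y with
  | nil => exact .loop_false rfl
  | cons s l ih =>
    have push₀ : Exec (.push 0 fun v => v.getD none) (some s) ![m, l, y, []] 1 (some s)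
      ![s :: m, l, y, []] := .push_eq (update_vec_zero ..)
    have push₂ : Exec (.push 2 fun v => v.getD none) (some s) ![s :: m, l, y, []] 1 (some s)
      ![s :: m, l, s :: y, []] := .push_eq (update_vec_two ..)
    have pop : Exec (.pop 1) (some s) ![s :: m, l, s :: y, []] 1 l.head?
      ![s :: m, l.tail, s :: y, []] := .pop_eq rfl (update_vec_one ..)
    exact (Exec.loop_true (c := Option.isSome) rfl (push₀.seq (push₂.seq pop)) (ih _ _)).cast rfl
      rfl (by simp only [List.length_cons]; omega) rfl (by simp)

theorem run_fork (l m : List Letter) :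
    Run fork ![m, l, [], []] (4 * l.length + 2) ![l.reverse ++ m, [], l.reverse, []] := by
  intro v
  have pop : Exec (.pop 1) v ![m, l, [], []] 1 l.head? ![m, l.tail, [], []] :=
    .pop_eq rfl (update_vec_one ..)
  exact ⟨none, _, le_rfl,
    (pop.seq (exec_fork_loop l m [])).cast rfl rfl (by omega) rfl (by simp)⟩

/-- Duplicate the top tree. -/
def dup : TreeProg := .seq take (.seq fork (.seq (pour 2 3) (pour 3 0)))

theorem run_dup (t : BTree) (m : List Letter) :
    Run dup (mainStack (t.word ++ m)) (20 * t.word.length + 20)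
      (mainStack (t.word ++ (t.word ++ m))) := by
  have take := run_take t m [] []
  have fork := run_fork (t.word.reverse ++ []) m
  have pour := run_pour_two_three (t.word ++ m) [] t.word []
  have return_copy := run_pour_three_zero (t.word ++ m) [] [] (t.word.reverse ++ [])
  simp only [List.append_nil, List.reverse_reverse, List.length_reverse] at *
  exact (take.seq (fork.seq (pour.seq return_copy))).mono (by omega)

/-- The program that does nothing. -/
def skip : TreeProg := .loop (fun _ => false) (.pop 0)

theorem run_skip (S : Fin 4 → List Letter) : Run skip S 1 S :=
  fun v => ⟨v, 1, le_rfl, .loop_false rfl⟩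

theorem run_pushTop (s : Letter) (m : List Letter) :
    Run (.push 0 fun _ => s) (mainStack m) 1 (mainStack (s :: m)) := by
  have push := run_push 0 s (mainStack m)
  rwa [update_vec_zero] at push

theorem runTo_popTop (s : Letter) (m : List Letter) :
    RunTo (.pop 0) (mainStack (s :: m)) 1 (some s) (mainStack m) := fun _ =>
  ⟨1, le_rfl, .pop_eq rfl (update_vec_zero ..)⟩

/-- Push a word on stack `0`. -/
def pushAll : List Letter → TreeProg
  | [] => skip
  | s :: w => .seq (pushAll w) (.push 0 fun _ => s)

theorem run_pushAll (w m : List Letter) :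
    Run (pushAll w) (mainStack m) (w.length + 1) (mainStack (w ++ m)) := by
  induction w with
  | nil => exact run_skip _
  | cons s w ih => exact (ih.seq (run_pushTop s (w ++ m))).mono (by rw [List.length_cons])

end Prog

/-! ### Polynomial time functions on encoded data -/

section PolynomialTime

/-- Types whose elements are encoded as trees. -/
class Enc (α : Type) where
  tree : α → BTree

/-- The word of an element of a type with an encoding. -/
def word {α : Type} [Enc α] (a : α) : List Letter := (Enc.tree a).word

/-- The length of the word of an element; running times are measured in it. -/
def size {α : Type} [Enc α] (a : α) : ℕ := (word a).length

instance : Enc Bool := ⟨.leaf⟩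

instance {α β : Type} [Enc α] [Enc β] : Enc (α × β) :=
  ⟨fun x => .node (Enc.tree x.1) (Enc.tree x.2)⟩

/-- The tree of a list: the entries are the left subtrees along the rightmost path. -/
def listTree {α : Type} [Enc α] : List α → BTree
  | [] => .leaf false
  | a :: l => .node (Enc.tree a) (listTree l)

instance {α : Type} [Enc α] : Enc (List α) := ⟨listTree⟩

instance : Enc ℕ := ⟨fun n => Enc.tree n.bits⟩

variable {α β γ σ : Type} [Enc α] [Enc β] [Enc γ] [Enc σ]

theorem word_pair (a : α) (b : β) : word (a, b) = none :: (word a ++ word b) := rfl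

theorem word_cons (a : α) (l : List α) : word (a :: l) = none :: (word a ++ word l) := rfl

@[simp] theorem size_bool (b : Bool) : size b = 1 := rfl

@[simp] theorem size_pair (x : α × β) : size x = size x.1 + size x.2 + 1 := by
  simp only [size, word_pair x.1 x.2, List.length_cons, List.length_append]

@[simp] theorem size_nil : size ([] : List α) = 1 := rfl

@[simp] theorem size_cons (a : α) (l : List α) : size (a :: l) = size a + size l + 1 := by
  simp only [size, word_cons, List.length_cons, List.length_append]

theorem size_nat (n : ℕ) : size n = size n.bits := rfl

theorem size_pos (a : α) : 0 < size a := by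
  unfold size word
  cases Enc.tree a <;> simp [BTree.word]

theorem size_lt_of_mem {a : α} {l : List α} (h : a ∈ l) : size a < size l := by
  induction h with
  | head => rw [size_cons]; omega
  | tail _ _ ih => rw [size_cons]; omega

theorem length_lt_size (l : List α) : l.length < size l := by
  induction l with
  | nil => exact size_pos _
  | cons a l ih => rw [size_cons, List.length_cons]; omega

theorem eval_mono (q : Polynomial ℕ) {m n : ℕ} (h : m ≤ n) : q.eval m ≤ q.eval n := by
  rw [Polynomial.eval_eq_sum_range, Polynomial.eval_eq_sum_range]
  exact Finset.sum_le_sum fun i _ => Nat.mul_le_mul_left _ (Nat.pow_le_pow_left h i)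

/-- Bounded by a polynomial in the size of the argument. -/
@[fun_prop] def PolyBounded (g : α → ℕ) : Prop := ∃ q : Polynomial ℕ, ∀ a, g a ≤ q.eval (size a)

namespace PolyBounded

theorem mono {f g : α → ℕ} (hg : PolyBounded g) (h : ∀ a, f a ≤ g a) : PolyBounded f :=
  let ⟨q, hq⟩ := hg
  ⟨q, fun a => (h a).trans (hq a)⟩

@[fun_prop] theorem const (n : ℕ) : PolyBounded fun _ : α => n := ⟨Polynomial.C n, by simp⟩

@[fun_prop] theorem size_self : PolyBounded fun a : α => size a := ⟨Polynomial.X, by simp⟩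

@[fun_prop] theorem add {f g : α → ℕ} (hf : PolyBounded f) (hg : PolyBounded g) :
    PolyBounded fun a => f a + g a :=
  let ⟨q, hq⟩ := hf
  let ⟨r, hr⟩ := hg
  ⟨q + r, fun a => by rw [Polynomial.eval_add]; exact add_le_add (hq a) (hr a)⟩

@[fun_prop] theorem mul {f g : α → ℕ} (hf : PolyBounded f) (hg : PolyBounded g) :
    PolyBounded fun a => f a * g a :=
  let ⟨q, hq⟩ := hf
  let ⟨r, hr⟩ := hg
  ⟨q * r, fun a => by rw [Polynomial.eval_mul]; exact Nat.mul_le_mul (hq a) (hr a)⟩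

@[fun_prop] theorem eval (q : Polynomial ℕ) {f : α → ℕ} (hf : PolyBounded f) :
    PolyBounded fun a => q.eval (f a) :=
  let ⟨r, hr⟩ := hf
  ⟨q.comp r, fun a => by rw [Polynomial.eval_comp]; exact eval_mono q (hr a)⟩

end PolyBounded

open Prog

/-- Functions computed in polynomial time by a program that replaces the word of the argument on top
of stack `0` by the word of the value. -/
@[fun_prop] def PolyTime (f : α → β) : Prop :=
  ∃ (p : TreeProg) (T : α → ℕ), PolyBounded T ∧
    ∀ a r, Run p (mainStack (word a ++ r)) (T a) (mainStack (word (f a) ++ r))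

namespace PolyTime

theorem polyBounded_size {f : α → β} (hf : PolyTime f) : PolyBounded fun a => size (f a) := by
  obtain ⟨p, T, hT, hp⟩ := hf
  refine (PolyBounded.size_self.add hT).mono fun a => ?_
  obtain ⟨v, m, hm, exec⟩ := hp a [] none
  have growth := exec.sum_length_le
  simp only [Fin.sum_univ_four, Matrix.cons_val, List.append_nil, List.length_nil] at growth
  simp only [size]
  omega

theorem polyBounded_comp {f : α → β} {g : β → ℕ} (hg : PolyBounded g) (hf : PolyTime f) :
    PolyBounded fun a => g (f a) :=
  let ⟨q, hq⟩ := hg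
  (hf.polyBounded_size.eval q).mono fun a => hq (f a)

@[fun_prop] protected theorem id : PolyTime fun a : α => a :=
  ⟨skip, fun _ => 1, by fun_prop, fun _ _ => run_skip _⟩

theorem of_word_eq {f : α → β} (h : ∀ a, word (f a) = word a) : PolyTime f :=
  ⟨skip, fun _ => 1, by fun_prop, fun a r => by rw [h]; exact run_skip _⟩

@[fun_prop] theorem const (b : β) : PolyTime fun _ : α => b :=
  ⟨.seq drop (pushAll (word b)), fun a => 10 * size a + 10 + (size b + 1), by fun_prop,
    fun a r => (run_drop _ r).seq (run_pushAll _ r)⟩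

@[fun_prop] theorem comp {g : β → γ} {f : α → β} (hg : PolyTime g) (hf : PolyTime f) :
    PolyTime fun a => g (f a) := by
  have polyBounded_comp_f {g : β → ℕ} (hg : PolyBounded g) := polyBounded_comp hg hf
  obtain ⟨p, T, hT, hp⟩ := hf
  obtain ⟨q, U, hU, hq⟩ := hg
  exact ⟨.seq p q, fun a => T a + U (f a), hT.add (polyBounded_comp_f hU),
    fun a r => (hp a r).seq (hq (f a) r)⟩

theorem of_eq {f g : α → β} (hg : PolyTime g) (h : ∀ a, f a = g a) : PolyTime f :=
  (funext h : f = g) ▸ hg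

@[fun_prop] theorem prodMk {f : α → β} {g : α → γ} (hf : PolyTime f) (hg : PolyTime g) :
    PolyTime fun a => (f a, g a) := by
  have size_g := hg.polyBounded_size
  obtain ⟨p, T, hT, hp⟩ := hf
  obtain ⟨q, U, hU, hq⟩ := hg
  refine ⟨.seq dup (.seq q (.seq swap (.seq p (.push 0 fun _ => none)))),
    fun a => (20 * size a + 20) + (U a + (30 * (size (g a) + size a + 1) + (T a + 1))), by fun_prop,
    fun a r => ?_⟩
  refine ((run_dup _ r).seq ((hq a _).seq ((run_swap _ _ r).seq
    ((hp a _).seq (run_pushTop none _))))).cast rfl le_rfl ?_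
  rw [word_pair, List.cons_append, List.append_assoc]
  rfl

theorem comp₂ {f : β → γ → σ} {g : α → β} {h : α → γ} (hf : PolyTime fun x : β × γ => f x.1 x.2)
    (hg : PolyTime g) (hh : PolyTime h) : PolyTime fun a => f (g a) (h a) :=
  comp (g := fun x : β × γ => f x.1 x.2) hf (hg.prodMk hh)

@[fun_prop] theorem fst {f : α → β × γ} (hf : PolyTime f) : PolyTime fun a => (f a).1 := by
  suffices PolyTime (Prod.fst : β × γ → β) from this.comp hf
  refine ⟨.seq (.pop 0) (.seq swap drop), fun x => 1 + (30 * (size x.1 + size x.2 + 1) +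
    (10 * size x.2 + 10)), ?_, fun x r => ?_⟩
  · refine PolyBounded.mono (g := fun x => 50 * size x + 50) (by fun_prop) fun x => ?_
    simp only [size_pair]
    omega
  · refine ((runTo_popTop none _).run.seq ((run_swap _ _ r).seq (run_drop _ _))).cast ?_ le_rfl rfl
    rw [word_pair, List.cons_append, List.append_assoc]
    rfl

@[fun_prop] theorem snd {f : α → β × γ} (hf : PolyTime f) : PolyTime fun a => (f a).2 := by
  suffices PolyTime (Prod.snd : β × γ → γ) from this.comp hf
  refine ⟨.seq (.pop 0) drop, fun x => 1 + (10 * size x.1 + 10), ?_, fun x r => ?_⟩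
  · refine PolyBounded.mono (g := fun x => 50 * size x + 50) (by fun_prop) fun x => ?_
    simp only [size_pair]
    omega
  · refine ((runTo_popTop none _).run.seq (run_drop _ _)).cast ?_ le_rfl rfl
    rw [word_pair, List.cons_append, List.append_assoc]
    rfl

@[fun_prop] protected theorem cons {f : α → β} {l : α → List β} (hf : PolyTime f)
    (hl : PolyTime l) : PolyTime fun a => f a :: l a :=
  (of_word_eq (f := fun x : β × List β => x.1 :: x.2) fun _ => rfl).comp (hf.prodMk hl)

@[fun_prop] protected theorem cond {c : α → Bool} {f g : α → β} (hc : PolyTime c) (hf : PolyTime f)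
    (hg : PolyTime g) : PolyTime fun a => cond (c a) (f a) (g a) := by
  obtain ⟨p, T, hT, hp⟩ := hf
  obtain ⟨q, U, hU, hq⟩ := hg
  obtain ⟨t, V, hV, ht⟩ := hc
  refine ⟨.seq dup (.seq t (.seq (.pop 0) (.ite (fun v => v == some (some true)) p q))),
    fun a => (20 * size a + 20) + (V a + (1 + (1 + (T a + U a)))), by fun_prop,
    fun a r => (run_dup _ r).seq ((ht a _).seq ?_)⟩
  beta_reduce
  have test : RunTo (.pop 0) (mainStack (word (c a) ++ (word a ++ r))) 1 (some (some (c a)))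
      (mainStack (word a ++ r)) := runTo_popTop _ _
  cases hca : c a <;> rw [hca] at test
  · exact test.seq_ite_false rfl ((hq a r).mono (by omega))
  · exact test.seq_ite_true rfl ((hp a r).mono (by omega))

@[fun_prop] theorem listCases {l : α → List β} {f : α → γ} {g : α → β → List β → γ}
    (hl : PolyTime l) (hf : PolyTime f)
    (hg : PolyTime fun x : α × β × List β => g x.1 x.2.1 x.2.2) :
    PolyTime fun a => (List.casesOn (l a) (f a) (fun b t => g a b t) : γ) := by
  have size_l := hl.polyBounded_size
  obtain ⟨p, T, hT, hp⟩ := hf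
  obtain ⟨q, U, ⟨u, hu⟩, hq⟩ := hg
  obtain ⟨t, V, hV, ht⟩ := hl
  refine ⟨.seq dup (.seq t (.seq (.pop 0) (.ite isNode
    (.seq (.push 0 fun _ => none) (.seq swap (.seq (.push 0 fun _ => none) q))) p))),
    fun a => (20 * size a + 20) + (V a + (1 + (1 + (1 + (30 * (size (l a) + size a + 1) +
      (1 + u.eval (size a + size (l a) + 1))) + T a)))), by fun_prop,
    fun a r => (run_dup _ r).seq ((ht a _).seq ?_)⟩
  beta_reduce
  cases hla : l a with
  | nil => exact (runTo_popTop (some false) _).seq_ite_false rfl ((hp a r).mono (by omega))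
  | cons b s =>
    have test : RunTo (.pop 0) (mainStack (word (b :: s) ++ (word a ++ r))) 1 (some none)
        (mainStack (word b ++ (word s ++ (word a ++ r)))) := by
      rw [word_cons, List.cons_append, List.append_assoc]
      exact runTo_popTop none _
    have swap : Run swap (mainStack (none :: (word b ++ (word s ++ (word a ++ r)))))
        (30 * (size (b, s) + size a + 1)) (mainStack (word a ++ (word (b, s) ++ r))) := by
      refine (run_swap (Enc.tree (b, s)) (Enc.tree a) r).cast ?_ le_rfl rfl
      rw [← List.append_assoc (word b)]
      rfl
    have call : Run q (mainStack (none :: (word a ++ (word (b, s) ++ r)))) (U (a, b, s))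
        (mainStack (word (g a b s) ++ r)) := by
      rw [← List.append_assoc (word a)]
      exact hq (a, b, s) r
    have time := (hu (a, b, s)).trans (eval_mono u (n := size a + size (b :: s) + 1) (by simp))
    refine test.seq_ite_true rfl (((run_pushTop none _).seq
      (swap.seq ((run_pushTop none _).seq call))).mono ?_)
    simp only [size_cons, size_pair] at *
    omega

theorem exists_runTo_test {test : α → Bool} (h : PolyTime test) :
    ∃ (p : TreeProg) (q : Polynomial ℕ), ∀ a r,
      RunTo p (mainStack (word a ++ r)) (q.eval (size a)) (some (some (test a)))
        (mainStack (word a ++ r)) := by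
  obtain ⟨t, V, ⟨w, hw⟩, ht⟩ := h
  refine ⟨.seq dup (.seq t (.pop 0)), 20 * .X + 20 + (w + 1), fun a r =>
    ((run_dup _ r).seqTo ((ht a _).seqTo (runTo_popTop _ _))).mono ?_⟩
  have := hw a
  simp only [Polynomial.eval_add, Polynomial.eval_mul, Polynomial.eval_ofNat, Polynomial.eval_X,
    Polynomial.eval_one]
  exact add_le_add le_rfl (add_le_add this le_rfl)

theorem iterateWhile {start : α → σ} {step : σ → σ} {test : σ → Bool} {N : α → ℕ} {B : α → ℕ}
    (hstart : PolyTime start) (hstep : PolyTime step) (htest : PolyTime test) (hN : PolyBounded N)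
    (hB : PolyBounded B) (hsize : ∀ a, ∀ k ≤ N a, size (step^[k] (start a)) ≤ B a)
    (htrue : ∀ a, ∀ k < N a, test (step^[k] (start a)) = true)
    (hfalse : ∀ a, test (step^[N a] (start a)) = false) :
    PolyTime fun a => step^[N a] (start a) := by
  obtain ⟨p, T, hT, hp⟩ := hstart
  obtain ⟨q, U, ⟨u, hu⟩, hq⟩ := hstep
  obtain ⟨t, w, ht⟩ := htest.exists_runTo_test
  refine ⟨.seq p (.seq t (.loop (fun v => v == some (some true)) (.seq q t))),
    fun a => T a + (w.eval (B a) + (N a * (1 + (u.eval (B a) + w.eval (B a))) + 1)), by fun_prop,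
    fun a r => (hp a r).seq ?_⟩
  have initial := (ht (start a) r).mono (eval_mono w (hsize a 0 (Nat.zero_le _)))
  refine initial.seq_exec (exec_loop_of_forall_lt
    (S := fun i => mainStack (word (step^[i] (start a)) ++ r))
    (r := fun i => some (some (test (step^[i] (start a))))) (fun i hi => ?_) ?_ ?_)
  · have step_time := (hu (step^[i] (start a))).trans (eval_mono u (hsize a i hi.le))
    have test_time := eval_mono w (hsize a (i + 1) hi)
    rw [Function.iterate_succ_apply'] at *
    exact ((hq _ r).seqTo (ht _ r)).mono (add_le_add step_time test_time)
  · exact fun i hi => by rw [htrue a i hi]; rfl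
  · rw [hfalse a]; rfl

end PolyTime

end PolynomialTime

/-! ### Lists -/

section Lists

variable {α β γ : Type}

/-- One step of a fold; the state consists of a parameter, the accumulator, and the entries not yet
processed. -/
def foldStep (s : α → γ → β → γ) (x : α × γ × List β) : α × γ × List β :=
  List.casesOn x.2.2 x fun b t => (x.1, s x.1 x.2.1 b, t)

theorem iterate_foldStep (s : α → γ → β → γ) (a : α) (c : γ) (l : List β) {k : ℕ}
    (hk : k ≤ l.length) :
    (foldStep s)^[k] (a, c, l) = (a, (l.take k).foldl (s a) c, l.drop k) := by
  induction k with
  | zero => rfl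
  | succ k ih =>
    rw [Function.iterate_succ_apply', ih (by omega), List.drop_eq_getElem_cons (by omega), foldStep,
      List.take_succ_eq_append_getElem (by omega), List.foldl_append]
    rfl

theorem foldl_dropWhile_eq (f : β → Bool) (l c : List β) :
    l.foldl (fun c b => cond (c.isEmpty && f b) c (b :: c)) c =
      cond c.isEmpty (l.dropWhile f).reverse (l.reverse ++ c) := by
  induction l generalizing c with
  | nil => cases c <;> rfl
  | cons b l ih => cases c <;> cases h : f b <;> simp [h, ih]

variable [Enc α] [Enc γ]

theorem size_tail_le (l : List α) : size l.tail ≤ size l := by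
  cases l with
  | nil => exact le_rfl
  | cons a l => rw [List.tail_cons, size_cons]; omega

theorem size_drop_le (k : ℕ) (l : List α) : size (l.drop k) ≤ size l := by
  induction k generalizing l with
  | zero => exact le_rfl
  | succ k ih => rw [← List.drop_tail]; exact (ih _).trans (size_tail_le l)

theorem size_append (l m : List α) : size (l ++ m) + 1 = size l + size m := by
  induction l with
  | nil => rw [List.nil_append, size_nil, add_comm]
  | cons a l ih => rw [List.cons_append, size_cons, size_cons]; omega

theorem size_foldl_le {s : γ → β → γ} {l : List β} {e : ℕ}
    (h : ∀ c, ∀ b ∈ l, size (s c b) ≤ size c + e) (c : γ) :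
    size (l.foldl s c) ≤ size c + l.length * e := by
  induction l generalizing c with
  | nil => simp
  | cons b l ih =>
    have first := h c b (by simp)
    have rest := ih (fun c b hb => h c b (List.mem_cons_of_mem _ hb)) (s c b)
    rw [List.foldl_cons, List.length_cons, add_mul]
    omega

variable [Enc β]

namespace PolyTime

theorem foldl_of_bound {l : α → List β} {i : α → γ} {s : α → γ → β → γ} (hl : PolyTime l)
    (hi : PolyTime i) (hs : PolyTime fun x : α × γ × β => s x.1 x.2.1 x.2.2) {B : α → ℕ}
    (hB : PolyBounded B) (h : ∀ a l', l' <+: l a → size (l'.foldl (s a) (i a)) ≤ B a) :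
    PolyTime fun a => (l a).foldl (s a) (i a) := by
  have size_l := hl.polyBounded_size
  have step : PolyTime (foldStep s) := by
    have : PolyTime fun x : (α × γ × List β) × β × List β => s x.1.1 x.1.2.1 x.2.1 :=
      hs.comp (f := fun x : (α × γ × List β) × β × List β => (x.1.1, x.1.2.1, x.2.1)) (by fun_prop)
    unfold foldStep
    fun_prop
  have fold := iterateWhile (start := fun a => (a, i a, l a)) (N := fun a => (l a).length)
    (test := fun x => (List.casesOn x.2.2 false fun _ _ => true : Bool))
    (B := fun a => size a + (B a + size (l a) + 1) + 1) (by fun_prop) step (by fun_prop)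
    (size_l.mono fun a => (length_lt_size _).le) (by fun_prop)
    (fun a k hk => by
      have acc := h a _ ⟨_, List.take_append_drop k (l a)⟩
      have rest := size_drop_le k (l a)
      simp only [iterate_foldStep s _ _ _ hk, size_pair]
      omega)
    (fun a k hk => by rw [iterate_foldStep s _ _ _ hk.le, List.drop_eq_getElem_cons hk])
    (fun a => by rw [iterate_foldStep s _ _ _ le_rfl, List.drop_length])
  exact fold.snd.fst.of_eq fun a => by rw [iterate_foldStep s _ _ _ le_rfl, List.take_length]

theorem foldl_of_add {l : α → List β} {i : α → γ} {s : α → γ → β → γ} (hl : PolyTime l)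
    (hi : PolyTime i) (hs : PolyTime fun x : α × γ × β => s x.1 x.2.1 x.2.2) {e : α → ℕ}
    (he : PolyBounded e) (h : ∀ a c, ∀ b ∈ l a, size (s a c b) ≤ size c + e a) :
    PolyTime fun a => (l a).foldl (s a) (i a) := by
  have size_l := hl.polyBounded_size
  have size_i := hi.polyBounded_size
  refine foldl_of_bound hl hi hs (B := fun a => size (i a) + size (l a) * e a) (by fun_prop)
    fun a l' hl' => ?_
  have length_le := hl'.length_le.trans (length_lt_size (l a)).le
  exact (size_foldl_le (fun c b hb => h a c b (hl'.subset hb)) _).trans (by gcongr)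

theorem exists_polyBounded_forall_mem_le {l : α → List β} (hl : PolyTime l) {g : α → β → ℕ}
    (hg : PolyBounded fun x : α × β => g x.1 x.2) :
    ∃ e : α → ℕ, PolyBounded e ∧ ∀ a, ∀ b ∈ l a, g a b ≤ e a := by
  obtain ⟨q, hq⟩ := hg
  have size_l := hl.polyBounded_size
  refine ⟨fun a => q.eval (size a + size (l a) + 1), by fun_prop, fun a b hb => ?_⟩
  refine (hq (a, b)).trans (eval_mono q ?_)
  have := size_lt_of_mem hb
  simp only [size_pair]
  omega

@[fun_prop] theorem or {f g : α → Bool} (hf : PolyTime f) (hg : PolyTime g) :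
    PolyTime fun a => f a || g a :=
  (hf.cond (const true) hg).of_eq fun a => by cases f a <;> rfl

@[fun_prop] theorem and {f g : α → Bool} (hf : PolyTime f) (hg : PolyTime g) :
    PolyTime fun a => f a && g a :=
  (hf.cond hg (const false)).of_eq fun a => by cases f a <;> rfl

@[fun_prop] theorem not {f : α → Bool} (hf : PolyTime f) : PolyTime fun a => !f a :=
  (hf.cond (const false) (const true)).of_eq fun a => by cases f a <;> rfl

@[fun_prop] theorem any {l : α → List β} {f : α → β → Bool} (hl : PolyTime l)
    (hf : PolyTime fun x : α × β => f x.1 x.2) : PolyTime fun a => (l a).any (f a) := by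
  have step : PolyTime fun x : α × Bool × β => x.2.1 || f x.1 x.2.2 :=
    .or (by fun_prop) (hf.comp₂ (by fun_prop) (by fun_prop))
  have foldl_eq (a : α) (m : List β) (c : Bool) :
      m.foldl (fun c b => c || f a b) c = (c || m.any (f a)) := by
    induction m generalizing c with
    | nil => exact (Bool.or_false c).symm
    | cons b m ih => rw [List.foldl_cons, ih, List.any_cons, Bool.or_assoc]
  exact (foldl_of_add (s := fun a c b => c || f a b) hl (const false) step (.const 0)
    fun _ _ _ _ => le_rfl).of_eq fun a => (foldl_eq a _ false).symm

@[fun_prop] theorem all {l : α → List β} {f : α → β → Bool} (hl : PolyTime l)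
    (hf : PolyTime fun x : α × β => f x.1 x.2) : PolyTime fun a => (l a).all (f a) :=
  (hl.any (f := fun a b => !f a b) hf.not).not.of_eq fun _ => List.all_eq_not_any_not ..

@[fun_prop] theorem reverse {l : α → List β} (hl : PolyTime l) : PolyTime fun a => (l a).reverse :=
  (foldl_of_add (s := fun _ c b => b :: c) hl (const []) (by fun_prop) hl.polyBounded_size
    fun a c b hb => by have := size_lt_of_mem hb; rw [size_cons]; omega).of_eq
    fun a => by rw [List.foldl_flip_cons_eq_append, List.map_id', List.append_nil]

@[fun_prop] theorem append {l m : α → List β} (hl : PolyTime l) (hm : PolyTime m) :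
    PolyTime fun a => l a ++ m a :=
  (foldl_of_add (s := fun _ c b => b :: c) hl.reverse hm (by fun_prop) hl.reverse.polyBounded_size
    fun a c b hb => by have := size_lt_of_mem hb; rw [size_cons]; omega).of_eq
    fun a => by rw [List.foldl_flip_cons_eq_append, List.map_id', List.reverse_reverse]

@[fun_prop] theorem flatMap {l : α → List β} {f : α → β → List γ} (hl : PolyTime l)
    (hf : PolyTime fun x : α × β => f x.1 x.2) : PolyTime fun a => (l a).flatMap (f a) := by
  obtain ⟨e, he, size_f⟩ :=
    exists_polyBounded_forall_mem_le hl (g := fun a b => size (f a b)) hf.polyBounded_size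
  have step : PolyTime fun x : α × List γ × β => x.2.1 ++ f x.1 x.2.2 :=
    .append (by fun_prop) (hf.comp₂ (by fun_prop) (by fun_prop))
  exact (foldl_of_add (s := fun a c b => c ++ f a b) hl (const []) step he fun a c b hb => by
    have := size_f a b hb; have := size_append c (f a b); omega).of_eq
    fun a => List.flatMap_eq_foldl

@[fun_prop] theorem map {l : α → List β} {f : α → β → γ} (hl : PolyTime l)
    (hf : PolyTime fun x : α × β => f x.1 x.2) : PolyTime fun a => (l a).map (f a) :=
  (hl.flatMap (f := fun a b => [f a b]) (by fun_prop)).of_eq fun _ => List.map_eq_flatMap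

@[fun_prop] theorem filter {l : α → List β} {f : α → β → Bool} (hl : PolyTime l)
    (hf : PolyTime fun x : α × β => f x.1 x.2) : PolyTime fun a => (l a).filter (f a) :=
  (hl.flatMap (f := fun a b => cond (f a b) [b] []) (by fun_prop)).of_eq fun a => by
    induction l a with
    | nil => rfl
    | cons b m ih => cases h : f a b <;> simp [h, ih]

@[fun_prop] theorem headD {l : α → List β} {d : α → β} (hl : PolyTime l) (hd : PolyTime d) :
    PolyTime fun a => (l a).headD (d a) :=
  (hl.listCases hd (g := fun _ b _ => b) (by fun_prop)).of_eq fun a => by cases l a <;> rfl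

@[fun_prop] theorem tail {l : α → List β} (hl : PolyTime l) : PolyTime fun a => (l a).tail :=
  (hl.listCases (const []) (g := fun _ _ t => t) (by fun_prop)).of_eq fun a => by cases l a <;> rfl

@[fun_prop] theorem isEmpty {l : α → List β} (hl : PolyTime l) : PolyTime fun a => (l a).isEmpty :=
  (hl.listCases (const true) (g := fun _ _ _ => false) (by fun_prop)).of_eq fun a => by
    cases l a <;> rfl

@[fun_prop] theorem takeWhile {l : α → List β} {f : α → β → Bool} (hl : PolyTime l)
    (hf : PolyTime fun x : α × β => f x.1 x.2) : PolyTime fun a => (l a).takeWhile (f a) := by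
  have : PolyTime fun x : α × List β × β => f x.1 x.2.2 :=
    hf.comp₂ (by fun_prop) (by fun_prop)
  refine (foldl_of_add (s := fun a c b => cond (f a b) (b :: c) []) hl.reverse (const [])
    (by fun_prop) hl.reverse.polyBounded_size fun a c b hb => ?_).of_eq fun a => ?_
  · have := size_lt_of_mem hb
    have := size_pos c
    cases f a b
    · rw [cond_false, size_nil]; omega
    · rw [cond_true, size_cons]; omega
  · rw [List.foldl_reverse]
    induction l a with
    | nil => rfl
    | cons b m ih => cases h : f a b <;> simp [h, ih]

@[fun_prop] theorem dropWhile {l : α → List β} {f : α → β → Bool} (hl : PolyTime l)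
    (hf : PolyTime fun x : α × β => f x.1 x.2) : PolyTime fun a => (l a).dropWhile (f a) := by
  have : PolyTime fun x : α × List β × β => f x.1 x.2.2 :=
    hf.comp₂ (by fun_prop) (by fun_prop)
  refine (foldl_of_add (s := fun a c b => cond (c.isEmpty && f a b) c (b :: c)) hl (const [])
    (by fun_prop) hl.polyBounded_size fun a c b hb => ?_).reverse.of_eq fun a => ?_
  · have := size_lt_of_mem hb
    cases c.isEmpty && f a b
    · rw [cond_false, size_cons]; omega
    · rw [cond_true]; omega
  · rw [foldl_dropWhile_eq, List.isEmpty_nil, cond_true, List.reverse_reverse]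

end PolyTime

/-! ### Natural numbers -/

theorem size_bools (l : List Bool) : size l = 2 * l.length + 1 := by
  induction l with
  | nil => rfl
  | cons b l ih => rw [size_cons, size_bool, ih, List.length_cons]; ring

theorem size_nat_eq (n : ℕ) : size n = 2 * n.size + 1 := by
  rw [size_nat, size_bools, Nat.size_eq_bits_len]

theorem size_nat_mono {m n : ℕ} (h : m ≤ n) : size m ≤ size n := by
  have := Nat.size_le_size h
  rw [size_nat_eq, size_nat_eq]
  omega

theorem size_mul_le (m n : ℕ) : size (m * n) ≤ size m + size n := by
  have : (m * n).size ≤ m.size + n.size := by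
    rw [Nat.size_le, pow_add]
    exact Nat.mul_lt_mul'' (Nat.lt_size_self m) (Nat.lt_size_self n)
  simp only [size_nat_eq]
  omega

theorem size_add_le (m n : ℕ) : size (m + n) ≤ size m + size n := by
  rcases Nat.eq_zero_or_pos m with rfl | hm
  · simp
  rcases Nat.eq_zero_or_pos n with rfl | hn
  · simp
  have size_add : (m + n).size ≤ m.size + n.size := by
    have lt_m := Nat.lt_size_self m
    have lt_n := Nat.lt_size_self n
    have : 2 ≤ 2 ^ m.size := le_self_pow₀ one_le_two (Nat.size_pos.2 hm).ne'
    have : 2 ≤ 2 ^ n.size := le_self_pow₀ one_le_two (Nat.size_pos.2 hn).ne'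
    rw [Nat.size_le, pow_add]
    nlinarith
  simp only [size_nat_eq]
  omega

namespace PolyTime

theorem of_bits {f : α → ℕ} (h : PolyTime fun a => (f a).bits) : PolyTime f := h

@[fun_prop] theorem bits {f : α → ℕ} (h : PolyTime f) : PolyTime fun a => (f a).bits := h

@[fun_prop] theorem natBit {b : α → Bool} {f : α → ℕ} (hb : PolyTime b) (hf : PolyTime f) :
    PolyTime fun a => Nat.bit (b a) (f a) := by
  have bits : PolyTime fun a => (List.casesOn (f a).bits (cond (b a) [true] [])
    fun c t => b a :: c :: t : List Bool) := by fun_prop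
  refine of_bits (bits.of_eq fun a => ?_)
  rcases Nat.eq_zero_or_pos (f a) with h | h
  · cases hb : b a <;> simp [h]
  · rw [Nat.bits_append_bit _ _ (by omega)]
    cases hbits : (f a).bits with
    | nil => exact absurd (Nat.size_pos.2 h) (by simp [← Nat.size_eq_bits_len, hbits])
    | cons c t => rfl

@[fun_prop] theorem div2 {f : α → ℕ} (hf : PolyTime f) : PolyTime fun a => (f a).div2 :=
  of_bits (hf.bits.tail.of_eq fun _ => Nat.div2_bits_eq_tail _)

@[fun_prop] theorem bodd {f : α → ℕ} (hf : PolyTime f) : PolyTime fun a => (f a).bodd :=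
  (hf.bits.headD (const false)).of_eq fun a => by
    rw [Nat.bodd_eq_bits_head]; cases (f a).bits <;> rfl

end PolyTime

end Lists

/-! ### Arithmetic in binary -/

section Binary

theorem size_div2_le (n : ℕ) : size n.div2 ≤ size n := by
  rw [Nat.div2_val]
  exact size_nat_mono (Nat.div_le_self n 2)

theorem size_bit_le (b : Bool) (n : ℕ) : size (Nat.bit b n) ≤ size n + 2 := by
  have : (Nat.bit b n).size ≤ n.size + 1 := by
    by_cases h : Nat.bit b n = 0
    · simp [h]
    · rw [Nat.size_bit h]
  rw [size_nat_eq, size_nat_eq]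
  omega

/-- The state of a digit-wise operation: the rests of the two arguments, a carry bit, and the digits
computed so far, the most significant first. -/
abbrev DigitState := ℕ × ℕ × Bool × List Bool

/-- One digit of a binary operation: `f` is the new carry, the new digit is the parity. -/
def digitStep (f : Bool → Bool → Bool → Bool) (s : DigitState) : DigitState :=
  (s.1.div2, s.2.1.div2, f s.1.bodd s.2.1.bodd s.2.2.1,
    (xor (xor s.1.bodd s.2.1.bodd) s.2.2.1) :: s.2.2.2)

/-- The state of the digit-wise operation with carry function `f` after all digits of `x` and
`y`. -/
def digits (f : Bool → Bool → Bool → Bool) (x y : ℕ) : DigitState :=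
  (x.bits ++ y.bits).foldl (fun s _ => digitStep f s) (x, y, false, [])

/-- The number with the given digits, the most significant first, and the leading part `c`. -/
def ofDigits (l : List Bool) (c : ℕ) : ℕ := l.foldl (fun n b => Nat.bit b n) c

theorem div2_iterate (k x : ℕ) : Nat.div2^[k] x = x / 2 ^ k := by
  induction k generalizing x with
  | zero => simp
  | succ k ih =>
    rw [Function.iterate_succ_apply, ih, Nat.div2_val, Nat.div_div_eq_div_mul, pow_succ']

theorem div2_iterate_eq_zero {x k : ℕ} (h : x.size ≤ k) : Nat.div2^[k] x = 0 := by
  rw [div2_iterate, Nat.div_eq_of_lt]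
  exact (Nat.lt_size_self x).trans_le (Nat.pow_le_pow_right two_pos h)

theorem foldl_digitStep (f : Bool → Bool → Bool → Bool) (l : List Bool) (s : DigitState) :
    (l.foldl (fun s _ => digitStep f s) s).1 = Nat.div2^[l.length] s.1 ∧
      (l.foldl (fun s _ => digitStep f s) s).2.1 = Nat.div2^[l.length] s.2.1 := by
  induction l generalizing s with
  | nil => exact ⟨rfl, rfl⟩
  | cons _ _ ih => exact ih (digitStep f s)

theorem digits_zero (f : Bool → Bool → Bool → Bool) (x y : ℕ) :
    (digits f x y).1 = 0 ∧ (digits f x y).2.1 = 0 := by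
  obtain ⟨fst_eq, snd_eq⟩ := foldl_digitStep f (x.bits ++ y.bits) (x, y, false, [])
  have length_eq : (x.bits ++ y.bits).length = x.size + y.size := by
    rw [List.length_append, Nat.size_eq_bits_len, Nat.size_eq_bits_len]
  rw [digits, fst_eq, snd_eq, length_eq]
  exact ⟨div2_iterate_eq_zero (Nat.le_add_right ..), div2_iterate_eq_zero (Nat.le_add_left ..)⟩

theorem digits_induction {f : Bool → Bool → Bool → Bool} {x y : ℕ} (P : DigitState → Prop)
    (h : P (x, y, false, [])) (hs : ∀ s, P s → P (digitStep f s)) : P (digits f x y) := by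
  unfold digits
  generalize (x, y, false, []) = s at h
  generalize x.bits ++ y.bits = l
  induction l generalizing s with
  | nil => exact h
  | cons b _ ih => exact ih _ (hs _ h)

/-- The carry of an addition. -/
def carry (a b c : Bool) : Bool := cond a (b || c) (b && c)

/-- The borrow of a subtraction; the last borrow decides the comparison. -/
def borrow (a b c : Bool) : Bool := cond a (b && c) (b || c)

theorem add_eq_bit_add_carry (u v : ℕ) (c : Bool) :
    u + v + c.toNat = Nat.bit (xor (xor u.bodd v.bodd) c)
      (u.div2 + v.div2 + (carry u.bodd v.bodd c).toNat) := by
  conv_lhs => rw [← Nat.bit_bodd_div2 u, ← Nat.bit_bodd_div2 v]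
  cases u.bodd <;> cases v.bodd <;> cases c <;>
    simp [Nat.bit_val, carry] <;> omega

theorem lt_add_iff_borrow (u v : ℕ) (c : Bool) :
    u < v + c.toNat ↔ u.div2 < v.div2 + (borrow u.bodd v.bodd c).toNat := by
  conv_lhs => rw [← Nat.bit_bodd_div2 u, ← Nat.bit_bodd_div2 v]
  cases u.bodd <;> cases v.bodd <;> cases c <;>
    simp [Nat.bit_val, borrow] <;> omega

theorem sub_eq_bit_sub_borrow {u v : ℕ} {c : Bool} (h : v + c.toNat ≤ u) :
    u - (v + c.toNat) = Nat.bit (xor (xor u.bodd v.bodd) c)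
      (u.div2 - (v.div2 + (borrow u.bodd v.bodd c).toNat)) := by
  have bit_u := Nat.bit_bodd_div2 u
  have bit_v := Nat.bit_bodd_div2 v
  generalize u.div2 = u', v.div2 = v', u.bodd = p, v.bodd = q at bit_u bit_v ⊢
  subst bit_u bit_v
  cases p <;> cases q <;> cases c <;> simp [Nat.bit_val, borrow] at h ⊢ <;> omega

theorem digits_carry (x y : ℕ) :
    ofDigits (digits carry x y).2.2.2 (digits carry x y).2.2.1.toNat = x + y := by
  have invariant := digits_induction (f := carry) (x := x) (y := y)
    (fun s => ofDigits s.2.2.2 (s.1 + s.2.1 + s.2.2.1.toNat) = x + y) rfl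
    fun s h => by rwa [add_eq_bit_add_carry] at h
  rwa [(digits_zero carry x y).1, (digits_zero carry x y).2, zero_add, zero_add] at invariant

theorem digits_borrow_lt (x y : ℕ) : (digits borrow x y).2.2.1 = decide (x < y) := by
  have invariant := digits_induction (f := borrow) (x := x) (y := y)
    (fun s => s.1 < s.2.1 + s.2.2.1.toNat ↔ x < y) Iff.rfl
    fun s h => by rwa [lt_add_iff_borrow] at h
  rw [(digits_zero borrow x y).1, (digits_zero borrow x y).2] at invariant
  rw [Bool.eq_iff_iff, decide_eq_true_iff, ← invariant]
  cases (digits borrow x y).2.2.1 <;> simp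

theorem digits_borrow_sub {x y : ℕ} (h : y ≤ x) : ofDigits (digits borrow x y).2.2.2 0 = x - y := by
  have invariant := digits_induction (f := borrow) (x := x) (y := y)
    (fun s => s.2.1 + s.2.2.1.toNat ≤ s.1 ∧
      ofDigits s.2.2.2 (s.1 - (s.2.1 + s.2.2.1.toNat)) = x - y) ⟨h, rfl⟩
    fun s ⟨le, eq⟩ => by
      refine ⟨not_lt.1 ((lt_add_iff_borrow ..).not.1 (not_lt.2 le)), ?_⟩
      rwa [sub_eq_bit_sub_borrow le] at eq
  rw [(digits_zero borrow x y).1, zero_tsub] at invariant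
  exact invariant.2

variable {α β : Type} [Enc α] [Enc β]

namespace PolyTime

@[fun_prop] theorem xor {f g : α → Bool} (hf : PolyTime f) (hg : PolyTime g) :
    PolyTime fun a => Bool.xor (f a) (g a) :=
  (hf.cond hg.not hg).of_eq fun a => by cases f a <;> simp

theorem digits {c : Bool → Bool → Bool → Bool}
    (hc : PolyTime fun x : Bool × Bool × Bool => c x.1 x.2.1 x.2.2) {f g : α → ℕ} (hf : PolyTime f)
    (hg : PolyTime g) : PolyTime fun a => digits c (f a) (g a) := by
  have step : PolyTime fun x : α × DigitState × Bool => digitStep c x.2.1 := by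
    have : PolyTime fun x : α × DigitState × Bool => c x.2.1.1.bodd x.2.1.2.1.bodd x.2.1.2.2.1 :=
      hc.comp (f := fun x : α × DigitState × Bool =>
        (x.2.1.1.bodd, x.2.1.2.1.bodd, x.2.1.2.2.1)) (by fun_prop)
    unfold digitStep
    fun_prop
  refine foldl_of_add (s := fun _ s _ => digitStep c s) (by fun_prop) (by fun_prop) step (.const 2)
    ?_
  rintro _ ⟨x, y, z, l⟩ _ _
  have := size_div2_le x
  have := size_div2_le y
  simp only [digitStep, size_pair, size_cons, size_bool]
  omega

theorem ofDigits {l : α → List Bool} {f : α → ℕ} (hl : PolyTime l) (hf : PolyTime f) :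
    PolyTime fun a => ofDigits (l a) (f a) :=
  foldl_of_add (s := fun _ n b => Nat.bit b n) hl hf (by fun_prop) (.const 2)
    fun _ n b _ => size_bit_le b n

@[fun_prop] theorem natAdd {f g : α → ℕ} (hf : PolyTime f) (hg : PolyTime g) :
    PolyTime fun a => f a + g a := by
  have digits_carry := digits (c := carry) (by unfold carry; fun_prop) hf hg
  exact (ofDigits (l := fun a => (HiWRAC.digits carry (f a) (g a)).2.2.2)
    (f := fun a => cond (HiWRAC.digits carry (f a) (g a)).2.2.1 1 0) (by fun_prop)
    (by fun_prop)).of_eq fun a => (HiWRAC.digits_carry _ _).symm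

@[fun_prop] theorem decideLt {f g : α → ℕ} (hf : PolyTime f) (hg : PolyTime g) :
    PolyTime fun a => decide (f a < g a) :=
  (digits (c := borrow) (by unfold borrow; fun_prop) hf hg).snd.snd.fst.of_eq
    fun _ => (digits_borrow_lt _ _).symm

@[fun_prop] theorem decideLe {f g : α → ℕ} (hf : PolyTime f) (hg : PolyTime g) :
    PolyTime fun a => decide (f a ≤ g a) :=
  (hg.decideLt hf).not.of_eq fun a => by rw [← decide_not, decide_eq_decide, not_lt]

@[fun_prop] theorem natBeq {f g : α → ℕ} (hf : PolyTime f) (hg : PolyTime g) :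
    PolyTime fun a => f a == g a :=
  ((hf.decideLe hg).and (hg.decideLe hf)).of_eq fun a => by
    rw [Bool.eq_iff_iff, beq_iff_eq, Bool.and_eq_true, decide_eq_true_iff, decide_eq_true_iff]
    omega

@[fun_prop] theorem natBne {f g : α → ℕ} (hf : PolyTime f) (hg : PolyTime g) :
    PolyTime fun a => f a != g a :=
  (hf.natBeq hg).not

@[fun_prop] theorem natSub {f g : α → ℕ} (hf : PolyTime f) (hg : PolyTime g) :
    PolyTime fun a => f a - g a := by
  have digits_borrow := digits (c := borrow) (by unfold borrow; fun_prop) hf hg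
  have difference := ofDigits (l := fun a => (HiWRAC.digits borrow (f a) (g a)).2.2.2)
    (f := fun _ => 0) (by fun_prop) (by fun_prop)
  refine ((hf.decideLt hg).cond (const 0) difference).of_eq fun a => ?_
  by_cases h : f a < g a
  · rw [decide_eq_true h, cond_true, Nat.sub_eq_zero_of_le h.le]
  · rw [decide_eq_false h, cond_false, digits_borrow_sub (not_lt.1 h)]

@[fun_prop] theorem natMax {f g : α → ℕ} (hf : PolyTime f) (hg : PolyTime g) :
    PolyTime fun a => max (f a) (g a) :=
  (hf.natAdd (hg.natSub hf)).of_eq fun a => by omega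

@[fun_prop] theorem natMul {f g : α → ℕ} (hf : PolyTime f) (hg : PolyTime g) :
    PolyTime fun a => f a * g a := by
  have size_f := hf.polyBounded_size
  have step : PolyTime fun x : α × ℕ × Bool => Nat.bit false x.2.1 + cond x.2.2 (f x.1) 0 := by
    fun_prop
  refine (foldl_of_add (s := fun a c b => Nat.bit false c + cond b (f a) 0) hg.bits.reverse
    (const 0) step (e := fun a => size (f a) + 2) (by fun_prop) fun a c b _ => ?_).of_eq fun a => ?_
  · have := size_bit_le false c
    have := size_add_le (Nat.bit false c) (cond b (f a) 0)
    have : size (cond b (f a) 0) ≤ size (f a) := size_nat_mono (by cases b <;> simp)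
    omega
  · rw [List.foldl_reverse]
    induction g a using Nat.binaryRec' with
    | zero => simp
    | bit b n h ih =>
      rw [Nat.bits_append_bit _ _ h, List.foldr_cons, ← ih, Nat.bit_val, Nat.bit_val]
      cases b
      · simp only [cond_false, Bool.toNat_false]; ring
      · simp only [cond_true, Bool.toNat_true, Bool.toNat_false]; ring

/-! ### Indexing -/

theorem foldl_cond_tail {β γ : Type} (l : List β) (m : List γ) (n : ℕ) :
    (l.foldl (fun s _ => cond (s.1 == 0) s (s.1 - 1, s.2.tail)) (n, m)).2 =
      m.drop (min n l.length) := by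
  induction l generalizing n m with
  | nil => simp
  | cons b l ih =>
    rw [List.foldl_cons]
    cases n with
    | zero => exact (ih m 0).trans (by simp)
    | succ n =>
      rw [List.length_cons, Nat.add_min_add_right, ← List.drop_tail]
      exact ih _ _

@[fun_prop] theorem drop {f : α → ℕ} {l : α → List β} (hf : PolyTime f) (hl : PolyTime l) :
    PolyTime fun a => (l a).drop (f a) := by
  refine (foldl_of_add (l := l) (i := fun a => (f a, l a))
    (s := fun _ s _ => cond (s.1 == 0) s (s.1 - 1, s.2.tail)) hl (by fun_prop) (by fun_prop)
    (.const 0) ?_).snd.of_eq fun a => ?_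
  · rintro _ ⟨n, m⟩ _ _
    have := size_nat_mono (Nat.sub_le n 1)
    have := size_tail_le m
    cases n == 0
    · simp only [cond_false, size_pair]; omega
    · exact le_rfl
  · rw [foldl_cond_tail]
    rcases le_total (f a) (l a).length with h | h
    · rw [min_eq_left h]
    · rw [min_eq_right h, List.drop_eq_nil_of_le h, List.drop_length]

@[fun_prop] theorem getD {f : α → ℕ} {l : α → List β} {d : α → β} (hl : PolyTime l)
    (hf : PolyTime f) (hd : PolyTime d) : PolyTime fun a => (l a).getD (f a) (d a) :=
  ((hf.drop hl).headD hd).of_eq fun a => by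
    rw [List.headD_eq_head?_getD, List.head?_drop, List.getD_eq_getElem?_getD]

@[fun_prop] theorem length {l : α → List β} (hl : PolyTime l) : PolyTime fun a => (l a).length :=
  (foldl_of_add (s := fun _ c _ => c + 1) hl (const 0) (by fun_prop) (.const 3)
    fun _ c _ _ => size_add_le c 1).of_eq fun a => by
    rw [← List.length_reverse, ← List.foldr_reverse]
    induction (l a).reverse with
    | nil => rfl
    | cons b m ih => rw [List.length_cons, ih, List.foldr_cons]

@[fun_prop] theorem take {f : α → ℕ} {l : α → List β} (hf : PolyTime f) (hl : PolyTime l) :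
    PolyTime fun a => (l a).take (f a) := by
  refine ((hl.length.natSub hf).drop hl.reverse).reverse.of_eq fun a => ?_
  rw [List.drop_reverse, List.reverse_reverse]
  rcases le_total (f a) (l a).length with h | h
  · congr 1; omega
  · rw [List.take_of_length_le h, List.take_of_length_le (by omega)]

end PolyTime

theorem size_range_le (m : ℕ) : size (List.range m) ≤ m * (2 * m + 2) + 1 := by
  induction m with
  | zero => exact le_rfl
  | succ m ih =>
    have append := size_append (List.range m) [m]
    have size_le : m.size ≤ m := Nat.size_le.2 Nat.lt_two_pow_self
    rw [List.range_succ]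
    simp only [size_cons, size_nil, size_nat_eq] at append
    nlinarith

theorem foldl_append_length {β : Type} (m : List β) :
    m.foldl (fun c _ => c ++ [c.length]) [] = List.range m.length := by
  induction m using List.reverseRecOn with
  | nil => rfl
  | append_singleton m b ih => simp [ih, List.range_succ]

namespace PolyTime

@[fun_prop] theorem rangeLength {l : α → List β} (hl : PolyTime l) :
    PolyTime fun a => List.range (l a).length := by
  have size_l := hl.polyBounded_size
  refine (foldl_of_bound (s := fun _ c _ => c ++ [c.length]) hl (const ([] : List ℕ)) (by fun_prop)
    (B := fun a => size (l a) * (2 * size (l a) + 2) + 1) (by fun_prop) fun a l' h => ?_).of_eq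
    fun a => (foldl_append_length _).symm
  have : l'.length ≤ size (l a) := h.length_le.trans (length_lt_size (l a)).le
  rw [foldl_append_length]
  exact (size_range_le _).trans (by gcongr)

@[fun_prop] theorem listSum {l : α → List ℕ} (hl : PolyTime l) : PolyTime fun a => (l a).sum :=
  (foldl_of_add (s := fun _ c b => c + b) hl (const 0) (by fun_prop) hl.polyBounded_size
    fun a c b h => (size_add_le c b).trans (by have := size_lt_of_mem h; omega)).of_eq
    fun _ => List.sum_eq_foldl

@[fun_prop] theorem listProd {l : α → List ℕ} (hl : PolyTime l) : PolyTime fun a => (l a).prod :=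
  (foldl_of_add (s := fun _ c b => c * b) hl (const 1) (by fun_prop) hl.polyBounded_size
    fun a c b h => (size_mul_le c b).trans (by have := size_lt_of_mem h; omega)).of_eq
    fun _ => List.prod_eq_foldl

end PolyTime

end Binary

/-! ### Input and output -/

instance {α : Type} [Enc α] : Enc (Option α) := ⟨fun o => Enc.tree o.toList⟩

namespace Prog

/-- The loop of `read`: encode the word whose head is in the register and whose tail is on
stack `1`. -/
def readLoop : TreeProg :=
  .loop Option.isSome (.seq (.push 0 fun _ => some false) (.seq (.ite isNode (.push 0 fun _ => none)
    (.seq (.push 0 fun v => v.getD none) (.seq (.push 0 fun _ => none) (.push 0 fun _ => none))))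
    (.pop 1)))

theorem exec_readLoop (l w : List Letter) :
    ∃ m ≤ 7 * l.length + 1, Exec readLoop l.head? ![word w, l.tail, [], []] m none
      (mainStack (word (l.reverse ++ w))) := by
  induction l generalizing w with
  | nil => exact ⟨1, le_rfl, .loop_false rfl⟩
  | cons s l ih =>
    obtain ⟨m, hm, rest⟩ := ih (s :: w)
    rw [List.reverse_cons, List.append_assoc, List.singleton_append, List.length_cons]
    have close_list : Exec (.push 0 fun _ => some false) (some s) ![word w, l, [], []] 1 (some s)
      ![some false :: word w, l, [], []] := .push_eq (update_vec_zero ..)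
    have pop : Exec (.pop 1) (some s) ![word (s :: w), l, [], []] 1 l.head?
      ![word (s :: w), l.tail, [], []] := .pop_eq rfl (update_vec_one ..)
    cases s with
    | none =>
      have push : Exec (.push 0 fun _ => none) (some none) ![some false :: word w, l, [], []] 1
        (some none) ![none :: some false :: word w, l, [], []] := .push_eq (update_vec_zero ..)
      exact ⟨_, by omega, .loop_true (c := Option.isSome) rfl
        (close_list.seq ((push.ite_true (c := isNode) rfl).seq pop)) rest⟩
    | some b =>
      have push_bit : Exec (.push 0 fun v => v.getD none) (some (some b))
        ![some false :: word w, l, [], []] 1 (some (some b))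
        ![some b :: some false :: word w, l, [], []] := .push_eq (update_vec_zero ..)
      have push_node : Exec (.push 0 fun _ => none) (some (some b))
        ![some b :: some false :: word w, l, [], []] 1 (some (some b))
        ![none :: some b :: some false :: word w, l, [], []] := .push_eq (update_vec_zero ..)
      have push_node' : Exec (.push 0 fun _ => none) (some (some b))
        ![none :: some b :: some false :: word w, l, [], []] 1 (some (some b))
        ![none :: none :: some b :: some false :: word w, l, [], []] :=
        .push_eq (update_vec_zero ..)
      exact ⟨_, by omega, .loop_true (c := Option.isSome) rfl (close_list.seq
        (((push_bit.seq (push_node.seq push_node')).ite_false (c := isNode) rfl).seq pop)) rest⟩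

/-- Replace the word on stack `2` by the tree that encodes it, on stack `0`. -/
def read : TreeProg :=
  .seq (pour 2 1) (.seq (.push 0 fun _ => some false) (.seq (.pop 1) readLoop))

theorem run_read (w : List Letter) :
    Run read ![[], [], w, []] (10 * w.length + 10) (mainStack (word w)) := by
  have pour := (runTo_pour (i := 2) (j := 1) (by decide) ![[], [], w, []]).run
  rw [update_vec_two, update_vec_one] at pour
  have push := run_push 0 (some false) ![[], w.reverse, [], []]
  rw [update_vec_zero] at push
  have pop : RunTo (.pop 1) ![[some false], w.reverse, [], []] 1 w.reverse.head?
    ![word ([] : List Letter), w.reverse.tail, [], []] :=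
    fun v => ⟨1, le_rfl, .pop_eq rfl (update_vec_one ..)⟩
  obtain ⟨m, hm, loop⟩ := exec_readLoop w.reverse []
  rw [List.length_reverse] at hm
  refine ((pour.cast rfl le_rfl (by simp)).seq
    (push.seq (pop.seq_exec ⟨none, m, hm, loop⟩))).cast rfl ?_ (by simp)
  simp only [Matrix.cons_val]
  omega

/-- The body of the loop of `write`: move one letter of the encoded word to stack `1`. -/
def writeBody : TreeProg :=
  .seq (.seq (.pop 0) (.ite isNode (.seq (.pop 0) (.seq (.push 1 fun v => v.getD none) (.pop 0)))
    (.push 1 fun _ => none))) (.pop 0)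

theorem exec_writeBody (s h : Letter) (r x : List Letter) :
    ∃ k ≤ 6, Exec writeBody (some none) ![word s ++ (h :: r), x, [], []] k (some h)
      ![r, s :: x, [], []] := by
  have pop_next (v : Option Letter) : Exec (.pop 0) v ![h :: r, s :: x, [], []] 1 (some h)
    ![r, s :: x, [], []] := .pop_eq rfl (update_vec_zero ..)
  cases s with
  | none =>
    have pop : Exec (.pop 0) (some none) ![some false :: h :: r, x, [], []] 1 (some (some false))
      ![h :: r, x, [], []] := .pop_eq rfl (update_vec_zero ..)
    have push : Exec (.push 1 fun _ => none) (some (some false)) ![h :: r, x, [], []] 1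
      (some (some false)) ![h :: r, none :: x, [], []] := .push_eq (update_vec_one ..)
    exact ⟨_, by omega, (pop.seq (push.ite_false (c := isNode) rfl)).seq (pop_next _)⟩
  | some b =>
    have pop_node : Exec (.pop 0) (some none) ![none :: some b :: some false :: h :: r, x, [], []] 1
      (some none) ![some b :: some false :: h :: r, x, [], []] := .pop_eq rfl (update_vec_zero ..)
    have pop_bit : Exec (.pop 0) (some none) ![some b :: some false :: h :: r, x, [], []] 1
      (some (some b)) ![some false :: h :: r, x, [], []] := .pop_eq rfl (update_vec_zero ..)
    have push : Exec (.push 1 fun v => v.getD none) (some (some b))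
      ![some false :: h :: r, x, [], []] 1 (some (some b))
      ![some false :: h :: r, some b :: x, [], []] := .push_eq (update_vec_one ..)
    have pop_end : Exec (.pop 0) (some (some b)) ![some false :: h :: r, some b :: x, [], []] 1
      (some (some false)) ![h :: r, some b :: x, [], []] := .pop_eq rfl (update_vec_zero ..)
    exact ⟨_, by omega, (pop_node.seq
      ((pop_bit.seq (push.seq pop_end)).ite_true (c := isNode) rfl)).seq (pop_next _)⟩

theorem exec_write_loop (w x : List Letter) {h : Letter} {r : List Letter} (hw : word w = h :: r) :
    ∃ v, ∃ m ≤ 7 * w.length + 1, Exec (.loop isNode writeBody) (some h) ![r, x, [], []] m v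
      ![[], w.reverse ++ x, [], []] := by
  induction w generalizing x h r with
  | nil =>
    obtain ⟨rfl, rfl⟩ := List.cons_eq_cons.1 (hw : [some false] = h :: r)
    exact ⟨_, 1, le_rfl, .loop_false rfl⟩
  | cons s w ih =>
    obtain ⟨rfl, rfl⟩ := List.cons_eq_cons.1 (hw : none :: (word s ++ word w) = h :: r)
    obtain ⟨h, r, hw⟩ : ∃ h r, word w = h :: r := List.exists_cons_of_length_pos (size_pos w)
    have hr : word s ++ word w = word s ++ (h :: r) := by rw [hw]
    obtain ⟨k, hk, body⟩ := exec_writeBody s h r x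
    obtain ⟨v, m, hm, rest⟩ := ih (s :: x) hw
    rw [← hr] at body
    rw [List.reverse_cons, List.append_assoc, List.singleton_append, List.length_cons]
    exact ⟨v, _, by omega, .loop_true (c := isNode) rfl body rest⟩

/-- Replace the encoded word on stack `0` by the word itself. -/
def write : TreeProg := .seq (.seq (.pop 0) (.loop isNode writeBody)) (pour 1 0)

theorem runTo_write (w : List Letter) :
    RunTo write (mainStack (word w)) (10 * w.length + 10) none (mainStack w) := by
  obtain ⟨h, r, hw⟩ : ∃ h r, word w = h :: r := List.exists_cons_of_length_pos (size_pos w)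
  have pop : RunTo (.pop 0) (mainStack (word w)) 1 (some h) ![r, [], [], []] :=
    hw ▸ runTo_popTop h r
  have pour := runTo_pour (i := 1) (j := 0) (by decide) ![[], w.reverse, [], []]
  rw [update_vec_one, update_vec_zero] at pour
  have result := (pop.seq_exec (exec_write_loop w [] hw)).seqTo (S'' := mainStack w) (v := none)
    (m := 3 * w.length + 2) (by simpa using pour)
  exact result.mono (by omega)

end Prog

/-- The encoding of a type by words. -/
@[reducible] def encOfWords {ι : Type} (e : ι → List Letter) : Enc ι := ⟨fun i => Enc.tree (e i)⟩

theorem size_letters_le (w : List Letter) : size w ≤ 4 * w.length + 1 := by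
  induction w with
  | nil => exact le_rfl
  | cons s w ih =>
    have size_letter : size s ≤ 3 := by
      cases s
      · exact (by decide : 1 ≤ 3)
      · exact le_rfl
    rw [size_cons, List.length_cons]
    omega

open Prog in
theorem exists_exec_of_polyTime {ι : Type} (ei eo : ι → List Letter)
    (h : @PolyTime ι (List Letter) (encOfWords ei) _ eo) :
    ∃ (p : TreeProg) (t : Polynomial ℕ), ∀ i, ∃ n, n + 1 ≤ t.eval (ei i).length ∧
      Exec p none ![[], [], ei i, []] n none (mainStack (eo i)) := by
  let _ := encOfWords ei
  obtain ⟨b, size_output⟩ := h.polyBounded_size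
  obtain ⟨p, T, ⟨q, time_le⟩, run⟩ := h
  have size_input (i : ι) : size i ≤ 4 * (ei i).length + 1 := size_letters_le (ei i)
  refine ⟨.seq read (.seq p write), (10 * .X + 10) + ((q.comp (4 * .X + 1)) +
    (10 * (b.comp (4 * .X + 1)) + 10)) + 1, fun i => ?_⟩
  have run_p := run i []
  simp only [List.append_nil] at run_p
  obtain ⟨n, hn, exec⟩ := ((run_read (ei i)).seqTo (run_p.seqTo (runTo_write _))) none
  refine ⟨n, ?_, exec⟩
  have time := (time_le i).trans (eval_mono q (size_input i))
  have output := ((length_lt_size (eo i)).le.trans (size_output i)).trans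
    (eval_mono b (size_input i))
  simp only [Polynomial.eval_add, Polynomial.eval_mul, Polynomial.eval_comp, Polynomial.eval_X,
    Polynomial.eval_ofNat, Polynomial.eval_one]
  omega

theorem computable_of_polyTime {ι ο : Type} (ei : ι → List Letter) (eo : ο → List Letter)
    (f : ι → ο) (h : @PolyTime ι (List Letter) (encOfWords ei) _ fun i => eo (f i)) :
    Nonempty (TM2ComputableInPolyTime ei eo f) := by
  obtain ⟨p, t, exec⟩ := exists_exec_of_polyTime ei (fun i => eo (f i)) h
  choose n hn exec using exec
  have no_stack : (fun _ => [] : Fin 4 → List Letter) = ![[], [], [], []] := by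
    funext k
    fin_cases k <;> rfl
  exact ⟨{
    tm := p.machine 2 0
    inputAlphabet := Equiv.refl _
    outputAlphabet := Equiv.refl _
    time := t
    outputsFun := fun i => by
      have out := (Prog.Exec.tm2OutputsInTime_machine (w := (ei i).map id) (w' := (eo (f i)).map id)
        ((exec i).cast rfl (by rw [List.map_id, no_stack, Prog.update_vec_two]) rfl rfl
          (by rw [List.map_id, no_stack, Prog.update_vec_zero]))).some
      exact ⟨⟨out.steps, out.evals_in_steps⟩, out.steps_le_m.trans (hn i)⟩ }⟩

/-! ### The algorithm -/

/-- The data of a vertex: width and height as pairs of numerator and denominator, and the clockwise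
list of neighbours, marked if the edge is outgoing. -/
abbrev Vertex := ((ℕ × ℕ) × ℕ × ℕ) × List (ℕ × Bool)

/-- The data of all vertices, which are numbered from `0`. -/
abbrev Net := List Vertex

section Definitions

variable (V : Net)

/-- The data of the vertex `v`. -/
def vertex (v : ℕ) : Vertex := V.getD v (((0, 0), 0, 0), [])

/-- The clockwise list of the neighbours of `v`. -/
def neighbors (v : ℕ) : List ℕ := (vertex V v).2.map fun q => q.1

/-- Is there an arc from `u` to `v`? -/
def hasArc (u v : ℕ) : Bool := (vertex V u).2.any fun q => q.1 == v && q.2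

/-- The first out-neighbour of `v`, or `v` itself if there is none. -/
def firstOut (v : ℕ) : ℕ := (((vertex V v).2.filter fun q => q.2).map fun q => q.1).headD v

/-- The product of the two denominators at `v`. -/
def boxDenom (v : ℕ) : ℕ := (vertex V v).1.1.2 * (vertex V v).1.2.2

/-- A common denominator of all widths and heights. -/
def commonDenom : ℕ := ((List.range V.length).map fun v => boxDenom V v).prod

/-- The product of the denominators at the vertices other than `v`. -/
def coDenom (v : ℕ) : ℕ :=
  ((List.range V.length).map fun j => bif j == v then 1 else boxDenom V j).prod

/-- The width of a box in units of `1 / (n * commonDenom V)`, for `n` vertices. The factor `n` makes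
room for strict inequalities: if difference constraints in `n` variables, the constants of which are
multiples of `n`, are solvable, then they have an integer solution in which the strict ones hold
with a margin of one unit. -/
def scaledWidth (v : ℕ) : ℕ :=
  V.length * ((vertex V v).1.1.1 * (vertex V v).1.2.2 * coDenom V v)

/-- The height of a box in units of `1 / commonDenom V`. -/
def scaledHeight (v : ℕ) : ℕ := (vertex V v).1.2.1 * (vertex V v).1.1.2 * coDenom V v

/-- The path of first out-neighbours that starts at `v`; it is long enough to reach the sink, where
it stays. -/
def outPath (v : ℕ) : List ℕ := List.iterate (firstOut V) v (V.length + 1)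

/-- How far the bottom side of `v` is below that of the sink, in units of `1 / commonDenom V`. -/
def depth (v : ℕ) : ℕ :=
  ((outPath V v).map fun c => bif firstOut V c == c then 0 else scaledHeight V c).sum

/-- Rotate a list so that it starts with the first occurrence of `s`. -/
def rotateTo (s : ℕ) (l : List ℕ) : List ℕ :=
  l.dropWhile (fun x => x != s) ++ l.takeWhile (fun x => x != s)

/-- Does `x` precede `y` in the list `l`? -/
def precedes (l : List ℕ) (x y : ℕ) : Bool := (l.dropWhile fun z => z != x).tail.any fun z => z == y

/-- The clockwise list of the neighbours of `c`, cut open at an out-neighbour or, if `c` is the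
sink, at `g`. Its in-neighbours then appear from right to left if `g` is the rightmost one of the
sink. -/
def cutRotation (g c : ℕ) : List ℕ :=
  rotateTo (bif firstOut V c == c then g else firstOut V c) (neighbors V c)

/-- Is `a` to the left of `b`, if `g` is the rightmost in-neighbour of the sink? This is read off
where the two paths of first out-neighbours meet. -/
def leftOf (g a b : ℕ) : Bool :=
  (outPath V a).any fun a' => (outPath V b).any fun b' =>
    firstOut V a' == firstOut V b' && precedes (cutRotation V g (firstOut V a')) b' a'

/-- Do the closed vertical extents of two boxes intersect? -/
def closedMeet (u v : ℕ) : Bool :=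
  decide (depth V v ≤ depth V u + scaledHeight V v) &&
    decide (depth V u ≤ depth V v + scaledHeight V u)

/-- Do the open vertical extents of two boxes intersect? -/
def openMeet (u v : ℕ) : Bool :=
  decide (depth V v < depth V u + scaledHeight V v) &&
    decide (depth V u < depth V v + scaledHeight V u)

/-- Is there an arc between `u` and `v`? -/
def adjacent (u v : ℕ) : Bool := hasArc V u v || hasArc V v u

/-- The constraint on the abscissae of `u` and `v`, if any: `(p, q)` means `x u + p ≤ x v + q`. -/
def constraint (g u v : ℕ) : List (ℕ × ℕ) :=
  bif u == v then [] else
  bif adjacent V u v then [(1, scaledWidth V v)] else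
  bif leftOf V g u v && closedMeet V u v then
    [(scaledWidth V u + bif openMeet V u v then 1 else 0, 0)] else []

/-- One round of Bellman–Ford relaxations. The truncated subtraction is harmless since abscissae
never decrease. -/
def relax (g : ℕ) (d : List ℕ) : List ℕ :=
  (List.range V.length).map fun v =>
    ((List.range V.length).flatMap fun u =>
      (constraint V g u v).map fun c => d.getD u 0 + c.1 - c.2).foldl max (d.getD v 0)

/-- The abscissae after as many rounds of relaxations as there are vertices: the least nonnegative
solution of the constraints, if there is one. -/
def abscissae (g : ℕ) : List ℕ := V.foldl (fun d _ => relax V g d) (V.map fun _ => 0)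

/-- Are the boxes `u` and `v` placed correctly with respect to each other? -/
def checkPair (x : List ℕ) (u v : ℕ) : Bool :=
  bif hasArc V u v then depth V u == depth V v + scaledHeight V u &&
    decide (x.getD u 0 < x.getD v 0 + scaledWidth V v) &&
    decide (x.getD v 0 < x.getD u 0 + scaledWidth V u)
  else hasArc V v u || u == v ||
    (!(closedMeet V u v && decide (x.getD u 0 < x.getD v 0 + scaledWidth V v) &&
      decide (x.getD v 0 < x.getD u 0 + scaledWidth V u)) &&
    !(openMeet V u v && decide (x.getD u 0 ≤ x.getD v 0 + scaledWidth V v) &&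
      decide (x.getD v 0 ≤ x.getD u 0 + scaledWidth V u)))

/-- May the contact with `a` precede the one with `b` on a clockwise tour around `v` that starts
with the top side? -/
def mayPrecede (x : List ℕ) (v a b : ℕ) : Bool :=
  bif hasArc V v a then !hasArc V v b || decide (x.getD a 0 < x.getD b 0)
  else !hasArc V v b && decide (x.getD b 0 < x.getD a 0)

/-- Are the contacts of `v` met in the given clockwise order? The tour starts at some neighbour; `v`
itself, which is not a neighbour, is added as a start for the case that there are none. -/
def checkRotation (x : List ℕ) (v : ℕ) : Bool :=
  (v :: neighbors V v).any fun s =>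
    (rotateTo s (neighbors V v)).all fun a => (rotateTo s (neighbors V v)).all fun b =>
      !precedes (rotateTo s (neighbors V v)) a b || mayPrecede V x v a b

/-- The next dart on the boundary walk of a face. -/
def nextDart (d : ℕ × ℕ) : ℕ × ℕ :=
  (d.2, (((neighbors V d.2).dropWhile fun x => x != d.1).tail ++ neighbors V d.2).headD d.1)

/-- The darts on the boundary of the face of `d`. There are at most `n ^ 2`, for `n` vertices. -/
def face (d : ℕ × ℕ) : List (ℕ × ℕ) :=
  List.iterate (nextDart V) d ((V.flatMap fun _ => V).length + 1)

/-- Is the outer face the unbounded one? The list `D` holds the two ends of the dart that gives the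
outer face, or is empty if there is no edge. -/
def checkOuter (D x : List ℕ) : Bool :=
  D.isEmpty || (face V (D.getD 0 0, D.getD 1 0)).any fun e =>
    firstOut V e.1 == e.1 && hasArc V e.2 e.1 &&
      (List.range V.length).all fun u => !hasArc V u e.1 || decide (x.getD u 0 ≤ x.getD e.2 0)

/-- Does the placement with the abscissae `x` hierarchically realize the input? -/
def check (D x : List ℕ) : Bool :=
  ((List.range V.length).all fun u => (List.range V.length).all fun v => checkPair V x u v) &&
    ((List.range V.length).all fun v => checkRotation V x v) && checkOuter V D x

/-- The candidates, one for every guess of the rightmost in-neighbour of the sink, that pass the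
check. -/
def solutions (D : List ℕ) : List (List ℕ) :=
  ((List.range V.length).map fun g => abscissae V g).filter fun x => check V D x

/-- The output before its encoding as a word. -/
def result (D : List ℕ) : List ℕ :=
  List.casesOn (solutions V D) [0] fun x _ => 1 :: (List.range V.length).flatMap fun v =>
    [0, x.getD v 0, V.length * commonDenom V,
      bif depth V v == 0 then 0 else 1, depth V v, commonDenom V]

end Definitions

section Size

theorem size_le_of_forall_mem_le {α : Type} [Enc α] {l : List α} {B : ℕ}
    (h : ∀ x ∈ l, size x ≤ B) : size l ≤ l.length * (B + 1) + 1 := by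
  induction l with
  | nil => rw [size_nil]; omega
  | cons x l ih =>
    have head := h x List.mem_cons_self
    have tail := ih fun y hy => h y (List.mem_cons_of_mem _ hy)
    rw [size_cons, List.length_cons, add_mul]
    omega

theorem size_nat_le (n : ℕ) : size n ≤ 2 * n + 1 := by
  have : n.size ≤ n := Nat.size_le.2 n.lt_two_pow_self
  rw [size_nat_eq]
  omega

theorem size_vertex_le (V : Net) (v : ℕ) : size (vertex V v) ≤ size V + 9 := by
  unfold vertex
  by_cases h : v < V.length
  · rw [List.getD_eq_getElem _ _ h]
    exact (size_lt_of_mem (List.getElem_mem h)).le.trans (by omega)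
  · rw [List.getD_eq_default _ _ (by omega)]
    exact Nat.le_add_left _ _

theorem size_le_of_mem_vertex {V : Net} {v : ℕ} {q : ℕ × Bool} (h : q ∈ (vertex V v).2) :
    size q.1 ≤ size V + 9 := by
  have size_vertex := size_vertex_le V v
  have size_q := size_lt_of_mem h
  rw [size_pair] at size_vertex size_q
  omega

theorem size_firstOut_le {V : Net} {v E : ℕ} (hE : size V + 9 ≤ E) (h : size v ≤ E) :
    size (firstOut V v) ≤ E := by
  unfold firstOut
  cases hl : ((vertex V v).2.filter fun q => q.2).map fun q => q.1 with
  | nil => exact h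
  | cons y l =>
    have hy : y ∈ ((vertex V v).2.filter fun q => q.2).map fun q => q.1 :=
      hl ▸ List.mem_cons_self
    obtain ⟨q, hq, rfl⟩ := List.mem_map.1 hy
    exact (size_le_of_mem_vertex (List.mem_of_mem_filter hq)).trans hE

theorem size_nextDart_snd_le {V : Net} {d : ℕ × ℕ} {E : ℕ} (hE : size V + 9 ≤ E)
    (h : size d.1 ≤ E) : size (nextDart V d).2 ≤ E := by
  unfold nextDart
  cases hl : ((neighbors V d.2).dropWhile fun y => y != d.1).tail ++ neighbors V d.2 with
  | nil => exact h
  | cons y l =>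
    have mem_append : y ∈ ((neighbors V d.2).dropWhile fun y => y != d.1).tail ++ neighbors V d.2 :=
      hl ▸ List.mem_cons_self
    have mem_neighbors : y ∈ neighbors V d.2 := (List.mem_append.1 mem_append).elim
      (fun hy => (List.dropWhile_suffix _).subset (List.mem_of_mem_tail hy)) id
    obtain ⟨q, hq, rfl⟩ := List.mem_map.1 mem_neighbors
    exact (size_le_of_mem_vertex hq).trans hE

/-- A bound for the shift `p` of all constraints `(p, q)`. -/
def maxShift (V : Net) : ℕ := ((List.range V.length).map fun v => scaledWidth V v).sum + 1

theorem le_maxShift {V : Net} {g u v : ℕ} {c : ℕ × ℕ} (hu : u < V.length)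
    (h : c ∈ constraint V g u v) : c.1 ≤ maxShift V := by
  have width_le : scaledWidth V u ≤ ((List.range V.length).map fun v => scaledWidth V v).sum :=
    List.single_le_sum (fun _ _ => Nat.zero_le _) _ (List.mem_map_of_mem (List.mem_range.2 hu))
  simp only [constraint, Bool.cond_eq_ite] at h
  unfold maxShift
  split_ifs at h <;> simp only [List.mem_cons, List.not_mem_nil, or_false] at h <;> subst h <;>
    dsimp only <;> omega

theorem foldl_max_le {l : List ℕ} {i b : ℕ} (hi : i ≤ b) (hl : ∀ x ∈ l, x ≤ b) :
    l.foldl max i ≤ b := by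
  induction l generalizing i with
  | nil => exact hi
  | cons x l ih =>
    exact ih (max_le hi (hl x List.mem_cons_self)) fun y hy => hl y (List.mem_cons_of_mem _ hy)

theorem length_relax (V : Net) (g : ℕ) (d : List ℕ) : (relax V g d).length = V.length := by
  rw [relax, List.length_map, List.length_range]

theorem relax_le {V : Net} {g b : ℕ} {d : List ℕ} (hd : ∀ x ∈ d, x ≤ b) :
    ∀ x ∈ relax V g d, x ≤ b + maxShift V := by
  have getD_le (u : ℕ) : d.getD u 0 ≤ b := by
    by_cases h : u < d.length
    · rw [List.getD_eq_getElem _ _ h]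
      exact hd _ (List.getElem_mem h)
    · rw [List.getD_eq_default _ _ (by omega)]
      exact Nat.zero_le b
  intro x hx
  obtain ⟨v, -, rfl⟩ := List.mem_map.1 hx
  refine foldl_max_le ((getD_le v).trans (by omega)) fun y hy => ?_
  obtain ⟨u, hu, hy⟩ := List.mem_flatMap.1 hy
  obtain ⟨c, hc, rfl⟩ := List.mem_map.1 hy
  have := getD_le u
  have := le_maxShift (List.mem_range.1 hu) hc
  omega

theorem foldl_relax_le (V : Net) (g : ℕ) (l : List Vertex) :
    (l.foldl (fun d _ => relax V g d) (V.map fun _ => 0)).length = V.length ∧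
      ∀ x ∈ l.foldl (fun d _ => relax V g d) (V.map fun _ => 0), x ≤ l.length * maxShift V := by
  induction l using List.reverseRecOn with
  | nil => simp
  | append_singleton l r ih =>
    rw [List.foldl_append, List.foldl_cons, List.foldl_nil, List.length_append,
      List.length_singleton, add_mul, one_mul]
    exact ⟨length_relax .., relax_le ih.2⟩

end Size

theorem foldl_cons_headD_eq_reverse_iterate {β γ : Type} (f : β → β) (i : β) (l : List γ) :
    l.foldl (fun p _ => f (p.headD i) :: p) [i] = (List.iterate f i (l.length + 1)).reverse := by
  have reverse_iterate (n : ℕ) : (List.iterate f i (n + 1)).reverse =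
      f^[n] i :: (List.iterate f i n).reverse := by
    rw [List.iterate_add, List.reverse_append]
    rfl
  induction l using List.reverseRecOn with
  | nil => rfl
  | append_singleton l b ih =>
    rw [List.foldl_append, ih, List.length_append, List.length_singleton,
      reverse_iterate (l.length + 1), reverse_iterate, List.foldl_cons, List.foldl_nil,
      List.headD_cons, Function.iterate_succ_apply']

namespace PolyTime

variable {α β γ : Type} [Enc α] [Enc β] [Enc γ]

theorem listIterate {l : α → List β} {f : α → γ → γ} {i : α → γ} (hl : PolyTime l)
    (hf : PolyTime fun x : α × γ => f x.1 x.2) (hi : PolyTime i) {E : α → ℕ} (hE : PolyBounded E)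
    {P : α → γ → Prop} (hP : ∀ a x, P a x → size x ≤ E a) (hPi : ∀ a, P a (i a))
    (hPf : ∀ a x, P a x → P a (f a x)) :
    PolyTime fun a => List.iterate (f a) (i a) ((l a).length + 1) := by
  have size_l := hl.polyBounded_size
  have : PolyTime fun x : α × List γ × β => f x.1 (x.2.1.headD (i x.1)) :=
    hf.comp (f := fun x : α × List γ × β => (x.1, x.2.1.headD (i x.1))) (by fun_prop)
  have invariant (a : α) (k : ℕ) : P a ((f a)^[k] (i a)) := by
    induction k with
    | zero => exact hPi a
    | succ k ih => rw [Function.iterate_succ_apply']; exact hPf a _ ih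
  have iterates := foldl_of_bound (s := fun a p _ => f a (p.headD (i a)) :: p) hl
    (i := fun a => [i a]) (by fun_prop) (by fun_prop)
    (B := fun a => (size (l a) + 1) * (E a + 1) + 1) (by fun_prop) fun a l' h => by
      have length_le := h.length_le.trans (length_lt_size (l a)).le
      rw [foldl_cons_headD_eq_reverse_iterate]
      refine (size_le_of_forall_mem_le fun x hx => ?_).trans
        (by rw [List.length_reverse, List.length_iterate]; gcongr)
      obtain ⟨k, -, rfl⟩ := List.mem_iterate.1 (List.mem_reverse.1 hx)
      exact hP a _ (invariant a k)
  exact iterates.reverse.of_eq fun a => by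
    rw [foldl_cons_headD_eq_reverse_iterate, List.reverse_reverse]

variable {V : α → Net} {u v g : α → ℕ} {x D : α → List ℕ}

@[fun_prop] theorem vertex (hV : PolyTime V) (hv : PolyTime v) :
    PolyTime fun a => vertex (V a) (v a) := by
  unfold HiWRAC.vertex; fun_prop

@[fun_prop] theorem neighbors (hV : PolyTime V) (hv : PolyTime v) :
    PolyTime fun a => neighbors (V a) (v a) := by
  unfold HiWRAC.neighbors; fun_prop

@[fun_prop] theorem hasArc (hV : PolyTime V) (hu : PolyTime u) (hv : PolyTime v) :
    PolyTime fun a => hasArc (V a) (u a) (v a) := by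
  unfold HiWRAC.hasArc; fun_prop

@[fun_prop] theorem firstOut (hV : PolyTime V) (hv : PolyTime v) :
    PolyTime fun a => firstOut (V a) (v a) := by
  unfold HiWRAC.firstOut; fun_prop

@[fun_prop] theorem boxDenom (hV : PolyTime V) (hv : PolyTime v) :
    PolyTime fun a => boxDenom (V a) (v a) := by
  unfold HiWRAC.boxDenom; fun_prop

@[fun_prop] theorem commonDenom (hV : PolyTime V) : PolyTime fun a => commonDenom (V a) := by
  unfold HiWRAC.commonDenom; fun_prop

@[fun_prop] theorem coDenom (hV : PolyTime V) (hv : PolyTime v) :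
    PolyTime fun a => coDenom (V a) (v a) := by
  unfold HiWRAC.coDenom; fun_prop

@[fun_prop] theorem scaledWidth (hV : PolyTime V) (hv : PolyTime v) :
    PolyTime fun a => scaledWidth (V a) (v a) := by
  unfold HiWRAC.scaledWidth; fun_prop

@[fun_prop] theorem scaledHeight (hV : PolyTime V) (hv : PolyTime v) :
    PolyTime fun a => scaledHeight (V a) (v a) := by
  unfold HiWRAC.scaledHeight; fun_prop

@[fun_prop] theorem outPath (hV : PolyTime V) (hv : PolyTime v) :
    PolyTime fun a => outPath (V a) (v a) := by
  have size_V := hV.polyBounded_size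
  have size_v := hv.polyBounded_size
  exact listIterate (f := fun a => HiWRAC.firstOut (V a)) hV (by fun_prop) hv
    (E := fun a => size (V a) + 9 + size (v a)) (by fun_prop)
    (P := fun a x => size x ≤ size (V a) + 9 + size (v a)) (fun _ _ h => h) (fun a => by omega)
    fun a x hx => size_firstOut_le (by omega) hx

@[fun_prop] theorem depth (hV : PolyTime V) (hv : PolyTime v) :
    PolyTime fun a => depth (V a) (v a) := by
  unfold HiWRAC.depth; fun_prop

@[fun_prop] theorem rotateTo (hv : PolyTime v) (hx : PolyTime x) :
    PolyTime fun a => rotateTo (v a) (x a) := by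
  unfold HiWRAC.rotateTo; fun_prop

@[fun_prop] theorem precedes (hx : PolyTime x) (hu : PolyTime u) (hv : PolyTime v) :
    PolyTime fun a => precedes (x a) (u a) (v a) := by
  unfold HiWRAC.precedes; fun_prop

@[fun_prop] theorem cutRotation (hV : PolyTime V) (hg : PolyTime g) (hv : PolyTime v) :
    PolyTime fun a => cutRotation (V a) (g a) (v a) := by
  unfold HiWRAC.cutRotation; fun_prop

@[fun_prop] theorem leftOf (hV : PolyTime V) (hg : PolyTime g) (hu : PolyTime u)
    (hv : PolyTime v) : PolyTime fun a => leftOf (V a) (g a) (u a) (v a) := by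
  unfold HiWRAC.leftOf; fun_prop

@[fun_prop] theorem closedMeet (hV : PolyTime V) (hu : PolyTime u) (hv : PolyTime v) :
    PolyTime fun a => closedMeet (V a) (u a) (v a) := by
  unfold HiWRAC.closedMeet; fun_prop

@[fun_prop] theorem openMeet (hV : PolyTime V) (hu : PolyTime u) (hv : PolyTime v) :
    PolyTime fun a => openMeet (V a) (u a) (v a) := by
  unfold HiWRAC.openMeet; fun_prop

@[fun_prop] theorem adjacent (hV : PolyTime V) (hu : PolyTime u) (hv : PolyTime v) :
    PolyTime fun a => adjacent (V a) (u a) (v a) := by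
  unfold HiWRAC.adjacent; fun_prop

@[fun_prop] theorem constraint (hV : PolyTime V) (hg : PolyTime g) (hu : PolyTime u)
    (hv : PolyTime v) : PolyTime fun a => constraint (V a) (g a) (u a) (v a) := by
  unfold HiWRAC.constraint; fun_prop

@[fun_prop] theorem foldlMax (hx : PolyTime x) (hv : PolyTime v) :
    PolyTime fun a => (x a).foldl max (v a) := by
  have size_x := hx.polyBounded_size
  exact foldl_of_add (s := fun _ => max) hx hv (by fun_prop) (e := fun a => size (x a))
    (by fun_prop) fun a c b hb => by
      have := size_lt_of_mem hb
      rcases max_choice c b with h | h <;> rw [h] <;> omega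

@[fun_prop] theorem relax (hV : PolyTime V) (hg : PolyTime g) (hx : PolyTime x) :
    PolyTime fun a => relax (V a) (g a) (x a) := by
  unfold HiWRAC.relax; fun_prop

@[fun_prop] theorem maxShift (hV : PolyTime V) : PolyTime fun a => maxShift (V a) := by
  unfold HiWRAC.maxShift; fun_prop

@[fun_prop] theorem abscissae (hV : PolyTime V) (hg : PolyTime g) :
    PolyTime fun a => abscissae (V a) (g a) := by
  have size_V := hV.polyBounded_size
  have size_shift := hV.maxShift.polyBounded_size
  refine foldl_of_bound (l := V) (s := fun a d _ => HiWRAC.relax (V a) (g a) d) hV (by fun_prop)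
    (by fun_prop)
    (B := fun a => size (V a) * (2 * size (V a) + 1 + size (HiWRAC.maxShift (V a)) + 1) + 1)
    (by fun_prop) fun a l' hl => ?_
  obtain ⟨length_eq, entry_le⟩ := foldl_relax_le (V a) (g a) l'
  have length_V := (length_lt_size (V a)).le
  have length_l' := hl.length_le
  refine (size_le_of_forall_mem_le fun x hx => ?_).trans (by rw [length_eq]; gcongr)
  have size_x := size_nat_mono (entry_le x hx)
  have size_mul := size_mul_le l'.length (HiWRAC.maxShift (V a))
  have size_length := size_nat_le l'.length
  omega

@[fun_prop] theorem checkPair (hV : PolyTime V) (hx : PolyTime x) (hu : PolyTime u)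
    (hv : PolyTime v) : PolyTime fun a => checkPair (V a) (x a) (u a) (v a) := by
  unfold HiWRAC.checkPair; fun_prop

@[fun_prop] theorem mayPrecede (hV : PolyTime V) (hx : PolyTime x) (hu : PolyTime u)
    (hv : PolyTime v) (hg : PolyTime g) :
    PolyTime fun a => mayPrecede (V a) (x a) (u a) (v a) (g a) := by
  unfold HiWRAC.mayPrecede; fun_prop

@[fun_prop] theorem checkRotation (hV : PolyTime V) (hx : PolyTime x) (hv : PolyTime v) :
    PolyTime fun a => checkRotation (V a) (x a) (v a) := by
  unfold HiWRAC.checkRotation; fun_prop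

@[fun_prop] theorem nextDart {d : α → ℕ × ℕ} (hV : PolyTime V) (hd : PolyTime d) :
    PolyTime fun a => nextDart (V a) (d a) := by
  unfold HiWRAC.nextDart; fun_prop

@[fun_prop] theorem face {d : α → ℕ × ℕ} (hV : PolyTime V) (hd : PolyTime d) :
    PolyTime fun a => face (V a) (d a) := by
  have size_V := hV.polyBounded_size
  have size_d := hd.polyBounded_size
  exact listIterate (f := fun a => HiWRAC.nextDart (V a)) (by fun_prop) (by fun_prop) hd
    (E := fun a => 2 * (size (V a) + 9 + size (d a)) + 1) (by fun_prop)
    (P := fun a x =>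
      size x.1 ≤ size (V a) + 9 + size (d a) ∧ size x.2 ≤ size (V a) + 9 + size (d a))
    (fun a x h => by rw [size_pair]; omega) (fun a => by rw [size_pair]; omega)
    fun a x hx => ⟨hx.2, size_nextDart_snd_le (by omega) hx.1⟩

@[fun_prop] theorem checkOuter (hV : PolyTime V) (hD : PolyTime D) (hx : PolyTime x) :
    PolyTime fun a => checkOuter (V a) (D a) (x a) := by
  unfold HiWRAC.checkOuter; fun_prop

@[fun_prop] theorem check (hV : PolyTime V) (hD : PolyTime D) (hx : PolyTime x) :
    PolyTime fun a => check (V a) (D a) (x a) := by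
  unfold HiWRAC.check; fun_prop

@[fun_prop] theorem solutions (hV : PolyTime V) (hD : PolyTime D) :
    PolyTime fun a => solutions (V a) (D a) := by
  unfold HiWRAC.solutions; fun_prop

@[fun_prop] theorem result (hV : PolyTime V) (hD : PolyTime D) :
    PolyTime fun a => result (V a) (D a) := by
  unfold HiWRAC.result; fun_prop

end PolyTime

/-! ### Parsing -/

section Parsing

/-- Read a letter: the state consists of the digits of the current number, last one first, and the
numbers read so far, last one first. -/
def tokenStep (s : List Bool × List ℕ) (o : Letter) : List Bool × List ℕ :=
  List.casesOn o.toList ([], ofDigits s.1 0 :: s.2) fun b _ => (b :: s.1, s.2)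

/-- The numbers encoded by a word, the inverse of `encodeNats`. -/
def tokens (w : List Letter) : List ℕ := (w.foldl tokenStep ([], [])).2.reverse

/-- The vertex at the start of a list of numbers, the inverse of `Instance.vertexToNats`. The two
signs, at positions `0` and `3`, are ignored. -/
def readVertex (t : List ℕ) : Vertex :=
  (((t.getD 1 0, t.getD 2 0), t.getD 4 0, t.getD 5 0),
    ((List.range t.length).take (t.getD 6 0)).map fun i =>
      (t.getD (7 + (i + i)) 0, t.getD (7 + (i + i + 1)) 0 == 1))

/-- Move a vertex from the numbers that are left to the vertices read so far. A vertex takes at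
least `7` numbers, and the outer dart, which comes last, at most `2`. -/
def parseStep (s : List ℕ × Net) : List ℕ × Net :=
  bif decide (s.1.length < 7) then s else
    (s.1.drop (7 + (s.1.getD 6 0 + s.1.getD 6 0)), s.2 ++ [readVertex s.1])

/-- The outer dart and the vertices that a list of numbers describes. There are at most as many
vertices as numbers, so that the list itself can serve as the clock of the iteration. -/
def parse (t : List ℕ) : List ℕ × Net := t.foldl (fun s _ => parseStep s) (t.tail, [])

theorem ofDigits_add_one_le (l : List Bool) (c : ℕ) :
    ofDigits l c + 1 ≤ (c + 1) * 2 ^ l.length := by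
  induction l generalizing c with
  | nil => simp [ofDigits]
  | cons b l ih =>
    refine (ih (Nat.bit b c)).trans ?_
    rw [List.length_cons, pow_succ', ← mul_assoc]
    refine Nat.mul_le_mul_right _ ?_
    rw [Nat.bit_val]
    cases b <;> simp only [Bool.toNat_false, Bool.toNat_true] <;> omega

theorem size_ofDigits_zero_le (l : List Bool) : (ofDigits l 0).size ≤ l.length := by
  have := ofDigits_add_one_le l 0
  exact Nat.size_le.2 (by omega)

theorem ofDigits_bits_reverse (n : ℕ) : ofDigits n.bits.reverse 0 = n := by
  unfold ofDigits
  rw [List.foldl_reverse]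
  induction n using Nat.binaryRec' with
  | zero => simp
  | bit b n h ih => rw [Nat.bits_append_bit _ _ h, List.foldr_cons, ih]

theorem foldl_tokenStep_map_some (b c : List Bool) (o : List ℕ) :
    (b.map some).foldl tokenStep (c, o) = (b.reverse ++ c, o) := by
  induction b generalizing c with
  | nil => rfl
  | cons x b ih => exact (ih (x :: c)).trans (by simp)

theorem foldl_tokenStep_encodeNats (l o : List ℕ) :
    (encodeNats l).foldl tokenStep ([], o) = ([], l.reverse ++ o) := by
  induction l generalizing o with
  | nil => rfl
  | cons n l ih =>
    rw [encodeNats, List.flatMap_cons, List.foldl_append, List.foldl_append,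
      foldl_tokenStep_map_some, List.append_nil]
    refine (ih (ofDigits n.bits.reverse 0 :: o)).trans ?_
    rw [ofDigits_bits_reverse, List.reverse_cons, List.append_assoc]
    rfl

theorem tokens_encodeNats (l : List ℕ) : tokens (encodeNats l) = l := by
  rw [tokens, foldl_tokenStep_encodeNats, List.append_nil, List.reverse_reverse]

theorem size_foldl_parseStep_le {q : Polynomial ℕ}
    (hq : ∀ t, size (readVertex t) ≤ q.eval (size t)) (t l : List ℕ) :
    size (l.foldl (fun s _ => parseStep s) (t.tail, [])).1 ≤ size t ∧
      size (l.foldl (fun s _ => parseStep s) (t.tail, [])).2 ≤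
        l.length * (q.eval (size t) + 1) + 1 := by
  induction l using List.reverseRecOn with
  | nil => exact ⟨size_tail_le _, by simp⟩
  | append_singleton l b ih =>
    rw [List.foldl_append, List.foldl_cons, List.foldl_nil, List.length_append,
      List.length_singleton, add_mul]
    generalize l.foldl (fun s _ => parseStep s) (t.tail, []) = s at ih
    unfold parseStep
    cases decide (s.1.length < 7)
    · refine ⟨(size_drop_le _ _).trans ih.1, ?_⟩
      have size_append := size_append s.2 [readVertex s.1]
      have size_vertex := (hq s.1).trans (eval_mono q ih.1)
      simp only [size_cons, size_nil, cond_false] at size_append ⊢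
      omega
    · exact ⟨ih.1, ih.2.trans (by omega)⟩

end Parsing

namespace PolyTime

variable {α β : Type} [Enc α] [Enc β]

@[fun_prop] theorem toList {f : α → Option β} (hf : PolyTime f) : PolyTime fun a => (f a).toList :=
  (of_word_eq (f := fun o : Option β => o.toList) fun _ => rfl).comp hf

@[fun_prop] protected theorem some {f : α → β} (hf : PolyTime f) : PolyTime fun a => some (f a) :=
  (of_word_eq (α := List β) (β := List β) (f := fun l => l) fun _ => rfl).comp
    (hf.cons (const ([] : List β)))

@[fun_prop] theorem tokens {w : α → List Letter} (hw : PolyTime w) :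
    PolyTime fun a => tokens (w a) := by
  have polyTime_ofDigits :
      PolyTime fun x : α × (List Bool × List ℕ) × Letter => HiWRAC.ofDigits x.2.1.1 0 :=
    ofDigits (by fun_prop) (by fun_prop)
  refine (foldl_of_add (s := fun _ s o => tokenStep s o) hw (const ([], []))
    (by unfold tokenStep; fun_prop) (e := fun _ => 2) (by fun_prop) ?_).snd.reverse
  rintro _ ⟨c, o⟩ s _
  cases s with
  | none =>
    have := size_ofDigits_zero_le c
    simp only [tokenStep, Option.toList_none, size_pair, size_bools, size_cons, size_nat_eq,
      List.length_nil]
    omega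
  | some b =>
    simp only [tokenStep, Option.toList_some, size_pair, size_bools, List.length_cons]
    omega

@[fun_prop] theorem readVertex {t : α → List ℕ} (ht : PolyTime t) :
    PolyTime fun a => readVertex (t a) := by
  unfold HiWRAC.readVertex; fun_prop

@[fun_prop] theorem parse {t : α → List ℕ} (ht : PolyTime t) : PolyTime fun a => parse (t a) := by
  have size_t := ht.polyBounded_size
  obtain ⟨q, hq⟩ := (readVertex (PolyTime.id (α := List ℕ))).polyBounded_size
  refine foldl_of_bound (s := fun _ s _ => parseStep s) ht (by fun_prop)
    (by unfold parseStep; fun_prop)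
    (B := fun a => size (t a) + (size (t a) * (q.eval (size (t a)) + 1) + 1) + 1) (by fun_prop)
    fun a l hl => ?_
  have length_le := hl.length_le.trans (length_lt_size (t a)).le
  obtain ⟨size_rest, size_net⟩ := size_foldl_parseStep_le hq (t a) l
  have : l.length * (q.eval (size (t a)) + 1) ≤ size (t a) * (q.eval (size (t a)) + 1) := by
    gcongr
  rw [size_pair]
  omega

end PolyTime

section Input

/-- The data of the vertex `v` of an input. -/
def vertexOf (I : Instance) (v : Fin I.n) : Vertex :=
  ((((I.width v).num.natAbs, (I.width v).den), (I.height v).num.natAbs, (I.height v).den),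
    (I.graph.rot v).map fun w => (w.val, I.graph.arc v w))

/-- The data of an input. -/
def netOf (I : Instance) : Net := (List.finRange I.n).map (vertexOf I)

/-- The outer dart of an input. -/
def outerOf (I : Instance) : List ℕ :=
  match I.outer with
  | none => []
  | some d => [d.1.val, d.2.val]

theorem getD_flatMap_pair {ι : Type} (l : List ι) (f g : ι → ℕ) (r : List ℕ) (i : ℕ)
    (h : i < l.length) :
    ((l.flatMap fun w => [f w, g w]) ++ r).getD (i + i) 0 = f l[i] ∧
      ((l.flatMap fun w => [f w, g w]) ++ r).getD (i + i + 1) 0 = g l[i] := by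
  induction l generalizing i with
  | nil => simp at h
  | cons w l ih =>
    cases i with
    | zero => simp
    | succ i =>
      have := ih i (by simpa using h)
      simp only [List.flatMap_cons, List.cons_append, List.nil_append, List.getElem_cons_succ]
      rw [show i + 1 + (i + 1) = i + i + 1 + 1 by omega]
      simpa using this

theorem length_vertexToNats (I : Instance) (v : Fin I.n) :
    (I.vertexToNats v).length = 7 + 2 * (I.graph.rot v).length := by
  simp only [Instance.vertexToNats, Fraction.toNats, List.length_append, List.length_flatMap,
    List.length_cons, List.length_nil, List.map_const', List.sum_replicate, smul_eq_mul]
  omega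

theorem readVertex_vertexToNats (I : Instance) (v : Fin I.n) (r : List ℕ) :
    readVertex (I.vertexToNats v ++ r) = vertexOf I v := by
  have length_eq := length_vertexToNats I v
  refine Prod.ext rfl (List.ext_getElem ?_ fun i _ h => ?_)
  · have degree_eq : (I.vertexToNats v ++ r).getD 6 0 = (I.graph.rot v).length := rfl
    simp only [readVertex, vertexOf, degree_eq, List.length_map, List.length_take,
      List.length_range, List.length_append]
    omega
  · have hi : i < (I.graph.rot v).length := by simpa [vertexOf] using h
    obtain ⟨neighbor_eq, mark_eq⟩ := getD_flatMap_pair (I.graph.rot v) (fun w => w.val)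
      (fun w => (I.graph.arc v w).toNat) r i hi
    simp only [readVertex, vertexOf, Instance.vertexToNats, Fraction.toNats, List.cons_append,
      List.nil_append, List.getElem_map, List.getElem_take, List.getElem_range]
    rw [add_comm 7, add_comm 7]
    refine Prod.ext neighbor_eq ?_
    simp only [List.getD_cons_succ]
    rw [mark_eq]
    cases I.graph.arc v (I.graph.rot v)[i] <;> rfl

theorem parseStep_outerOf (I : Instance) (V : Net) :
    parseStep (outerOf I, V) = (outerOf I, V) := by
  have : (outerOf I).length < 7 := by unfold outerOf; split <;> simp
  simp [parseStep, this]

theorem parseStep_vertexToNats (I : Instance) (v : Fin I.n) (r : List ℕ) (V : Net) :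
    parseStep (I.vertexToNats v ++ r, V) = (r, V ++ [vertexOf I v]) := by
  have degree_eq : (I.vertexToNats v ++ r).getD 6 0 = (I.graph.rot v).length := rfl
  have length_eq := length_vertexToNats I v
  simp only [parseStep, readVertex_vertexToNats, degree_eq]
  rw [decide_eq_false (by rw [List.length_append]; omega), cond_false, ← two_mul, ← length_eq,
    List.drop_left]

theorem foldl_parseStep (I : Instance) {vs : List (Fin I.n)} {t : List ℕ}
    (h : vs.length ≤ t.length) (V : Net) :
    t.foldl (fun s _ => parseStep s) (vs.flatMap I.vertexToNats ++ outerOf I, V) =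
      (outerOf I, V ++ vs.map (vertexOf I)) := by
  induction t generalizing vs V with
  | nil => simp [List.eq_nil_of_length_eq_zero (Nat.le_zero.1 h)]
  | cons x t ih =>
    rw [List.foldl_cons]
    cases vs with
    | nil =>
      rw [List.flatMap_nil, List.nil_append, parseStep_outerOf]
      exact ih (vs := []) (Nat.zero_le _) V
    | cons v vs =>
      rw [List.flatMap_cons, List.append_assoc, parseStep_vertexToNats,
        ih (Nat.le_of_succ_le_succ h), List.append_assoc]
      rfl

theorem length_le_length_flatMap_vertexToNats (I : Instance) (vs : List (Fin I.n)) :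
    vs.length ≤ (vs.flatMap I.vertexToNats).length := by
  induction vs with
  | nil => simp
  | cons v vs ih =>
    have := length_vertexToNats I v
    rw [List.flatMap_cons, List.length_append, List.length_cons]
    omega

theorem parse_tokens_encodeInstance (I : Instance) :
    parse (tokens (encodeInstance I)) = (outerOf I, netOf I) := by
  rw [encodeInstance, tokens_encodeNats]
  refine (foldl_parseStep I (vs := List.finRange I.n) ?_ []).trans rfl
  have := length_le_length_flatMap_vertexToNats I (List.finRange I.n)
  simp only [List.length_append]
  omega

theorem polyTime_result : @PolyTime Instance (List Letter) (encOfWords encodeInstance) _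
    fun I => encodeNats (result (netOf I) (outerOf I)) := by
  let _ := encOfWords encodeInstance
  have polyTime_encode : PolyTime fun I : Instance => encodeInstance I :=
    PolyTime.of_word_eq fun _ => rfl
  have polyTime_parsed : PolyTime fun I : Instance => encodeNats
      (result (parse (tokens (encodeInstance I))).2 (parse (tokens (encodeInstance I))).1) := by
    unfold encodeNats
    fun_prop
  exact polyTime_parsed.of_eq fun I => by rw [parse_tokens_encodeInstance]

end Input

/-! ### Difference constraints -/

section DifferenceConstraints

variable {ι : Type*}

/-- The sequence `d` arises by rounds of Bellman–Ford relaxations from the difference constraints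
`x u + p ≤ x v + q`, one for every `u`, `v`, `p`, `q` with `E u v p q`. -/
structure IsRelaxation (E : ι → ι → ℕ → ℕ → Prop) (d : ℕ → ι → ℕ) : Prop where
  le_succ : ∀ k v, d k v ≤ d (k + 1) v
  sub_le_succ : ∀ k u v p q, E u v p q → d k u + p - q ≤ d (k + 1) v
  eq_or_eq_sub : ∀ k v, d (k + 1) v = d k v ∨ ∃ u p q, E u v p q ∧ d (k + 1) v = d k u + p - q

namespace IsRelaxation

variable {E : ι → ι → ℕ → ℕ → Prop} {d : ℕ → ι → ℕ} {z : ι → ℤ}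

/-- An increase in some round is caused by an increase in the round before. -/
theorem exists_chain (hd : IsRelaxation E d) (hz : ∀ u v p q, E u v p q → z u + p ≤ z v + q) (k : ℕ)
    {v : ι} (hv : d k v < d (k + 1) v) :
    ∃ c : ℕ → ι, c k = v ∧ (∀ j ≤ k, d j (c j) < d (j + 1) (c j)) ∧
      ∀ j < k, (d (j + 2) (c (j + 1)) : ℤ) - z (c (j + 1)) ≤ d (j + 1) (c j) - z (c j) := by
  induction k generalizing v with
  | zero => exact ⟨fun _ => v, rfl, fun j hj => Nat.le_zero.1 hj ▸ hv, by simp⟩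
  | succ k ih =>
    obtain ⟨u, p, q, hE, eq_sub⟩ := (hd.eq_or_eq_sub (k + 1) v).resolve_left (by omega)
    have increase_u : d k u < d (k + 1) u := by
      have := hd.sub_le_succ k u v p q hE
      omega
    obtain ⟨c, rfl, increase, gap_le⟩ := ih increase_u
    refine ⟨fun j => if j ≤ k then c j else v, by simp, fun j hj => ?_, fun j hj => ?_⟩
    · dsimp only
      split_ifs with h
      · exact increase j h
      · obtain rfl : j = k + 1 := by omega
        exact hv
    · dsimp only
      rw [if_pos (by omega : j ≤ k)]
      split_ifs with h
      · exact gap_le j (by omega)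
      · obtain rfl : j = k := by omega
        have := hz (c j) v p q hE
        rw [show d (j + 2) v = _ from eq_sub] at hv ⊢
        omega

theorem add_le_add [Fintype ι] (hd : IsRelaxation E d)
    (hz : ∀ u v p q, E u v p q → z u + p ≤ z v + q) {u v : ι} {p q : ℕ} (h : E u v p q) :
    d (Fintype.card ι) u + p ≤ d (Fintype.card ι) v + q := by
  set n := Fintype.card ι with hn
  by_contra hlt
  have increase_v : d n v < d (n + 1) v := by
    have := hd.sub_le_succ n u v p q h
    omega
  obtain ⟨c, -, increase, gap_succ_le⟩ := hd.exists_chain hz n increase_v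
  have gap_le (i j : ℕ) (hij : i ≤ j) (hj : j ≤ n) :
      (d (j + 1) (c j) : ℤ) - z (c j) ≤ d (i + 1) (c i) - z (c i) := by
    induction j, hij using Nat.le_induction with
    | base => rfl
    | succ j _ ih => exact (gap_succ_le j hj).trans (ih (by omega))
  have ne_of_lt (i j : ℕ) (hij : i < j) (hj : j ≤ n) : c i ≠ c j := by
    intro eq
    have gap := gap_le i j hij.le hj
    have increase_j := increase j hj
    have mono : d (i + 1) (c j) ≤ d j (c j) :=
      monotone_nat_of_le_succ (f := fun k => d k (c j)) (fun k => hd.le_succ k _) hij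
    rw [eq] at gap
    omega
  obtain ⟨i, j, hij, eq⟩ := Fintype.exists_ne_map_eq_of_card_lt (fun j : Fin (n + 1) => c j)
    (by simp [hn])
  rcases hij.lt_or_gt with h | h
  · exact ne_of_lt i j h (by omega) eq
  · exact ne_of_lt j i h (by omega) eq.symm

end IsRelaxation

theorem exists_rank [Fintype ι] {β : Type*} [LinearOrder β] (f : ι → β) :
    ∃ r : ι → ℕ, (∀ v, r v < Fintype.card ι) ∧ (∀ u v, f u ≤ f v → r u ≤ r v) ∧
      ∀ u v, f u < f v → r u < r v := by
  refine ⟨fun v => (Finset.univ.filter fun u => f u < f v).card, fun v => ?_, fun u v h => ?_,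
    fun u v h => ?_⟩
  · exact Finset.card_lt_univ_of_notMem (x := v) (by simp)
  · exact Finset.card_le_card (Finset.monotone_filter_right _ fun w _ hw => hw.trans_le h)
  · refine Finset.card_lt_card (Finset.ssubset_iff_of_subset
      (Finset.monotone_filter_right _ fun w _ hw => hw.trans h) |>.2 ⟨u, ?_, ?_⟩) <;> simp [h]

-- Scale by `n = Fintype.card ι` and replace the fractional part of `y v` by its rank.
theorem exists_int_potential [Fintype ι] (y : ι → ℝ) :
    ∃ z : ι → ℤ, ∀ u v (c : ℤ), (y u + c ≤ y v → z u + Fintype.card ι * c ≤ z v) ∧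
      (y u + c < y v → z u + Fintype.card ι * c + 1 ≤ z v) := by
  obtain ⟨r, r_lt, r_le, r_strict⟩ := exists_rank fun v => Int.fract (y v)
  refine ⟨fun v => Fintype.card ι * ⌊y v⌋ + r v, fun u v c => ?_⟩
  have floor_le (h : y u + c ≤ y v) : ⌊y u⌋ + c ≤ ⌊y v⌋ := by
    rw [← Int.floor_add_intCast]
    exact Int.floor_le_floor h
  have of_floor_lt (h : ⌊y u⌋ + c < ⌊y v⌋) :
      (Fintype.card ι * ⌊y u⌋ + r u : ℤ) + Fintype.card ι * c + 1 ≤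
        Fintype.card ι * ⌊y v⌋ + r v := by
    have : (Fintype.card ι : ℤ) * (⌊y u⌋ + c + 1) ≤ Fintype.card ι * ⌊y v⌋ :=
      mul_le_mul_of_nonneg_left h (by positivity)
    have := r_lt u
    linarith
  have fract_sub (h : ⌊y u⌋ + c = ⌊y v⌋) :
      Int.fract (y v) - Int.fract (y u) = y v - (y u + c) := by
    have : (⌊y u⌋ : ℝ) + c = ⌊y v⌋ := by exact_mod_cast h
    rw [Int.fract, Int.fract]
    linarith
  constructor <;> intro h
  · rcases (floor_le h).lt_or_eq with lt | eq
    · linarith [of_floor_lt lt]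
    · have := r_le u v (by linarith [fract_sub eq])
      dsimp only
      rw [← eq]
      linarith
  · rcases (floor_le h.le).lt_or_eq with lt | eq
    · exact of_floor_lt lt
    · have := r_strict u v (by linarith [fract_sub eq])
      dsimp only
      rw [← eq]
      linarith

end DifferenceConstraints

/-! ### Iterates -/

section Iterates

variable {α : Type*}

theorem exists_iterate_eq_lt_card [Fintype α] (f : α → α) (a : α) (k : ℕ) :
    ∃ j < Fintype.card α, f^[j] a = f^[k] a := by
  classical
  have reached : ∃ j, f^[j] a = f^[k] a := ⟨k, rfl⟩
  refine ⟨Nat.find reached, ?_, Nat.find_spec reached⟩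
  by_contra! card_le
  obtain ⟨i, j, ne, eq⟩ := Fintype.exists_ne_map_eq_of_card_lt
    (fun i : Fin (Nat.find reached + 1) => f^[i] a) (by rw [Fintype.card_fin]; lia)
  wlog lt : i < j generalizing i j
  · exact this j i ne.symm eq.symm (ne.lt_or_gt.resolve_left lt)
  have shortcut : f^[Nat.find reached - j + i] a = f^[k] a := by
    rw [Function.iterate_add_apply, eq, ← Function.iterate_add_apply,
      Nat.sub_add_cancel (Nat.le_of_lt_succ j.isLt), Nat.find_spec reached]
  exact Nat.find_min reached (by lia) shortcut

theorem exists_siblings_of_iterate_eq (f : α → α) {a b : α} (h : ∃ i j, f^[i] a = f^[j] b) :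
    (∃ j, f^[j] b = a) ∨ (∃ i, f^[i] a = b) ∨ ∃ i j, f^[i] a ≠ f^[j] b ∧
      f (f^[i] a) = f (f^[j] b) ∧ f (f^[i] a) ≠ f^[i] a ∧ f (f^[j] b) ≠ f^[j] b := by
  classical
  obtain ⟨i, meets, first_i⟩ : ∃ i, (∃ j, f^[i] a = f^[j] b) ∧
      ∀ i' < i, ∀ j, f^[i'] a ≠ f^[j] b :=
    ⟨Nat.find h, Nat.find_spec h, fun _ lt => not_exists.1 (Nat.find_min h lt)⟩
  obtain ⟨j, eq, first_j⟩ : ∃ j, f^[i] a = f^[j] b ∧ ∀ j' < j, f^[i] a ≠ f^[j'] b :=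
    ⟨Nat.find meets, Nat.find_spec meets, fun _ => Nat.find_min meets⟩
  match i, j with
  | 0, j => exact .inl ⟨j, eq.symm⟩
  | i + 1, 0 => exact .inr (.inl ⟨i + 1, eq⟩)
  | i + 1, j + 1 =>
    rw [Function.iterate_succ_apply'] at eq first_j
    have eq' := eq
    rw [Function.iterate_succ_apply'] at eq'
    refine .inr (.inr ⟨i, j, first_i i (by lia) j, eq', fun fixed => ?_, fun fixed => ?_⟩)
    · exact first_i i (by lia) (j + 1) (fixed ▸ eq)
    · exact first_j j (by lia) (eq'.trans fixed)

end Iterates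

/-! ### Lists -/

section Lists

theorem precedes_iff {l : List ℕ} {x y : ℕ} : precedes l x y = true ↔ [x, y].Sublist l := by
  induction l with
  | nil => simp [precedes]
  | cons z l ih =>
    by_cases h : z = x
    · subst h
      simp [precedes]
    · have precedes_cons : precedes (z :: l) x y = precedes l x y := by simp [precedes, h]
      rw [precedes_cons, ih, List.sublist_cons_iff]
      simp [Ne.symm h]

theorem pair_sublist_or {β : Type*} {l : List β} {x y : β} (hxy : x ≠ y) (hx : x ∈ l)
    (hy : y ∈ l) : [x, y].Sublist l ∨ [y, x].Sublist l := by
  induction l with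
  | nil => simp at hx
  | cons z l ih =>
    rcases List.mem_cons.1 hx with rfl | hx' <;> rcases List.mem_cons.1 hy with rfl | hy'
    · exact absurd rfl hxy
    · exact .inl (List.Sublist.cons_cons _ (List.singleton_sublist.2 hy'))
    · exact .inr (List.Sublist.cons_cons _ (List.singleton_sublist.2 hx'))
    · exact (ih hx' hy').imp (fun h => h.cons z) fun h => h.cons z

theorem forall_mem_bne {s : ℕ} {l : List ℕ} (h : s ∉ l) : ∀ x ∈ l, (x != s) = true :=
  fun _ hx => bne_iff_ne.2 fun eq => h (eq ▸ hx)

theorem rotateTo_append_cons {s : ℕ} {l₁ l₂ : List ℕ} (h : s ∉ l₁) :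
    rotateTo s (l₁ ++ s :: l₂) = s :: l₂ ++ l₁ := by
  rw [rotateTo, List.dropWhile_append_of_pos (forall_mem_bne h),
    List.takeWhile_append_of_pos (forall_mem_bne h)]
  simp

theorem rotateTo_of_notMem {s : ℕ} {l : List ℕ} (h : s ∉ l) : rotateTo s l = l := by
  rw [rotateTo, List.dropWhile_eq_nil_iff.2 (forall_mem_bne h),
    List.takeWhile_eq_self_iff.2 (forall_mem_bne h), List.nil_append]

theorem isRotated_rotateTo (s : ℕ) (l : List ℕ) : l.IsRotated (rotateTo s l) := by
  by_cases h : s ∈ l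
  · obtain ⟨l₁, l₂, rfl, hn⟩ := List.eq_append_cons_of_mem h
    rw [rotateTo_append_cons hn]
    exact List.isRotated_append
  · rw [rotateTo_of_notMem h]

theorem eq_of_isRotated_cons {β : Type*} {s : β} {l m : List β} (hl : (s :: l).Nodup)
    (h : (s :: l).IsRotated (s :: m)) : l = m := by
  obtain ⟨k, hk, eq⟩ := List.isRotated_iff_mod.1 h
  rcases hk.lt_or_eq with hk | rfl
  · have getElem?_eq : (s :: l)[k]? = some (s :: l)[0] := by
      rw [← List.head?_rotate hk, eq]
      rfl
    rw [List.getElem?_eq_getElem hk, Option.some_inj, hl.getElem_inj_iff] at getElem?_eq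
    simpa [getElem?_eq] using eq
  · simpa [List.rotate_length] using eq

theorem rotateTo_eq {s : ℕ} {l m : List ℕ} (hl : l.Nodup) (h : l.IsRotated (s :: m)) :
    rotateTo s l = s :: m := by
  have hs : s ∈ l := h.mem_iff.2 List.mem_cons_self
  have isRotated := isRotated_rotateTo s l
  obtain ⟨l₁, l₂, rfl, hn⟩ := List.eq_append_cons_of_mem hs
  rw [rotateTo_append_cons hn, List.cons_append] at isRotated ⊢
  rw [eq_of_isRotated_cons (isRotated.nodup_iff.1 hl) (isRotated.symm.trans h)]

theorem pair_sublist_of_map {α β : Type*} {f : α → β} (hf : f.Injective) {l : List α} {x y : α}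
    (h : [f x, f y].Sublist (l.map f)) : [x, y].Sublist l := by
  obtain ⟨l', sublist, eq⟩ := List.sublist_map_iff.1 h
  have eq : [x, y].map f = l'.map f := eq
  rwa [List.map_injective_iff.2 hf eq]

theorem le_foldl_max {α : Type*} [LinearOrder α] (l : List α) (a : α) :
    a ≤ l.foldl max a ∧ ∀ b ∈ l, b ≤ l.foldl max a := by
  induction l generalizing a with
  | nil => simp
  | cons c l ih =>
    obtain ⟨le_init, le_mem⟩ := ih (max a c)
    rw [List.foldl_cons]
    refine ⟨(le_max_left _ _).trans le_init, fun b hb => ?_⟩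
    rcases List.mem_cons.1 hb with rfl | hb
    · exact (le_max_right _ _).trans le_init
    · exact le_mem b hb

theorem foldl_max_eq_or_mem {α : Type*} [LinearOrder α] (l : List α) (a : α) :
    l.foldl max a = a ∨ l.foldl max a ∈ l := by
  induction l generalizing a with
  | nil => simp
  | cons c l ih =>
    rw [List.foldl_cons, List.mem_cons]
    rcases ih (max a c) with eq | mem
    · rw [eq]
      rcases max_choice a c with h | h <;> simp [h]
    · exact .inr (.inr mem)

theorem filter_append_filter_not {β : Type*} (P : β → Bool) {l : List β}
    (h : l.Pairwise fun a b => P b = true → P a = true) :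
    l.filter P ++ l.filter (fun a => !P a) = l := by
  induction l with
  | nil => rfl
  | cons a l ih =>
    obtain ⟨head_le, pairwise⟩ := List.pairwise_cons.1 h
    cases ha : P a
    · have not_mem : ∀ b ∈ l, P b = false := fun b hb =>
        Bool.eq_false_iff.2 fun hb' => by simp [head_le b hb hb'] at ha
      have filter_nil : l.filter P = [] :=
        List.filter_eq_nil_iff.2 fun b hb => by simp [not_mem b hb]
      have filter_self : l.filter (fun a => !P a) = l :=
        List.filter_eq_self.2 fun b hb => by simp [not_mem b hb]
      simp [ha, filter_nil, filter_self]
    · simp [ha, ih pairwise]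

end Lists

/-! ### The data of an input -/

section Input

variable {I : Instance}

/-- A vertex without outgoing edges. -/
def IsSink (v : Fin I.n) : Prop := ∀ w, I.graph.arc v w = false

theorem arc_irrefl (v : Fin I.n) : I.graph.arc v v = false :=
  Bool.eq_false_iff.2 fun h => I.acyclic v (.single h)

theorem ne_of_arc {u v : Fin I.n} (h : I.graph.arc u v = true) : u ≠ v := by
  rintro rfl
  simp [arc_irrefl] at h

theorem IsSink.eq {u v : Fin I.n} (hu : IsSink u) (hv : IsSink v) : u = v :=
  I.unique_sink.unique hu hv

theorem n_pos (I : Instance) : 0 < I.n :=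
  let ⟨v, _⟩ := I.unique_sink
  v.pos

@[simp] theorem length_netOf (I : Instance) : (netOf I).length = I.n := by simp [netOf]

theorem vertex_netOf (v : Fin I.n) : vertex (netOf I) v = vertexOf I v := by
  unfold vertex
  rw [List.getD_eq_getElem?_getD, List.getElem?_eq_getElem (by simp)]
  simp [netOf]

theorem neighbors_netOf (v : Fin I.n) : neighbors (netOf I) v = (I.graph.rot v).map Fin.val := by
  rw [neighbors, vertex_netOf, vertexOf, List.map_map]
  rfl

theorem hasArc_netOf (u v : Fin I.n) : hasArc (netOf I) u v = I.graph.arc u v := by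
  rw [hasArc, vertex_netOf, Bool.eq_iff_iff]
  simp only [vertexOf, List.any_map, List.any_eq_true, Function.comp, Bool.and_eq_true, beq_iff_eq,
    Fin.val_inj]
  constructor
  · rintro ⟨w, -, rfl, h⟩
    exact h
  · exact fun h => ⟨v, (I.graph.mem_rot u v).2 (.inl h), rfl, h⟩

theorem adjacent_netOf (u v : Fin I.n) : adjacent (netOf I) u v = true ↔
    I.graph.arc u v = true ∨ I.graph.arc v u = true := by
  simp [adjacent, hasArc_netOf]

theorem exists_firstOut (v : Fin I.n) : ∃ w : Fin I.n, firstOut (netOf I) v = w ∧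
    (I.graph.arc v w = true ∨ w = v ∧ IsSink v) := by
  unfold firstOut
  rw [vertex_netOf]
  cases h : ((vertexOf I v).2.filter fun q => q.2).map fun q => q.1 with
  | nil =>
    refine ⟨v, rfl, .inr ⟨rfl, fun w => Bool.eq_false_iff.2 fun hw => ?_⟩⟩
    rw [List.map_eq_nil_iff, List.filter_eq_nil_iff] at h
    exact h (w.val, I.graph.arc v w)
      (List.mem_map_of_mem ((I.graph.mem_rot v w).2 (.inl hw))) hw
  | cons x l =>
    have mem : x ∈ ((vertexOf I v).2.filter fun q => q.2).map fun q => q.1 := by simp [h]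
    simp only [vertexOf, List.mem_map, List.mem_filter] at mem
    obtain ⟨q, ⟨⟨w, -, rfl⟩, arc⟩, rfl⟩ := mem
    exact ⟨w, rfl, .inl arc⟩

/-- The first out-neighbour of a vertex, or itself for the sink. -/
noncomputable def parent (v : Fin I.n) : Fin I.n := (exists_firstOut v).choose

theorem firstOut_netOf (v : Fin I.n) : firstOut (netOf I) v = parent v :=
  (exists_firstOut v).choose_spec.1

theorem arc_parent {v : Fin I.n} (h : ¬ IsSink v) : I.graph.arc v (parent v) = true :=
  (exists_firstOut v).choose_spec.2.resolve_right fun h' => h h'.2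

theorem IsSink.parent_eq {v : Fin I.n} (h : IsSink v) : parent v = v :=
  ((exists_firstOut v).choose_spec.2.resolve_left (by simp [h _])).1

theorem isSink_iff {v : Fin I.n} : IsSink v ↔ parent v = v := by
  refine ⟨IsSink.parent_eq, fun h => ?_⟩
  by_contra not_sink
  exact ne_of_arc (arc_parent not_sink) h.symm

theorem IsSink.iterate_eq {v : Fin I.n} (h : IsSink v) (k : ℕ) : parent^[k] v = v :=
  Function.iterate_fixed h.parent_eq k

theorem not_isSink_of_iterate {v : Fin I.n} {k : ℕ} (h : ¬ IsSink (parent^[k] v)) : ¬ IsSink v :=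
  fun hv => h (by rwa [hv.iterate_eq])

theorem transGen_iterate {v : Fin I.n} (k : ℕ) (h : ¬ IsSink (parent^[k] v)) :
    Relation.TransGen (fun a b => I.graph.arc a b = true) v (parent^[k + 1] v) := by
  induction k with
  | zero => exact .single (arc_parent h)
  | succ k ih =>
    rw [Function.iterate_succ_apply']
    refine .tail (ih fun h' => h ?_) (arc_parent h)
    rwa [Function.iterate_succ_apply', h'.parent_eq]

theorem isSink_iterate (v : Fin I.n) : IsSink (parent^[I.n] v) := by
  by_contra h
  have not_isSink (k : ℕ) (hk : k ≤ I.n) : ¬ IsSink (parent^[k] v) := by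
    refine not_isSink_of_iterate (k := I.n - k) ?_
    rwa [← Function.iterate_add_apply, Nat.sub_add_cancel hk]
  have ne_of_lt (i j : ℕ) (hij : i < j) (hj : j ≤ I.n) : parent^[i] v ≠ parent^[j] v := by
    intro eq
    obtain ⟨m, rfl⟩ := Nat.exists_eq_add_of_lt hij
    have not_isSink_m : ¬ IsSink (parent^[m] (parent^[i] v)) := by
      rw [← Function.iterate_add_apply, add_comm]
      exact not_isSink _ (by omega)
    have cycle := transGen_iterate m not_isSink_m
    rw [← Function.iterate_add_apply, show m + 1 + i = i + m + 1 by omega, ← eq] at cycle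
    exact I.acyclic _ cycle
  obtain ⟨i, j, hij, eq⟩ :=
    Fintype.exists_ne_map_eq_of_card_lt (fun j : Fin (I.n + 1) => parent^[j.val] v) (by simp)
  rcases hij.lt_or_gt with h | h
  · exact ne_of_lt i j h (by omega) eq
  · exact ne_of_lt j i h (by omega) eq.symm

theorem iterate_firstOut_netOf (v : Fin I.n) (k : ℕ) :
    (firstOut (netOf I))^[k] v = (parent^[k] v).val := by
  induction k with
  | zero => rfl
  | succ k ih =>
    rw [Function.iterate_succ_apply', Function.iterate_succ_apply', ih, firstOut_netOf]

theorem mem_outPath {v : Fin I.n} {x : ℕ} :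
    x ∈ outPath (netOf I) v ↔ ∃ k ≤ I.n, (parent^[k] v).val = x := by
  simp only [outPath, List.mem_iterate, length_netOf, Nat.lt_succ_iff, iterate_firstOut_netOf,
    eq_comm]

theorem boxDenom_pos (v : Fin I.n) : 0 < boxDenom (netOf I) v := by
  rw [boxDenom, vertex_netOf]
  exact Nat.mul_pos (I.width v).den_pos (I.height v).den_pos

theorem prod_map_range (n : ℕ) (f : ℕ → ℕ) :
    ((List.range n).map f).prod = ∏ i ∈ Finset.range n, f i :=
  rfl

theorem coDenom_pos (v : Fin I.n) : 0 < coDenom (netOf I) v := by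
  rw [coDenom, prod_map_range, length_netOf]
  refine Finset.prod_pos fun j hj => ?_
  cases j == v.val
  · exact boxDenom_pos ⟨j, Finset.mem_range.1 hj⟩
  · exact Nat.one_pos

theorem commonDenom_eq (v : Fin I.n) :
    commonDenom (netOf I) = boxDenom (netOf I) v * coDenom (netOf I) v := by
  rw [commonDenom, coDenom, prod_map_range, prod_map_range, length_netOf]
  have hv : v.val ∈ Finset.range I.n := Finset.mem_range.2 v.isLt
  rw [← Finset.mul_prod_erase _ _ hv,
    ← Finset.mul_prod_erase _ (fun j => bif j == v.val then 1 else boxDenom (netOf I) j) hv,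
    beq_self_eq_true, cond_true, one_mul]
  congr 1
  refine Finset.prod_congr rfl fun j hj => ?_
  rw [beq_eq_false_iff_ne.2 (Finset.ne_of_mem_erase hj), cond_false]

theorem commonDenom_pos (I : Instance) : 0 < commonDenom (netOf I) := by
  rw [commonDenom_eq ⟨0, n_pos I⟩]
  exact Nat.mul_pos (boxDenom_pos _) (coDenom_pos _)

theorem width_val (v : Fin I.n) :
    (I.width v).val =
      scaledWidth (netOf I) v / ((I.n * commonDenom (netOf I) : ℕ) : ℝ) := by
  have := coDenom_pos v
  have := (I.width v).den_pos
  have := (I.height v).den_pos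
  have := n_pos I
  have num_eq : (((I.width v).num.natAbs : ℕ) : ℝ) = (I.width v).num := by
    rw [Nat.cast_natAbs, abs_of_pos (I.width_pos v)]
  rw [commonDenom_eq v, scaledWidth, boxDenom, vertex_netOf, length_netOf, Fraction.val, ← num_eq,
    vertexOf]
  push_cast
  field_simp

theorem height_val (v : Fin I.n) :
    (I.height v).val = scaledHeight (netOf I) v / (commonDenom (netOf I) : ℝ) := by
  have := coDenom_pos v
  have := (I.width v).den_pos
  have := (I.height v).den_pos
  have num_eq : (((I.height v).num.natAbs : ℕ) : ℝ) = (I.height v).num := by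
    rw [Nat.cast_natAbs, abs_of_pos (I.height_pos v)]
  rw [commonDenom_eq v, scaledHeight, boxDenom, vertex_netOf, Fraction.val, ← num_eq, vertexOf]
  push_cast
  field_simp

theorem scaledWidth_pos (v : Fin I.n) : 0 < scaledWidth (netOf I) v := by
  rw [scaledWidth, vertex_netOf, length_netOf]
  exact Nat.mul_pos (n_pos I) (Nat.mul_pos (Nat.mul_pos (Int.natAbs_pos.2 (I.width_pos v).ne')
    (I.height v).den_pos) (coDenom_pos v))

theorem scaledHeight_pos (v : Fin I.n) : 0 < scaledHeight (netOf I) v := by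
  rw [scaledHeight, vertex_netOf]
  exact Nat.mul_pos (Nat.mul_pos (Int.natAbs_pos.2 (I.height_pos v).ne') (I.width v).den_pos)
    (coDenom_pos v)

theorem depth_eq (v : Fin I.n) : depth (netOf I) v = ∑ k ∈ Finset.range (I.n + 1),
    if parent (parent^[k] v) = parent^[k] v then 0 else
      scaledHeight (netOf I) (parent^[k] v) := by
  rw [depth, outPath, ← List.range_map_iterate, length_netOf, List.map_map]
  change ∑ k ∈ Finset.range (I.n + 1), _ = _
  refine Finset.sum_congr rfl fun k _ => ?_
  simp only [Function.comp, iterate_firstOut_netOf, firstOut_netOf]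
  by_cases h : parent (parent^[k] v) = parent^[k] v
  · simp [h]
  · rw [beq_eq_false_iff_ne.2 fun h' => h (Fin.ext h'), cond_false, if_neg h]

theorem depth_sink {v : Fin I.n} (h : IsSink v) : depth (netOf I) v = 0 := by
  rw [depth_eq]
  exact Finset.sum_eq_zero fun k _ => by simp [h.iterate_eq, h.parent_eq]

theorem depth_parent {v : Fin I.n} (h : ¬ IsSink v) :
    depth (netOf I) v = depth (netOf I) (parent v) + scaledHeight (netOf I) v := by
  rw [depth_eq, depth_eq, Finset.sum_range_succ', Finset.sum_range_succ]
  have stays : parent (parent^[I.n] (parent v)) = parent^[I.n] (parent v) :=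
    (isSink_iterate _).parent_eq
  have moves : parent v ≠ v := fun h' => h (isSink_iff.2 h')
  simp only [Function.iterate_succ_apply, stays, if_true, Function.iterate_zero, id, moves,
    if_false, add_zero]
  rfl

end Input

/-! ### Soundness of the check -/

section Soundness

variable {I : Instance}

/-- The coordinates of the boxes in the placement with the abscissae `x`. -/
def coord (I : Instance) (x : List ℕ) (v : Fin I.n) : Fraction × Fraction :=
  (⟨(x.getD v 0 : ℕ), I.n * commonDenom (netOf I), Nat.mul_pos (n_pos I) (commonDenom_pos I)⟩,
    ⟨-(depth (netOf I) v : ℕ), commonDenom (netOf I), commonDenom_pos I⟩)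

/-- The placement with the abscissae `x`, given in units of `1 / (n * commonDenom (netOf I))`; the
sink lies on the `x`-axis. -/
noncomputable def place (I : Instance) (x : List ℕ) (v : Fin I.n) : ℝ × ℝ :=
  ((coord I x v).1.val, (coord I x v).2.val)

theorem cast_mul_commonDenom_pos (I : Instance) :
    (0 : ℝ) < ((I.n * commonDenom (netOf I) : ℕ) : ℝ) :=
  Nat.cast_pos.2 (Nat.mul_pos (n_pos I) (commonDenom_pos I))

theorem cast_commonDenom_pos (I : Instance) : (0 : ℝ) < (commonDenom (netOf I) : ℝ) :=
  Nat.cast_pos.2 (commonDenom_pos I)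

section Place

variable {x : List ℕ} {u v : Fin I.n}

theorem left_place :
    I.left (place I x) v = (x.getD v 0 : ℕ) / ((I.n * commonDenom (netOf I) : ℕ) : ℝ) := by
  simp [Instance.left, place, coord, Fraction.val]

theorem right_place : I.right (place I x) v =
    ((x.getD v 0 + scaledWidth (netOf I) v : ℕ) : ℝ) /
      ((I.n * commonDenom (netOf I) : ℕ) : ℝ) := by
  rw [Instance.right, width_val, Nat.cast_add, add_div]
  rfl

theorem left_lt_right_place : I.left (place I x) u < I.right (place I x) v ↔
    x.getD u 0 < x.getD v 0 + scaledWidth (netOf I) v := by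
  rw [left_place, right_place, div_lt_div_iff_of_pos_right (cast_mul_commonDenom_pos I),
    Nat.cast_lt]

theorem left_lt_left_place :
    I.left (place I x) u < I.left (place I x) v ↔ x.getD u 0 < x.getD v 0 := by
  rw [left_place, left_place, div_lt_div_iff_of_pos_right (cast_mul_commonDenom_pos I),
    Nat.cast_lt]

theorem right_eq_left_place : I.right (place I x) u = I.left (place I x) v ↔
    x.getD u 0 + scaledWidth (netOf I) u = x.getD v 0 := by
  rw [left_place, right_place, div_left_inj' (cast_mul_commonDenom_pos I).ne', Nat.cast_inj]

theorem low_place :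
    I.low (place I x) v = -(depth (netOf I) v : ℝ) / (commonDenom (netOf I) : ℝ) := by
  simp [Instance.low, place, coord, Fraction.val]

theorem high_place : I.high (place I x) v =
    (scaledHeight (netOf I) v - depth (netOf I) v : ℝ) / (commonDenom (netOf I) : ℝ) := by
  have low_eq := low_place (x := x) (v := v)
  rw [Instance.low] at low_eq
  rw [Instance.high, height_val, low_eq]
  ring

theorem low_lt_high_place : I.low (place I x) u < I.high (place I x) v ↔
    depth (netOf I) v < depth (netOf I) u + scaledHeight (netOf I) v := by
  rw [low_place, high_place, div_lt_div_iff_of_pos_right (cast_commonDenom_pos I),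
    ← Nat.cast_lt (α := ℝ)]
  push_cast
  constructor <;> intro h <;> linarith

theorem high_eq_low_place : I.high (place I x) u = I.low (place I x) v ↔
    depth (netOf I) u = depth (netOf I) v + scaledHeight (netOf I) u := by
  rw [low_place, high_place, div_left_inj' (cast_commonDenom_pos I).ne', ← Nat.cast_inj (R := ℝ)]
  push_cast
  constructor <;> intro h <;> linarith

theorem topContact_place : I.TopContact (place I x) u v ↔
    depth (netOf I) u = depth (netOf I) v + scaledHeight (netOf I) u ∧
      x.getD u 0 < x.getD v 0 + scaledWidth (netOf I) v ∧
      x.getD v 0 < x.getD u 0 + scaledWidth (netOf I) u := by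
  have := scaledWidth_pos u
  have := scaledWidth_pos v
  simp only [Instance.TopContact, high_eq_low_place, max_lt_iff, lt_min_iff, left_lt_right_place]
  omega

theorem sideContact_place (h : I.SideContact (place I x) u v) :
    x.getD u 0 + scaledWidth (netOf I) u = x.getD v 0 ∧
      depth (netOf I) v < depth (netOf I) u + scaledHeight (netOf I) v ∧
      depth (netOf I) u < depth (netOf I) v + scaledHeight (netOf I) u := by
  simp only [Instance.SideContact, right_eq_left_place, max_lt_iff, lt_min_iff,
    low_lt_high_place] at h
  omega

theorem disjoint_openBox_place (h : ¬ (x.getD u 0 < x.getD v 0 + scaledWidth (netOf I) v ∧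
    x.getD v 0 < x.getD u 0 + scaledWidth (netOf I) u ∧
    depth (netOf I) v < depth (netOf I) u + scaledHeight (netOf I) v ∧
    depth (netOf I) u < depth (netOf I) v + scaledHeight (netOf I) u)) :
    Disjoint (I.openBox (place I x) u) (I.openBox (place I x) v) := by
  rw [Set.disjoint_left]
  rintro ⟨a, b⟩ ⟨⟨left_u, right_u⟩, low_u, high_u⟩ ⟨⟨left_v, right_v⟩, low_v, high_v⟩
  exact h ⟨left_lt_right_place.1 (left_u.trans right_v),
    left_lt_right_place.1 (left_v.trans right_u), low_lt_high_place.1 (low_u.trans high_v),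
    low_lt_high_place.1 (low_v.trans high_u)⟩

end Place

section Face

theorem headD_dropWhile_eq_formPerm {n : ℕ} {l : List (Fin n)} (hl : l.Nodup) {x : Fin n}
    (hx : x ∈ l) :
    (((l.map Fin.val).dropWhile fun y => y != x.val).tail ++ l.map Fin.val).headD x.val =
      (l.formPerm x).val := by
  obtain ⟨l₁, l₂, rfl, hn⟩ := List.eq_append_cons_of_mem hx
  have dropWhile_eq : (((l₁ ++ x :: l₂).map Fin.val).dropWhile fun y => y != x.val) =
      x.val :: l₂.map Fin.val := by
    have not_mem : x.val ∉ l₁.map Fin.val := fun h => hn ((List.mem_map_of_injective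
      Fin.val_injective).1 h)
    rw [List.map_append, List.dropWhile_append_of_pos (forall_mem_bne not_mem)]
    simp
  have isRotated : (l₁ ++ x :: l₂).IsRotated (x :: (l₂ ++ l₁)) := List.isRotated_append
  rw [dropWhile_eq, List.formPerm_eq_of_isRotated hl isRotated, List.tail_cons, List.map_append,
    ← List.append_assoc, ← List.map_append]
  cases h : l₂ ++ l₁ with
  | nil => simp
  | cons y l =>
    rw [h] at isRotated
    rw [List.formPerm_apply_head _ _ _ (isRotated.nodup_iff.1 hl)]
    rfl

theorem isDart_iff_fst_mem {d : Fin I.n × Fin I.n} :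
    I.graph.IsDart d ↔ d.1 ∈ I.graph.rot d.2 := by
  rw [RotationSystem.IsDart, I.graph.mem_rot, I.graph.mem_rot, or_comm]

theorem isDart_faceNext {d : Fin I.n × Fin I.n} (h : I.graph.IsDart d) :
    I.graph.IsDart (I.graph.faceNext d) :=
  List.formPerm_mem_iff_mem.2 (isDart_iff_fst_mem.1 h)

theorem isDart_iterate_faceNext {d : Fin I.n × Fin I.n} (h : I.graph.IsDart d) (k : ℕ) :
    I.graph.IsDart (I.graph.faceNext^[k] d) := by
  induction k with
  | zero => exact h
  | succ k ih => rw [Function.iterate_succ_apply']; exact isDart_faceNext ih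

theorem nextDart_netOf {d : Fin I.n × Fin I.n} (h : I.graph.IsDart d) :
    nextDart (netOf I) (d.1.val, d.2.val) =
      ((I.graph.faceNext d).1.val, (I.graph.faceNext d).2.val) := by
  rw [nextDart]
  refine Prod.ext rfl ?_
  simp only [neighbors_netOf]
  exact headD_dropWhile_eq_formPerm (I.graph.rot_nodup d.2) (isDart_iff_fst_mem.1 h)

theorem iterate_nextDart_netOf {d : Fin I.n × Fin I.n} (h : I.graph.IsDart d) (k : ℕ) :
    (nextDart (netOf I))^[k] (d.1.val, d.2.val) =
      ((I.graph.faceNext^[k] d).1.val, (I.graph.faceNext^[k] d).2.val) := by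
  induction k with
  | zero => rfl
  | succ k ih =>
    rw [Function.iterate_succ_apply', Function.iterate_succ_apply', ih,
      nextDart_netOf (isDart_iterate_faceNext h k)]

end Face

section Check

variable {x : List ℕ}

theorem topContact_of_checkPair {u v : Fin I.n} (h : checkPair (netOf I) x u v = true)
    (arc : I.graph.arc u v = true) : I.TopContact (place I x) u v := by
  rw [checkPair, hasArc_netOf, arc] at h
  rw [topContact_place]
  simp only [cond_true, Bool.and_eq_true, beq_iff_eq, decide_eq_true_eq] at h
  tauto

theorem not_meet_of_checkPair {u v : Fin I.n} (h : checkPair (netOf I) x u v = true) (huv : u ≠ v)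
    (hadj : ¬ (I.graph.arc u v = true ∨ I.graph.arc v u = true)) :
    ¬ (x.getD u 0 < x.getD v 0 + scaledWidth (netOf I) v ∧
        x.getD v 0 < x.getD u 0 + scaledWidth (netOf I) u ∧
        depth (netOf I) v ≤ depth (netOf I) u + scaledHeight (netOf I) v ∧
        depth (netOf I) u ≤ depth (netOf I) v + scaledHeight (netOf I) u) ∧
      ¬ (x.getD u 0 ≤ x.getD v 0 + scaledWidth (netOf I) v ∧
        x.getD v 0 ≤ x.getD u 0 + scaledWidth (netOf I) u ∧
        depth (netOf I) v < depth (netOf I) u + scaledHeight (netOf I) v ∧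
        depth (netOf I) u < depth (netOf I) v + scaledHeight (netOf I) u) := by
  obtain ⟨not_arc, not_arc'⟩ := not_or.1 hadj
  rw [checkPair, hasArc_netOf, hasArc_netOf, Bool.eq_false_iff.2 not_arc,
    Bool.eq_false_iff.2 not_arc', beq_eq_false_iff_ne.2 fun h => huv (Fin.ext h)] at h
  simp only [cond_false, Bool.false_or, Bool.and_eq_true, Bool.not_eq_true', closedMeet, openMeet,
    Bool.and_eq_false_iff, decide_eq_false_iff_not] at h
  tauto

theorem touch_iff_of_checkPair (h : ∀ u v : Fin I.n, checkPair (netOf I) x u v = true)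
    {u v : Fin I.n} (huv : u ≠ v) :
    I.Touch (place I x) u v ↔ (I.graph.arc u v = true ∨ I.graph.arc v u = true) := by
  constructor
  · intro touch
    by_contra hadj
    obtain ⟨not_closed, not_open⟩ := not_meet_of_checkPair (h u v) huv hadj
    have := scaledWidth_pos u
    have := scaledWidth_pos v
    have := scaledHeight_pos u
    have := scaledHeight_pos v
    rcases touch with top | top | side | side
    · rw [topContact_place] at top; omega
    · rw [topContact_place] at top; omega
    · have := sideContact_place side; omega
    · have := sideContact_place side; omega
  · rintro (arc | arc)
    · exact .inl (topContact_of_checkPair (h u v) arc)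
    · exact .inr (.inl (topContact_of_checkPair (h v u) arc))

theorem isRepresentation_of_checkPair
    (h : ∀ u v : Fin I.n, checkPair (netOf I) x u v = true) : I.IsRepresentation (place I x) := by
  refine fun u v huv => disjoint_openBox_place ?_
  by_cases hadj : I.graph.arc u v = true ∨ I.graph.arc v u = true
  · rcases hadj with arc | arc
    · have := topContact_place.1 (topContact_of_checkPair (h u v) arc); omega
    · have := topContact_place.1 (topContact_of_checkPair (h v u) arc); omega
  · have := (not_meet_of_checkPair (h u v) huv hadj).1
    omega

theorem exists_pairwise_mayPrecede {v : Fin I.n} (h : checkRotation (netOf I) x v = true) :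
    ∃ l, (I.graph.rot v).IsRotated l ∧
      l.Pairwise fun a b : Fin I.n => mayPrecede (netOf I) x v a b = true := by
  rw [checkRotation, List.any_eq_true] at h
  obtain ⟨s, -, hs⟩ := h
  obtain ⟨k, hk⟩ := isRotated_rotateTo s (neighbors (netOf I) v)
  rw [← hk, neighbors_netOf, ← List.map_rotate] at hs
  refine ⟨(I.graph.rot v).rotate k, ⟨k, rfl⟩,
    List.pairwise_iff_forall_sublist.2 fun {a b} hab => ?_⟩
  have precedes_ab := precedes_iff.2 (hab.map Fin.val)
  have mem_a : a ∈ (I.graph.rot v).rotate k := hab.subset (by simp)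
  have mem_b : b ∈ (I.graph.rot v).rotate k := hab.subset (by simp)
  have check_ab := List.all_eq_true.1 (List.all_eq_true.1 hs _ (List.mem_map_of_mem mem_a)) _
    (List.mem_map_of_mem mem_b)
  rw [precedes_ab] at check_ab
  simpa using check_ab

theorem clockwiseContacts_of_checkRotation {v : Fin I.n}
    (h : checkRotation (netOf I) x v = true)
    (top : ∀ u w : Fin I.n, I.graph.arc u w = true → I.TopContact (place I x) u w) :
    I.ClockwiseContacts (place I x) v (I.graph.rot v) := by
  obtain ⟨l, isRotated, pairwise⟩ := exists_pairwise_mayPrecede h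
  simp only [mayPrecede, hasArc_netOf] at pairwise
  have split := filter_append_filter_not (fun a => I.graph.arc v a) (l := l)
    (pairwise.imp fun {a b} hab hb => by
      cases ha : I.graph.arc v a
      · simp [ha, hb] at hab
      · rfl)
  refine ⟨l.filter fun a => I.graph.arc v a, l.filter fun a => !I.graph.arc v a,
    by rwa [split], fun w hw => top v w (List.of_mem_filter hw), ?_, fun w hw => ?_, ?_⟩
  · refine List.pairwise_filter.2 (pairwise.imp fun {a b} hab ha hb => ?_)
    rw [left_lt_left_place]
    simpa [ha, hb] using hab
  · have mem : w ∈ I.graph.rot v := isRotated.mem_iff.2 (List.mem_of_mem_filter hw)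
    have not_arc : I.graph.arc v w = false := by simpa using List.of_mem_filter hw
    exact top w v (((I.graph.mem_rot v w).1 mem).resolve_left (by simp [not_arc]))
  · refine List.pairwise_filter.2 (pairwise.imp fun {a b} hab ha hb => ?_)
    rw [left_lt_left_place]
    rw [Bool.not_eq_true'] at ha hb
    simpa [ha, hb] using hab

theorem high_place_le_of_isSink {s : Fin I.n} (hs : IsSink s) (u : Fin I.n) :
    I.high (place I x) u ≤ I.high (place I x) s := by
  by_cases hu : IsSink u
  · rw [hu.eq hs]
  · rw [high_place, high_place, div_le_div_iff_of_pos_right (cast_commonDenom_pos I),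
      depth_sink hs, depth_parent hu]
    push_cast
    linarith [(depth (netOf I) (parent u)).cast_nonneg (α := ℝ),
      (scaledHeight (netOf I) s).cast_nonneg (α := ℝ)]

theorem exists_isUnboundedDart_of_checkOuter
    (pair : ∀ u v : Fin I.n, checkPair (netOf I) x u v = true)
    (h : checkOuter (netOf I) (outerOf I) x = true) {d : Fin I.n × Fin I.n}
    (hd : I.outer = some d) : ∃ e, I.IsUnboundedDart (place I x) e ∧ e ∈ I.graph.faceOf d := by
  rw [checkOuter, show outerOf I = [d.1.val, d.2.val] by rw [outerOf, hd]] at h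
  simp only [List.isEmpty_cons, Bool.false_or, List.getD_cons_zero, List.getD_cons_succ,
    List.any_eq_true, face, List.mem_iterate, Bool.and_eq_true] at h
  obtain ⟨e, ⟨k, -, rfl⟩, ⟨sink, arc⟩, rightmost⟩ := h
  rw [iterate_nextDart_netOf (I.outer_some d hd)] at sink arc rightmost
  refine ⟨I.graph.faceNext^[k] d, ?_, k, rfl⟩
  set e := I.graph.faceNext^[k] d
  rw [firstOut_netOf, beq_iff_eq] at sink
  rw [hasArc_netOf] at arc
  have sink : IsSink e.1 := isSink_iff.2 (Fin.ext sink)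
  refine ⟨high_place_le_of_isSink sink, topContact_of_checkPair (pair _ _) arc, fun u hu => ?_⟩
  have ne : u ≠ e.1 := by
    rintro rfl
    have := (topContact_place.1 hu).1
    have := scaledHeight_pos e.1
    omega
  have arc_u : I.graph.arc u e.1 = true :=
    ((touch_iff_of_checkPair pair ne).1 (.inl hu)).resolve_right (by simp [sink u])
  simp only [List.all_eq_true, List.mem_range, length_netOf] at rightmost
  have le := rightmost u u.isLt
  rw [hasArc_netOf, arc_u] at le
  rw [← not_lt, left_lt_left_place]
  simpa using le

theorem hierarchicallyRealizes_of_check (h : check (netOf I) (outerOf I) x = true) :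
    I.HierarchicallyRealizes (place I x) := by
  simp only [check, Bool.and_eq_true, List.all_eq_true, List.mem_range, length_netOf] at h
  obtain ⟨⟨pair, rotation⟩, outer⟩ := h
  have pair (u v : Fin I.n) := pair u u.isLt v v.isLt
  have top (u v : Fin I.n) := topContact_of_checkPair (pair u v)
  exact ⟨isRepresentation_of_checkPair pair, fun _ _ => touch_iff_of_checkPair pair, top,
    fun v => clockwiseContacts_of_checkRotation (rotation v v.isLt) top,
    fun _ => exists_isUnboundedDart_of_checkOuter pair outer⟩

end Check

end Soundness

/-! ### The geometry of a realization -/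

section Realization

variable {I : Instance} {p : Fin I.n → ℝ × ℝ} {u v w : Fin I.n}

theorem left_lt_right (p : Fin I.n → ℝ × ℝ) (v : Fin I.n) : I.left p v < I.right p v := by
  rw [Instance.left, Instance.right, width_val]
  exact lt_add_of_pos_right _
    (div_pos (Nat.cast_pos.2 (scaledWidth_pos v)) (cast_mul_commonDenom_pos I))

theorem low_lt_high (p : Fin I.n → ℝ × ℝ) (v : Fin I.n) : I.low p v < I.high p v := by
  rw [Instance.low, Instance.high, height_val]
  exact lt_add_of_pos_right _
    (div_pos (Nat.cast_pos.2 (scaledHeight_pos v)) (cast_commonDenom_pos I))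

theorem topContact_iff : I.TopContact p u v ↔
    I.high p u = I.low p v ∧ I.left p u < I.right p v ∧ I.left p v < I.right p u := by
  have := left_lt_right p u
  have := left_lt_right p v
  simp only [Instance.TopContact, max_lt_iff, lt_min_iff]
  tauto

theorem not_topContact_symm (h : I.TopContact p u v) : ¬ I.TopContact p v u := fun h' => by
  linarith [h.1, h'.1, low_lt_high p u, low_lt_high p v]

theorem Instance.IsRepresentation.separated (hr : I.IsRepresentation p) (huv : u ≠ v)
    (low_high : I.low p u < I.high p v) (high_low : I.low p v < I.high p u) :
    I.right p u ≤ I.left p v ∨ I.right p v ≤ I.left p u := by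
  by_contra! h
  have overlap_x : max (I.left p u) (I.left p v) < min (I.right p u) (I.right p v) := by
    simp [left_lt_right, h.1, h.2]
  have overlap_y : max (I.low p u) (I.low p v) < min (I.high p u) (I.high p v) := by
    simp [low_lt_high, low_high, high_low]
  obtain ⟨x, left_lt, lt_right⟩ := exists_between overlap_x
  obtain ⟨y, low_lt, lt_high⟩ := exists_between overlap_y
  rw [max_lt_iff] at left_lt low_lt
  rw [lt_min_iff] at lt_right lt_high
  have mem_u : (x, y) ∈ I.openBox p u := ⟨⟨left_lt.1, lt_right.1⟩, low_lt.1, lt_high.1⟩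
  have mem_v : (x, y) ∈ I.openBox p v := ⟨⟨left_lt.2, lt_right.2⟩, low_lt.2, lt_high.2⟩
  exact Set.disjoint_left.1 (hr u v huv) mem_u mem_v

/-- The ancestors `parent^[i] a` and `parent^[j] b` are children of the same box, the first one to
the left of the second one. -/
structure BranchLeft (p : Fin I.n → ℝ × ℝ) (i j : ℕ) (a b : Fin I.n) : Prop where
  not_isSink_left : ¬ IsSink (parent^[i] a)
  not_isSink_right : ¬ IsSink (parent^[j] b)
  parent_eq : parent (parent^[i] a) = parent (parent^[j] b)
  right_le_left : I.right p (parent^[i] a) ≤ I.left p (parent^[j] b)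

namespace Instance.HierarchicallyRealizes

theorem separated_strict (hp : I.HierarchicallyRealizes p) (huv : u ≠ v)
    (low_high : I.low p u < I.high p v) (high_low : I.low p v < I.high p u) :
    I.right p u < I.left p v ∨ I.right p v < I.left p u := by
  have not_touch : ¬ I.Touch p u v := fun touch => by
    rcases (hp.contact_graph u v huv).1 touch with arc | arc
    · exact high_low.ne' (hp.upward _ _ arc).1
    · exact low_high.ne' (hp.upward _ _ arc).1
  have overlap : max (I.low p u) (I.low p v) < min (I.high p u) (I.high p v) := by
    simp [low_lt_high, low_high, high_low]
  rcases hp.representation.separated huv low_high high_low with le | le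
  · exact .inl (le.lt_of_ne fun eq => not_touch (.inr (.inr (.inl ⟨eq, overlap⟩))))
  · exact .inr (le.lt_of_ne fun eq =>
      not_touch (.inr (.inr (.inr ⟨eq, by rwa [max_comm, min_comm]⟩))))

theorem separated_of_not_adjacent (hp : I.HierarchicallyRealizes p) (huv : u ≠ v)
    (hadj : ¬ (I.graph.arc u v = true ∨ I.graph.arc v u = true))
    (low_high : I.low p u ≤ I.high p v) (high_low : I.low p v ≤ I.high p u) :
    I.right p u ≤ I.left p v ∨ I.right p v ≤ I.left p u := by
  rw [← hp.contact_graph u v huv] at hadj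
  by_contra! overlap
  rcases low_high.lt_or_eq with low_lt | low_eq
  · rcases high_low.lt_or_eq with lt_high | eq_high
    · have := hp.representation.separated huv low_lt lt_high
      exact absurd this (by simpa using overlap)
    · exact hadj (.inl (topContact_iff.2 ⟨eq_high.symm, overlap.2, overlap.1⟩))
  · exact hadj (.inr (.inl (topContact_iff.2 ⟨low_eq.symm, overlap.1, overlap.2⟩)))

theorem arc_iff (hp : I.HierarchicallyRealizes p) :
    I.graph.arc u v = true ↔ I.TopContact p u v := by
  refine ⟨hp.upward u v, fun contact => ?_⟩
  have huv : u ≠ v := by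
    rintro rfl
    exact not_topContact_symm contact contact
  exact ((hp.contact_graph u v huv).1 (.inl contact)).resolve_right fun arc =>
    not_topContact_symm contact (hp.upward _ _ arc)

theorem topContact_parent (hp : I.HierarchicallyRealizes p) (h : ¬ IsSink v) :
    I.TopContact p v (parent v) :=
  hp.upward _ _ (arc_parent h)

theorem high_lt_high_parent (hp : I.HierarchicallyRealizes p) (h : ¬ IsSink v) :
    I.high p v < I.high p (parent v) := by
  rw [(hp.topContact_parent h).1]
  exact low_lt_high p _

theorem high_le_high_iterate (hp : I.HierarchicallyRealizes p) (v : Fin I.n) (k : ℕ) :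
    I.high p v ≤ I.high p (parent^[k] v) := by
  induction k with
  | zero => exact le_rfl
  | succ k ih =>
    rw [Function.iterate_succ_apply']
    by_cases h : IsSink (parent^[k] v)
    · rwa [h.parent_eq]
    · exact ih.trans (hp.high_lt_high_parent h).le

theorem iterate_ne_of_lt (hp : I.HierarchicallyRealizes p) {i j : ℕ} (hij : i < j)
    (hj : ¬ IsSink (parent^[j] v)) : parent (parent^[i] v) ≠ parent (parent^[j] v) := fun eq => by
  have lt_parent := hp.high_lt_high_parent hj
  have le_iterate := hp.high_le_high_iterate (parent^[i + 1] v) (j - (i + 1))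
  rw [← Function.iterate_add_apply, Nat.sub_add_cancel hij, Function.iterate_succ_apply', eq]
    at le_iterate
  linarith

section BranchLeft

variable {i j : ℕ} {a b : Fin I.n}

theorem ne_of_branchLeft (hp : I.HierarchicallyRealizes p) (h : BranchLeft p i j a b) :
    a ≠ b := by
  rintro rfl
  rcases lt_trichotomy i j with hij | rfl | hij
  · exact hp.iterate_ne_of_lt hij h.not_isSink_right h.parent_eq
  · exact h.right_le_left.not_gt (left_lt_right p _)
  · exact hp.iterate_ne_of_lt hij h.not_isSink_left h.parent_eq.symm

theorem high_eq_of_parent_eq (hp : I.HierarchicallyRealizes p) (ha : ¬ IsSink a)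
    (hb : ¬ IsSink b) (h : parent a = parent b) : I.high p a = I.high p b := by
  rw [(hp.topContact_parent ha).1, (hp.topContact_parent hb).1, h]

theorem high_le_of_branchLeft_zero_left (hp : I.HierarchicallyRealizes p)
    (h : BranchLeft p 0 j a b) : I.high p b ≤ I.high p a :=
  (hp.high_le_high_iterate b j).trans_eq
    (hp.high_eq_of_parent_eq h.not_isSink_left h.not_isSink_right h.parent_eq).symm

theorem high_le_of_branchLeft_zero_right (hp : I.HierarchicallyRealizes p)
    (h : BranchLeft p i 0 a b) : I.high p a ≤ I.high p b :=
  (hp.high_le_high_iterate a i).trans_eq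
    (hp.high_eq_of_parent_eq h.not_isSink_left h.not_isSink_right h.parent_eq)

/-- If `b` were to the left of `a`, then replacing the lower one of the two boxes by its parent,
which it touches, would give a smaller counterexample. -/
theorem right_le_left_of_branchLeft (hp : I.HierarchicallyRealizes p) {i j : ℕ} {a b : Fin I.n}
    (h : BranchLeft p i j a b) (low_high : I.low p a < I.high p b)
    (high_low : I.low p b < I.high p a) : I.right p a ≤ I.left p b := by
  have ⟨sink_a, sink_b, parent_eq, right_le⟩ := h
  obtain ⟨top_a, left_a, _⟩ :=
    topContact_iff.1 (hp.topContact_parent (not_isSink_of_iterate sink_a))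
  obtain ⟨top_b, _, right_b⟩ :=
    topContact_iff.1 (hp.topContact_parent (not_isSink_of_iterate sink_b))
  have := low_lt_high p (parent a)
  have := low_lt_high p (parent b)
  have := left_lt_right p a
  have := left_lt_right p b
  refine (hp.representation.separated (hp.ne_of_branchLeft h) low_high high_low).resolve_right
    fun wrong => ?_
  match i, j, lt_trichotomy (I.high p a) (I.high p b) with
  | 0, _, .inl lt => exact (hp.high_le_of_branchLeft_zero_left h).not_gt lt
  | i + 1, j, .inl lt =>
    have := right_le_left_of_branchLeft (i := i) (a := parent a) hp
      ⟨sink_a, sink_b, parent_eq, right_le⟩ (by linarith) (by linarith)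
    linarith
  | 0, 0, .inr (.inl _) => exact absurd right_le (by simpa using by linarith)
  | 0, j + 1, .inr (.inl eq) =>
    have := hp.high_le_of_branchLeft_zero_left (j := j) (b := parent b)
      ⟨sink_a, sink_b, parent_eq, right_le⟩
    linarith
  | i + 1, 0, .inr (.inl eq) =>
    have := hp.high_le_of_branchLeft_zero_right (i := i) (a := parent a)
      ⟨sink_a, sink_b, parent_eq, right_le⟩
    linarith
  | i + 1, j + 1, .inr (.inl eq) =>
    have := right_le_left_of_branchLeft (i := i) (j := j) (a := parent a) (b := parent b) hp
      ⟨sink_a, sink_b, parent_eq, right_le⟩ (by linarith) (by linarith)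
    linarith
  | _, 0, .inr (.inr lt) => exact (hp.high_le_of_branchLeft_zero_right h).not_gt lt
  | i, j + 1, .inr (.inr lt) =>
    have := right_le_left_of_branchLeft (j := j) (b := parent b) hp
      ⟨sink_a, sink_b, parent_eq, right_le⟩ (by linarith) (by linarith)
    linarith
termination_by i + j

theorem right_le_left_of_branchLeft_of_not_adjacent (hp : I.HierarchicallyRealizes p)
    (h : BranchLeft p i j a b) (hadj : ¬ (I.graph.arc a b = true ∨ I.graph.arc b a = true))
    (low_high : I.low p a ≤ I.high p b) (high_low : I.low p b ≤ I.high p a) :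
    I.right p a ≤ I.left p b := by
  have ⟨sink_a, sink_b, parent_eq, right_le⟩ := h
  obtain ⟨top_a, left_a, -⟩ :=
    topContact_iff.1 (hp.topContact_parent (not_isSink_of_iterate sink_a))
  obtain ⟨top_b, -, right_b⟩ :=
    topContact_iff.1 (hp.topContact_parent (not_isSink_of_iterate sink_b))
  have := low_lt_high p (parent a)
  have := low_lt_high p (parent b)
  have := low_lt_high p a
  have := low_lt_high p b
  have := left_lt_right p a
  have := left_lt_right p b
  refine (hp.separated_of_not_adjacent (hp.ne_of_branchLeft h) hadj low_high high_low).resolve_right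
    fun wrong => ?_
  rcases low_high.lt_or_eq with low_lt | low_eq
  · rcases high_low.lt_or_eq with lt_high | eq_high
    · have := hp.right_le_left_of_branchLeft h low_lt lt_high
      linarith
    · match i with
      | 0 =>
        have := hp.high_le_of_branchLeft_zero_left h
        linarith
      | i + 1 =>
        have := hp.right_le_left_of_branchLeft (i := i) (a := parent a)
          ⟨sink_a, sink_b, parent_eq, right_le⟩ (by linarith) (by linarith)
        linarith
  · match j with
    | 0 =>
      have := hp.high_le_of_branchLeft_zero_right h
      linarith
    | j + 1 =>
      have := hp.right_le_left_of_branchLeft (j := j) (b := parent b)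
        ⟨sink_a, sink_b, parent_eq, right_le⟩ (by linarith) (by linarith)
      linarith

end BranchLeft

theorem low_add_depth (hp : I.HierarchicallyRealizes p) (v : Fin I.n) (k : ℕ) :
    I.low p v + depth (netOf I) v / commonDenom (netOf I) =
      I.low p (parent^[k] v) + depth (netOf I) (parent^[k] v) / commonDenom (netOf I) := by
  induction k with
  | zero => rfl
  | succ k ih =>
    rw [ih, Function.iterate_succ_apply']
    by_cases h : IsSink (parent^[k] v)
    · rw [h.parent_eq]
    · have top := (hp.topContact_parent h).1
      rw [Instance.high, height_val] at top
      rw [depth_parent h, ← top, Instance.low]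
      push_cast
      ring

theorem low_add_depth_eq (hp : I.HierarchicallyRealizes p) (u v : Fin I.n) :
    I.low p u + depth (netOf I) u / commonDenom (netOf I) =
      I.low p v + depth (netOf I) v / commonDenom (netOf I) := by
  rw [hp.low_add_depth u I.n, hp.low_add_depth v I.n, (isSink_iterate u).eq (isSink_iterate v)]

theorem high_sub_low (hp : I.HierarchicallyRealizes p) (u v : Fin I.n) :
    I.high p v - I.low p u =
      (depth (netOf I) u + scaledHeight (netOf I) v - depth (netOf I) v) /
        commonDenom (netOf I) := by
  have := hp.low_add_depth_eq u v
  rw [Instance.high, height_val, ← Instance.low, sub_div, add_div]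
  linarith

theorem low_lt_high_iff (hp : I.HierarchicallyRealizes p) : I.low p u < I.high p v ↔
    depth (netOf I) v < depth (netOf I) u + scaledHeight (netOf I) v := by
  rw [← sub_pos, hp.high_sub_low, div_pos_iff_of_pos_right (cast_commonDenom_pos I), sub_pos]
  exact_mod_cast Iff.rfl

theorem low_le_high_iff (hp : I.HierarchicallyRealizes p) : I.low p u ≤ I.high p v ↔
    depth (netOf I) v ≤ depth (netOf I) u + scaledHeight (netOf I) v := by
  rw [← sub_nonneg, hp.high_sub_low, le_div_iff₀ (cast_commonDenom_pos I), zero_mul, sub_nonneg]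
  exact_mod_cast Iff.rfl

theorem closedMeet_iff (hp : I.HierarchicallyRealizes p) : closedMeet (netOf I) u v = true ↔
    I.low p u ≤ I.high p v ∧ I.low p v ≤ I.high p u := by
  simp only [closedMeet, Bool.and_eq_true, decide_eq_true_eq, hp.low_le_high_iff]

theorem openMeet_iff (hp : I.HierarchicallyRealizes p) : openMeet (netOf I) u v = true ↔
    I.low p u < I.high p v ∧ I.low p v < I.high p u := by
  simp only [openMeet, Bool.and_eq_true, decide_eq_true_eq, hp.low_lt_high_iff]

end Instance.HierarchicallyRealizes

/-- If the sink has contacts at all, the rightmost one is the box with index `g`. -/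
def IsRightmost (p : Fin I.n → ℝ × ℝ) (g : ℕ) : Prop :=
  ∀ c, IsSink c → ∀ u, I.TopContact p u c →
    ∃ r : Fin I.n, r.val = g ∧ I.TopContact p r c ∧ I.left p u ≤ I.left p r

theorem cutRotation_eq {g : ℕ} {c h : Fin I.n} {l : List (Fin I.n)}
    (rotated : (I.graph.rot c).IsRotated (h :: l))
    (head : (bif (parent c).val == c.val then g else (parent c).val) = h.val) :
    cutRotation (netOf I) g c = (h :: l).map Fin.val := by
  rw [cutRotation, firstOut_netOf, head, neighbors_netOf, List.map_cons]
  exact rotateTo_eq ((I.graph.rot_nodup c).map Fin.val_injective) (rotated.map Fin.val)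

namespace Instance.HierarchicallyRealizes

theorem exists_isRightmost (hp : I.HierarchicallyRealizes p) :
    ∃ g < I.n, IsRightmost p g := by
  cases outer : I.outer with
  | none =>
    refine ⟨0, n_pos I, fun c _ u hu => ?_⟩
    exact absurd ((I.graph.mem_rot u c).2 (.inl (hp.arc_iff.2 hu))) (I.outer_none outer (u, c))
  | some d =>
    obtain ⟨e, ⟨highest, contact, rightmost⟩, -⟩ := hp.outer_face d outer
    have sink : IsSink e.1 := by
      by_contra h
      exact (highest _).not_gt (hp.high_lt_high_parent h)
    refine ⟨e.2, e.2.isLt, fun c hc u hu => ?_⟩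
    rw [hc.eq sink] at hu ⊢
    exact ⟨e.2, rfl, contact, rightmost u hu⟩

theorem exists_cutRotation_eq_of_isSink (hp : I.HierarchicallyRealizes p) {g : ℕ}
    (hg : IsRightmost p g) {c : Fin I.n} (hc : IsSink c) :
    ∃ l : List (Fin I.n), cutRotation (netOf I) g c = l.map Fin.val ∧
      (I.graph.rot c).IsRotated l ∧
      (l.filter fun w => I.graph.arc w c).Pairwise fun a b => I.left p b < I.left p a := by
  obtain ⟨above, below, rotated, contact_above, -, contact_below, pairwise⟩ := hp.rotation c
  have above_nil : above = [] := List.eq_nil_iff_forall_not_mem.2 fun w hw => by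
    simpa [hc w] using hp.arc_iff.2 (contact_above w hw)
  rw [above_nil, List.nil_append] at rotated
  refine ⟨below, ?_, rotated, pairwise.sublist List.filter_sublist⟩
  cases below with
  | nil =>
    rw [cutRotation, neighbors_netOf, List.isRotated_nil_iff.1 rotated]
    rfl
  | cons h l =>
    obtain ⟨r, rfl, contact_r, left_le⟩ := hg c hc h (contact_below h List.mem_cons_self)
    have mem_r : r ∈ h :: l :=
      rotated.mem_iff.1 ((I.graph.mem_rot c r).2 (.inr (hp.arc_iff.2 contact_r)))
    have r_eq : r = h := (List.mem_cons.1 mem_r).resolve_right fun mem =>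
      ((List.pairwise_cons.1 pairwise).1 r mem).not_ge left_le
    exact cutRotation_eq rotated (by simp [hc.parent_eq, r_eq])

theorem exists_cutRotation_eq_of_not_isSink (hp : I.HierarchicallyRealizes p) (g : ℕ)
    {c : Fin I.n} (hc : ¬ IsSink c) :
    ∃ l : List (Fin I.n), cutRotation (netOf I) g c = l.map Fin.val ∧
      (I.graph.rot c).IsRotated l ∧
      (l.filter fun w => I.graph.arc w c).Pairwise fun a b => I.left p b < I.left p a := by
  obtain ⟨above, below, rotated, contact_above, -, contact_below, pairwise⟩ := hp.rotation c
  have parent_ne : (parent c).val ≠ c.val := fun h => hc (isSink_iff.2 (Fin.ext h))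
  have mem_parent : parent c ∈ above := by
    have mem := (I.graph.mem_rot c (parent c)).2 (.inl (arc_parent hc))
    rw [rotated.mem_iff, List.mem_append] at mem
    exact mem.resolve_right fun h => not_topContact_symm (hp.topContact_parent hc)
      (contact_below _ h)
  have not_arc : ∀ w ∈ above, ¬ I.graph.arc w c = true := fun w hw h =>
    not_topContact_symm (contact_above w hw) (hp.upward _ _ h)
  obtain ⟨before, after, rfl⟩ := List.append_of_mem mem_parent
  have rotated' : (I.graph.rot c).IsRotated (parent c :: (after ++ below ++ before)) := by
    rw [List.append_assoc, List.cons_append] at rotated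
    exact rotated.trans List.isRotated_append
  refine ⟨_, cutRotation_eq rotated' ?_, rotated', ?_⟩
  · rw [beq_eq_false_iff_ne.2 parent_ne, cond_false]
  · have filter_before : (before.filter fun w => I.graph.arc w c) = [] :=
      List.filter_eq_nil_iff.2 fun w hw => not_arc w (by simp [hw])
    have filter_after : (after.filter fun w => I.graph.arc w c) = [] :=
      List.filter_eq_nil_iff.2 fun w hw => not_arc w (by simp [hw])
    rw [List.filter_cons_of_neg (p := fun w => I.graph.arc w c) (not_arc _ mem_parent),
      List.filter_append, List.filter_append, filter_before, filter_after, List.nil_append,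
      List.append_nil]
    exact pairwise.sublist List.filter_sublist

theorem exists_cutRotation_eq (hp : I.HierarchicallyRealizes p) {g : ℕ} (hg : IsRightmost p g)
    (c : Fin I.n) : ∃ l : List (Fin I.n), cutRotation (netOf I) g c = l.map Fin.val ∧
      (I.graph.rot c).IsRotated l ∧
      (l.filter fun w => I.graph.arc w c).Pairwise fun a b => I.left p b < I.left p a := by
  by_cases hc : IsSink c
  · exact hp.exists_cutRotation_eq_of_isSink hg hc
  · exact hp.exists_cutRotation_eq_of_not_isSink g hc

end Instance.HierarchicallyRealizes

end Realization

/-! ### Completeness of the search -/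

section Search

variable {I : Instance} {p : Fin I.n → ℝ × ℝ} {u v : Fin I.n} {g : ℕ}

theorem iterate_mem_outPath (v : Fin I.n) (k : ℕ) :
    (parent^[k] v).val ∈ outPath (netOf I) v := by
  rw [mem_outPath]
  rcases le_total k I.n with le | ge
  · exact ⟨k, le, rfl⟩
  · refine ⟨I.n, le_rfl, ?_⟩
    rw [← Nat.sub_add_cancel ge, Function.iterate_add_apply, (isSink_iterate v).iterate_eq]

theorem leftOf_iff : leftOf (netOf I) g u v = true ↔ ∃ i j,
    parent (parent^[i] u) = parent (parent^[j] v) ∧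
      precedes (cutRotation (netOf I) g (parent (parent^[i] u))) (parent^[j] v) (parent^[i] u) =
        true := by
  simp only [leftOf, List.any_eq_true, Bool.and_eq_true, beq_iff_eq]
  constructor
  · rintro ⟨a, ha, b, hb, parent_eq, prec⟩
    obtain ⟨i, -, rfl⟩ := mem_outPath.1 ha
    obtain ⟨j, -, rfl⟩ := mem_outPath.1 hb
    rw [firstOut_netOf] at parent_eq prec
    rw [firstOut_netOf, Fin.val_inj] at parent_eq
    exact ⟨i, j, parent_eq, prec⟩
  · rintro ⟨i, j, parent_eq, prec⟩
    refine ⟨_, iterate_mem_outPath u i, _, iterate_mem_outPath v j, ?_, ?_⟩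
    · rw [firstOut_netOf, firstOut_netOf, parent_eq]
    · rwa [firstOut_netOf]

theorem mem_rot_parent_iff : v ∈ I.graph.rot (parent v) ↔ ¬ IsSink v := by
  refine ⟨fun mem sink => ?_, fun h => (I.graph.mem_rot _ _).2 (.inr (arc_parent h))⟩
  rw [I.graph.mem_rot, sink.parent_eq, arc_irrefl] at mem
  simp at mem

theorem mem_cutRotation (h : ¬ IsSink v) : v.val ∈ cutRotation (netOf I) g (parent v) := by
  rw [cutRotation, ← (isRotated_rotateTo _ _).mem_iff, neighbors_netOf]
  exact List.mem_map_of_mem (mem_rot_parent_iff.2 h)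

namespace Instance.HierarchicallyRealizes

theorem left_lt_left_of_precedes (hp : I.HierarchicallyRealizes p) (hg : IsRightmost p g)
    (parent_eq : parent u = parent v)
    (h : precedes (cutRotation (netOf I) g (parent u)) v u = true) :
    ¬ IsSink u ∧ ¬ IsSink v ∧ u ≠ v ∧ I.left p u < I.left p v := by
  obtain ⟨l, cut_eq, rotated, pairwise⟩ := hp.exists_cutRotation_eq hg (parent u)
  rw [precedes_iff, cut_eq] at h
  have sublist : [v, u].Sublist l := pair_sublist_of_map Fin.val_injective h
  have hu : ¬ IsSink u := mem_rot_parent_iff.1 (rotated.mem_iff.2 (sublist.subset (by simp)))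
  have hv : ¬ IsSink v :=
    mem_rot_parent_iff.1 (parent_eq ▸ rotated.mem_iff.2 (sublist.subset (by simp)))
  have nodup := (rotated.nodup_iff.1 (I.graph.rot_nodup _)).sublist sublist
  refine ⟨hu, hv, fun eq => by simp [eq] at nodup, ?_⟩
  have arc_v : I.graph.arc v (parent u) = true := parent_eq ▸ arc_parent hv
  have filtered := sublist.filter fun w => I.graph.arc w (parent u)
  simp only [List.filter_cons, arc_parent hu, arc_v, if_true, List.filter_nil] at filtered
  simpa using pairwise.sublist filtered

theorem right_le_left_of_leftOf (hp : I.HierarchicallyRealizes p) (hg : IsRightmost p g)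
    (h : leftOf (netOf I) g u v = true)
    (hadj : ¬ (I.graph.arc u v = true ∨ I.graph.arc v u = true))
    (hmeet : closedMeet (netOf I) u v = true) : I.right p u ≤ I.left p v := by
  obtain ⟨low_high, high_low⟩ := hp.closedMeet_iff.1 hmeet
  obtain ⟨i, j, parent_eq, prec⟩ := leftOf_iff.1 h
  obtain ⟨sink_u, sink_v, ne, left_lt⟩ := hp.left_lt_left_of_precedes hg parent_eq prec
  have high_eq := hp.high_eq_of_parent_eq sink_u sink_v parent_eq
  have right_le := (hp.representation.separated ne (high_eq ▸ low_lt_high p _)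
    (high_eq ▸ low_lt_high p _)).resolve_right
      ((left_lt.trans (left_lt_right p _)).not_ge)
  exact hp.right_le_left_of_branchLeft_of_not_adjacent ⟨sink_u, sink_v, parent_eq, right_le⟩ hadj
    low_high high_low

theorem not_adjacent_of_openMeet (hp : I.HierarchicallyRealizes p)
    (h : openMeet (netOf I) u v = true) :
    ¬ (I.graph.arc u v = true ∨ I.graph.arc v u = true) := by
  rw [hp.openMeet_iff] at h
  rintro (arc | arc)
  · exact h.2.ne' (hp.upward _ _ arc).1
  · exact h.1.ne' (hp.upward _ _ arc).1

theorem high_le_low_iterate (hp : I.HierarchicallyRealizes p) (hu : ¬ IsSink u) (k : ℕ) :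
    I.high p u ≤ I.low p (parent^[k + 1] u) := by
  induction k with
  | zero => exact (hp.topContact_parent hu).1.le
  | succ k ih =>
    rw [Function.iterate_succ_apply']
    by_cases h : IsSink (parent^[k + 1] u)
    · rwa [h.parent_eq]
    · rw [← (hp.topContact_parent h).1]
      exact ih.trans (low_lt_high p _).le

theorem high_lt_low_iterate (hp : I.HierarchicallyRealizes p) {k : ℕ}
    (hne : parent^[k] u ≠ u) (harc : ¬ I.graph.arc u (parent^[k] u) = true) :
    I.high p u < I.low p (parent^[k] u) := by
  have hu : ¬ IsSink u := fun h => hne (h.iterate_eq k)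
  match k with
  | 0 => exact absurd rfl hne
  | 1 => exact absurd (arc_parent hu) harc
  | k + 2 =>
    by_cases hpar : IsSink (parent u)
    · rw [Function.iterate_succ_apply, hpar.iterate_eq] at harc
      exact absurd (arc_parent hu) harc
    · exact (hp.high_lt_high_parent hu).trans_le (hp.high_le_low_iterate hpar k)

theorem leftOf_total (hp : I.HierarchicallyRealizes p) (g : ℕ) (huv : u ≠ v)
    (hadj : ¬ (I.graph.arc u v = true ∨ I.graph.arc v u = true))
    (hmeet : closedMeet (netOf I) u v = true) :
    leftOf (netOf I) g u v = true ∨ leftOf (netOf I) g v u = true := by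
  obtain ⟨low_high, high_low⟩ := hp.closedMeet_iff.1 hmeet
  rcases exists_siblings_of_iterate_eq parent
    ⟨I.n, I.n, (isSink_iterate u).eq (isSink_iterate v)⟩ with
    ⟨j, rfl⟩ | ⟨i, rfl⟩ | ⟨i, j, ne, parent_eq, not_fixed_u, not_fixed_v⟩
  · exact absurd (hp.high_lt_low_iterate huv fun arc => hadj (.inr arc)) low_high.not_gt
  · exact absurd (hp.high_lt_low_iterate huv.symm fun arc => hadj (.inl arc)) high_low.not_gt
  · have mem_u := mem_cutRotation (g := g) fun sink => not_fixed_u (isSink_iff.1 sink)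
    have mem_v := mem_cutRotation (g := g) fun sink => not_fixed_v (isSink_iff.1 sink)
    rw [← parent_eq] at mem_v
    rcases pair_sublist_or (fun eq => ne (Fin.ext eq)) mem_u mem_v with sublist | sublist
    · exact .inr (leftOf_iff.2 ⟨j, i, parent_eq.symm, parent_eq ▸ precedes_iff.2 sublist⟩)
    · exact .inl (leftOf_iff.2 ⟨i, j, parent_eq, precedes_iff.2 sublist⟩)

end Instance.HierarchicallyRealizes

/-- The abscissae `x`, integral or natural, satisfy the difference constraints that result from the
guess `g` of the rightmost in-neighbour of the sink. -/
def IsFeasible {R : Type*} [AddMonoidWithOne R] [LE R] (I : Instance) (g : ℕ) (x : Fin I.n → R) :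
    Prop :=
  ∀ (u v : Fin I.n) (a b : ℕ), (a, b) ∈ constraint (netOf I) g u v → x u + a ≤ x v + b

theorem mem_constraint {c : ℕ × ℕ} : c ∈ constraint (netOf I) g u v ↔ u ≠ v ∧
    ((I.graph.arc u v = true ∨ I.graph.arc v u = true) ∧ c = (1, scaledWidth (netOf I) v) ∨
      ¬ (I.graph.arc u v = true ∨ I.graph.arc v u = true) ∧ leftOf (netOf I) g u v = true ∧
        closedMeet (netOf I) u v = true ∧
          c = (scaledWidth (netOf I) u + bif openMeet (netOf I) u v then 1 else 0, 0)) := by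
  rw [← adjacent_netOf, constraint, ne_eq, ← Fin.val_inj, ← beq_iff_eq]
  cases u.val == v.val <;> cases adjacent (netOf I) u v <;> cases leftOf (netOf I) g u v <;>
    cases closedMeet (netOf I) u v <;> simp

theorem exists_right_mul_eq (p : Fin I.n → ℝ × ℝ) (v : Fin I.n) : ∃ W : ℕ,
    scaledWidth (netOf I) v = I.n * W ∧
      I.right p v * commonDenom (netOf I) = I.left p v * commonDenom (netOf I) + W := by
  have := cast_commonDenom_pos I
  have : (0 : ℝ) < I.n := Nat.cast_pos.2 (n_pos I)
  have dvd : I.n ∣ scaledWidth (netOf I) v := by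
    rw [scaledWidth, length_netOf]
    exact dvd_mul_right _ _
  obtain ⟨W, hW⟩ := dvd
  refine ⟨W, hW, ?_⟩
  rw [Instance.right, width_val, hW, Instance.left]
  push_cast
  field_simp

theorem exists_int_abscissae (p : Fin I.n → ℝ × ℝ) : ∃ z : Fin I.n → ℤ, ∀ u v,
    (I.right p u ≤ I.left p v → z u + scaledWidth (netOf I) u ≤ z v) ∧
    (I.right p u < I.left p v → z u + scaledWidth (netOf I) u + 1 ≤ z v) ∧
    (I.left p u < I.right p v → z u + 1 ≤ z v + scaledWidth (netOf I) v) := by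
  have denom_pos := cast_commonDenom_pos I
  choose W scaledWidth_eq right_eq using exists_right_mul_eq p
  obtain ⟨z, hz⟩ := exists_int_potential fun v => I.left p v * commonDenom (netOf I)
  rw [Fintype.card_fin] at hz
  refine ⟨z, fun u v => ⟨fun le => ?_, fun lt => ?_, fun lt => ?_⟩⟩
  · have scaled := mul_le_mul_of_nonneg_right le denom_pos.le
    rw [right_eq] at scaled
    have := (hz u v (W u)).1 (by exact_mod_cast scaled)
    rw [scaledWidth_eq]
    exact_mod_cast this
  · have scaled := mul_lt_mul_of_pos_right lt denom_pos
    rw [right_eq] at scaled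
    have := (hz u v (W u)).2 (by exact_mod_cast scaled)
    rw [scaledWidth_eq]
    exact_mod_cast this
  · have scaled := mul_lt_mul_of_pos_right lt denom_pos
    rw [right_eq] at scaled
    have := (hz u v (-W v)).2 (by push_cast; linarith)
    rw [scaledWidth_eq]
    push_cast
    linarith

namespace Instance.HierarchicallyRealizes

theorem exists_isFeasible (hp : I.HierarchicallyRealizes p) (hg : IsRightmost p g) :
    ∃ z : Fin I.n → ℤ, IsFeasible I g z := by
  obtain ⟨z, hz⟩ := exists_int_abscissae p
  refine ⟨z, fun u v a b h => ?_⟩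
  obtain ⟨of_le, of_lt, of_left_lt_right⟩ := hz u v
  obtain ⟨huv, ⟨hadj, eq⟩ | ⟨hadj, left, hmeet, eq⟩⟩ := mem_constraint.1 h <;>
    obtain ⟨rfl, rfl⟩ := Prod.mk.inj eq
  · have left_lt : I.left p u < I.right p v := by
      rcases hadj with arc | arc
      · exact (topContact_iff.1 (hp.upward _ _ arc)).2.1
      · exact (topContact_iff.1 (hp.upward _ _ arc)).2.2
    exact_mod_cast of_left_lt_right left_lt
  · have right_le := hp.right_le_left_of_leftOf hg left hadj hmeet
    cases meets : openMeet (netOf I) u v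
    · simpa using of_le right_le
    · obtain ⟨low_high, high_low⟩ := hp.openMeet_iff.1 meets
      have right_lt := (hp.separated_strict huv low_high high_low).resolve_right fun wrong => by
        linarith [left_lt_right p u, left_lt_right p v]
      simpa [add_assoc] using of_lt right_lt

end Instance.HierarchicallyRealizes

theorem getD_relax (d : List ℕ) (v : Fin I.n) : (relax (netOf I) g d).getD v 0 =
    ((List.range I.n).flatMap fun u =>
      (constraint (netOf I) g u v).map fun c => d.getD u 0 + c.1 - c.2).foldl max (d.getD v 0) := by
  rw [relax, List.getD_eq_getElem?_getD, List.getElem?_eq_getElem (by simp)]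
  simp only [List.getElem_map, List.getElem_range, length_netOf, Option.getD_some]

theorem isRelaxation_iterate_relax (I : Instance) (g : ℕ) (d : List ℕ) :
    IsRelaxation (fun (u v : Fin I.n) a b => (a, b) ∈ constraint (netOf I) g u v)
      fun k v => ((relax (netOf I) g)^[k] d).getD v 0 where
  le_succ k v := by
    rw [Function.iterate_succ_apply', getD_relax]
    exact (le_foldl_max _ _).1
  sub_le_succ k u v a b h := by
    rw [Function.iterate_succ_apply', getD_relax]
    exact (le_foldl_max _ _).2 _ (List.mem_flatMap.2
      ⟨u, List.mem_range.2 u.isLt, List.mem_map.2 ⟨_, h, rfl⟩⟩)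
  eq_or_eq_sub k v := by
    rw [Function.iterate_succ_apply', getD_relax]
    refine (foldl_max_eq_or_mem _ _).imp_right fun mem => ?_
    obtain ⟨u, hu, mem⟩ := List.mem_flatMap.1 mem
    obtain ⟨c, hc, eq⟩ := List.mem_map.1 mem
    exact ⟨⟨u, List.mem_range.1 hu⟩, c.1, c.2, hc, eq.symm⟩

theorem abscissae_netOf (I : Instance) (g : ℕ) :
    abscissae (netOf I) g = (relax (netOf I) g)^[I.n] ((netOf I).map fun _ => 0) := by
  rw [abscissae, List.foldl_const, length_netOf]

theorem isFeasible_abscissae {z : Fin I.n → ℤ} (hz : IsFeasible I g z) :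
    IsFeasible I g fun v => (abscissae (netOf I) g).getD v 0 := fun u v a b h => by
  have := (isRelaxation_iterate_relax I g ((netOf I).map fun _ => 0)).add_le_add hz h
  rwa [Fintype.card_fin, ← abscissae_netOf] at this

end Search

section Completeness

variable {I : Instance} {p : Fin I.n → ℝ × ℝ} {u v : Fin I.n} {g : ℕ} {x : List ℕ}

theorem lt_add_scaledWidth_of_adjacent (hx : IsFeasible I g fun v => x.getD v 0)
    (hadj : I.graph.arc u v = true ∨ I.graph.arc v u = true) :
    x.getD u 0 < x.getD v 0 + scaledWidth (netOf I) v := by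
  have huv : u ≠ v := hadj.elim ne_of_arc fun arc => (ne_of_arc arc).symm
  exact hx u v 1 _ (mem_constraint.2 ⟨huv, .inl ⟨hadj, rfl⟩⟩)

theorem add_le_of_leftOf (hx : IsFeasible I g fun v => x.getD v 0) (huv : u ≠ v)
    (hadj : ¬ (I.graph.arc u v = true ∨ I.graph.arc v u = true))
    (left : leftOf (netOf I) g u v = true) (hmeet : closedMeet (netOf I) u v = true) :
    x.getD u 0 + (scaledWidth (netOf I) u + bif openMeet (netOf I) u v then 1 else 0) ≤
      x.getD v 0 :=
  hx u v _ 0 (mem_constraint.2 ⟨huv, .inr ⟨hadj, left, hmeet, rfl⟩⟩)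

theorem closedMeet_of_openMeet (h : openMeet (netOf I) u v = true) :
    closedMeet (netOf I) u v = true := by
  simp only [openMeet, closedMeet, Bool.and_eq_true, decide_eq_true_eq] at h ⊢
  exact ⟨h.1.le, h.2.le⟩

theorem openMeet_comm : openMeet (netOf I) u v = openMeet (netOf I) v u := by
  rw [openMeet, openMeet, Bool.and_comm]

theorem closedMeet_comm : closedMeet (netOf I) u v = closedMeet (netOf I) v u := by
  rw [closedMeet, closedMeet, Bool.and_comm]

theorem checkRotation_of_pairwise_mayPrecede {l : List (Fin I.n)}
    (rotated : (I.graph.rot v).IsRotated l)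
    (pairwise : l.Pairwise fun a b : Fin I.n => mayPrecede (netOf I) x v a b = true) :
    checkRotation (netOf I) x v = true := by
  have nodup : (neighbors (netOf I) v).Nodup := by
    rw [neighbors_netOf]
    exact (I.graph.rot_nodup v).map Fin.val_injective
  have rotated : (neighbors (netOf I) v).IsRotated (l.map Fin.val) := by
    rw [neighbors_netOf]
    exact rotated.map _
  obtain ⟨s, hs, rotateTo_s⟩ : ∃ s ∈ v.val :: neighbors (netOf I) v,
      rotateTo s (neighbors (netOf I) v) = l.map Fin.val := by
    cases eq : l.map Fin.val with
    | nil =>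
      rw [eq] at rotated
      refine ⟨v, List.mem_cons_self, ?_⟩
      rw [List.isRotated_nil_iff.1 rotated]
      rfl
    | cons s m =>
      rw [eq] at rotated
      exact ⟨s, List.mem_cons_of_mem _ (rotated.mem_iff.2 List.mem_cons_self),
        rotateTo_eq nodup rotated⟩
  rw [checkRotation, List.any_eq_true]
  refine ⟨s, hs, ?_⟩
  simp only [rotateTo_s, List.all_eq_true, List.forall_mem_map]
  intro a _ b _
  cases prec : precedes (l.map Fin.val) a b
  · rfl
  · simpa using pairwise.sublist (pair_sublist_of_map Fin.val_injective (precedes_iff.1 prec))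

namespace Instance.HierarchicallyRealizes

theorem openMeet_of_high_eq (hp : I.HierarchicallyRealizes p) (h : I.high p u = I.high p v) :
    openMeet (netOf I) u v = true :=
  hp.openMeet_iff.2 ⟨h ▸ low_lt_high p u, h ▸ low_lt_high p v⟩

theorem openMeet_of_low_eq (hp : I.HierarchicallyRealizes p) (h : I.low p u = I.low p v) :
    openMeet (netOf I) u v = true :=
  hp.openMeet_iff.2 ⟨h ▸ low_lt_high p v, h ▸ low_lt_high p u⟩

theorem depth_eq_of_arc (hp : I.HierarchicallyRealizes p) (h : I.graph.arc u v = true) :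
    depth (netOf I) u = depth (netOf I) v + scaledHeight (netOf I) u := by
  have low_eq := (hp.upward _ _ h).1
  have le := hp.low_le_high_iff.1 low_eq.ge
  have not_lt := mt hp.low_lt_high_iff.2 low_eq.not_gt
  omega

theorem getD_lt_getD_of_openMeet (hp : I.HierarchicallyRealizes p) (hg : IsRightmost p g)
    (hx : IsFeasible I g fun v => x.getD v 0) (hmeet : openMeet (netOf I) u v = true)
    (left_lt : I.left p u < I.left p v) : x.getD u 0 < x.getD v 0 := by
  have huv : u ≠ v := fun eq => (eq ▸ left_lt).false
  have hadj := hp.not_adjacent_of_openMeet hmeet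
  have closed := closedMeet_of_openMeet hmeet
  rcases hp.leftOf_total g huv hadj closed with left | left
  · have := add_le_of_leftOf hx huv hadj left closed
    have := scaledWidth_pos u
    omega
  · have := hp.right_le_left_of_leftOf hg left (by rwa [or_comm]) (by rwa [closedMeet_comm])
    exact absurd (left_lt.trans (left_lt_right p v)) this.not_gt

theorem getD_add_le_or (hp : I.HierarchicallyRealizes p)
    (hx : IsFeasible I g fun v => x.getD v 0) (huv : u ≠ v)
    (hadj : ¬ (I.graph.arc u v = true ∨ I.graph.arc v u = true))
    (hmeet : closedMeet (netOf I) u v = true) :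
    x.getD u 0 + (scaledWidth (netOf I) u + bif openMeet (netOf I) u v then 1 else 0) ≤
        x.getD v 0 ∨
      x.getD v 0 + (scaledWidth (netOf I) v + bif openMeet (netOf I) u v then 1 else 0) ≤
        x.getD u 0 := by
  rcases hp.leftOf_total g huv hadj hmeet with left | left
  · exact .inl (add_le_of_leftOf hx huv hadj left hmeet)
  · rw [openMeet_comm]
    exact .inr (add_le_of_leftOf hx huv.symm (by rwa [or_comm]) left (by rwa [closedMeet_comm]))

theorem checkPair_of_arc (hp : I.HierarchicallyRealizes p)
    (hx : IsFeasible I g fun v => x.getD v 0) (h : I.graph.arc u v = true) :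
    checkPair (netOf I) x u v = true := by
  rw [checkPair, hasArc_netOf, h]
  simp only [cond_true, Bool.and_eq_true, beq_iff_eq, decide_eq_true_eq]
  exact ⟨⟨hp.depth_eq_of_arc h, lt_add_scaledWidth_of_adjacent hx (.inl h)⟩,
    lt_add_scaledWidth_of_adjacent hx (.inr h)⟩

theorem checkPair_of_not_adjacent (hp : I.HierarchicallyRealizes p)
    (hx : IsFeasible I g fun v => x.getD v 0) (huv : u ≠ v)
    (hadj : ¬ (I.graph.arc u v = true ∨ I.graph.arc v u = true)) :
    checkPair (netOf I) x u v = true := by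
  have := scaledWidth_pos u
  have := scaledWidth_pos v
  cases closed : closedMeet (netOf I) u v
  · have opened : openMeet (netOf I) u v = false := by
      rw [← Bool.not_eq_true] at closed ⊢
      exact mt closedMeet_of_openMeet closed
    rw [not_or, Bool.not_eq_true] at hadj
    simp [checkPair, hasArc_netOf, hadj.1, closed, opened]
  · have apart := hp.getD_add_le_or hx huv hadj closed
    rw [not_or, Bool.not_eq_true, Bool.not_eq_true] at hadj
    rw [checkPair, hasArc_netOf, hasArc_netOf, hadj.1, hadj.2, closed]
    cases opened : openMeet (netOf I) u v <;> rw [opened] at apart <;>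
      simp only [cond_false, cond_true, Bool.false_or, Bool.true_and, Bool.false_and,
        Bool.not_false, Bool.and_true, Bool.or_eq_true, Bool.and_eq_true, Bool.not_eq_true',
        Bool.and_eq_false_iff, decide_eq_false_iff_not] at apart ⊢ <;> omega

theorem checkPair_of_isFeasible (hp : I.HierarchicallyRealizes p)
    (hx : IsFeasible I g fun v => x.getD v 0) (u v : Fin I.n) :
    checkPair (netOf I) x u v = true := by
  rcases eq_or_ne u v with rfl | huv
  · simp [checkPair, hasArc_netOf, arc_irrefl]
  · by_cases hadj : I.graph.arc u v = true ∨ I.graph.arc v u = true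
    · rcases hadj with arc | arc
      · exact hp.checkPair_of_arc hx arc
      · have not_arc : I.graph.arc u v = false := by
          rw [← Bool.not_eq_true, hp.arc_iff]
          exact not_topContact_symm (hp.upward _ _ arc)
        simp [checkPair, hasArc_netOf, arc, not_arc]
    · exact hp.checkPair_of_not_adjacent hx huv hadj

theorem checkRotation_of_isFeasible (hp : I.HierarchicallyRealizes p) (hg : IsRightmost p g)
    (hx : IsFeasible I g fun v => x.getD v 0) (v : Fin I.n) :
    checkRotation (netOf I) x v = true := by
  obtain ⟨above, below, rotated, contact_above, pairwise_above, contact_below, pairwise_below⟩ :=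
    hp.rotation v
  have arc_above {w} (hw : w ∈ above) : I.graph.arc v w = true := hp.arc_iff.2 (contact_above w hw)
  have not_arc_below {w} (hw : w ∈ below) : I.graph.arc v w = false := by
    rw [← Bool.not_eq_true, hp.arc_iff]
    exact not_topContact_symm (contact_below w hw)
  refine checkRotation_of_pairwise_mayPrecede rotated ?_
  simp only [mayPrecede, hasArc_netOf]
  refine List.pairwise_append.2 ⟨pairwise_above.imp_of_mem fun ha hb left_lt => ?_,
    pairwise_below.imp_of_mem fun ha hb left_lt => ?_, fun a ha b hb => ?_⟩
  · have meets := hp.openMeet_of_low_eq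
      ((contact_above _ ha).1.symm.trans (contact_above _ hb).1)
    simpa [arc_above ha, arc_above hb] using hp.getD_lt_getD_of_openMeet hg hx meets left_lt
  · have meets := hp.openMeet_of_high_eq
      ((contact_below _ hb).1.trans (contact_below _ ha).1.symm)
    simpa [not_arc_below ha, not_arc_below hb] using
      hp.getD_lt_getD_of_openMeet hg hx meets left_lt
  · simp [arc_above ha, not_arc_below hb]

theorem getD_le_getD_of_topContact (hp : I.HierarchicallyRealizes p) (hg : IsRightmost p g)
    (hx : IsFeasible I g fun v => x.getD v 0) {c : Fin I.n} (hu : I.TopContact p u c)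
    (hv : I.TopContact p v c) (left_le : I.left p u ≤ I.left p v) :
    x.getD u 0 ≤ x.getD v 0 := by
  rcases eq_or_ne u v with rfl | huv
  · exact le_rfl
  · have meets := hp.openMeet_of_high_eq (hu.1.trans hv.1.symm)
    obtain ⟨low_high, high_low⟩ := hp.openMeet_iff.1 meets
    refine (hp.getD_lt_getD_of_openMeet hg hx meets (left_le.lt_of_ne fun eq => ?_)).le
    rcases hp.representation.separated huv low_high high_low with right_le | right_le
    · exact (eq ▸ left_lt_right p u).not_ge right_le
    · exact (eq ▸ left_lt_right p v).not_ge right_le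

theorem checkOuter_of_isFeasible (hp : I.HierarchicallyRealizes p) (hg : IsRightmost p g)
    (hx : IsFeasible I g fun v => x.getD v 0) : checkOuter (netOf I) (outerOf I) x = true := by
  cases outer : I.outer with
  | none => simp [checkOuter, outerOf, outer]
  | some d =>
    obtain ⟨e, ⟨highest, contact, rightmost⟩, k, face_eq⟩ := hp.outer_face d outer
    obtain ⟨j, lt_card, iterate_eq⟩ := exists_iterate_eq_lt_card I.graph.faceNext d k
    rw [face_eq] at iterate_eq
    have sink : IsSink e.1 := by
      by_contra h
      exact (highest _).not_gt (hp.high_lt_high_parent h)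
    rw [checkOuter, show outerOf I = [d.1.val, d.2.val] by rw [outerOf, outer]]
    simp only [List.isEmpty_cons, Bool.false_or, List.getD_cons_zero, List.getD_cons_succ,
      List.any_eq_true, face, List.mem_iterate]
    refine ⟨(e.1.val, e.2.val), ⟨j, ?_, ?_⟩, ?_⟩
    · simp only [Fintype.card_prod, Fintype.card_fin] at lt_card
      simpa using lt_card.trans (Nat.lt_succ_self _)
    · rw [iterate_nextDart_netOf (I.outer_some d outer), iterate_eq]
    · simp only [firstOut_netOf, sink.parent_eq, hasArc_netOf, hp.arc_iff.2 contact,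
        beq_self_eq_true, Bool.true_and, List.all_eq_true, List.mem_range, length_netOf]
      intro i hi
      lift i to Fin I.n using hi
      rw [hasArc_netOf]
      cases arc : I.graph.arc i e.1
      · rfl
      · have contact_i := hp.arc_iff.1 arc
        simpa using hp.getD_le_getD_of_topContact hg hx contact_i contact (rightmost i contact_i)

theorem solutions_ne_nil (hp : I.HierarchicallyRealizes p) :
    solutions (netOf I) (outerOf I) ≠ [] := by
  obtain ⟨g, g_lt, hg⟩ := hp.exists_isRightmost
  obtain ⟨z, hz⟩ := hp.exists_isFeasible hg
  have hx := isFeasible_abscissae hz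
  refine List.ne_nil_of_mem (a := abscissae (netOf I) g) (List.mem_filter.2
    ⟨List.mem_map.2 ⟨g, by simpa using g_lt, rfl⟩, ?_⟩)
  simp only [check, Bool.and_eq_true, List.all_eq_true, List.mem_range, length_netOf]
  exact ⟨⟨fun u hu v hv => hp.checkPair_of_isFeasible hx ⟨u, hu⟩ ⟨v, hv⟩,
    fun v hv => hp.checkRotation_of_isFeasible hg hx ⟨v, hv⟩⟩, hp.checkOuter_of_isFeasible hg hx⟩

end Instance.HierarchicallyRealizes

end Completeness

/-! ### The answer -/

/-- The output of the algorithm: the placement of the first candidate that passes the check, if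
any. -/
def answer (I : Instance) : Option (List (Fraction × Fraction)) :=
  (solutions (netOf I) (outerOf I)).head?.map fun x => List.ofFn (coord I x)

theorem isCorrectOutput_answer (I : Instance) : IsCorrectOutput I (answer I) := by
  rw [answer]
  cases eq : solutions (netOf I) (outerOf I) with
  | nil => exact fun ⟨p, hp⟩ => hp.solutions_ne_nil eq
  | cons x l =>
    have mem : x ∈ solutions (netOf I) (outerOf I) := by simp [eq]
    exact ⟨coord I x, rfl, hierarchicallyRealizes_of_check (List.mem_filter.1 mem).2⟩

theorem encodeOutput_answer (I : Instance) :
    encodeOutput (answer I) = encodeNats (result (netOf I) (outerOf I)) := by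
  unfold answer result encodeOutput
  congr 1
  cases solutions (netOf I) (outerOf I) with
  | nil => rfl
  | cons x l =>
    simp only [List.head?_cons, Option.map_some, List.singleton_append, List.cons.injEq, true_and,
      length_netOf]
    rw [List.ofFn_eq_map, ← List.map_coe_finRange_eq_range, List.flatMap_map, List.flatMap_map]
    congr 1
    funext v
    rcases Nat.eq_zero_or_pos (depth (netOf I) v) with zero | pos
    · simp [coord, Fraction.toNats, zero]
    · simp [coord, Fraction.toNats, pos, beq_eq_false_iff_ne.2 pos.ne']

end HiWRAC

theorem theorem3 :
    ∃ f : HiWRAC.Instance → Option (List (HiWRAC.Fraction × HiWRAC.Fraction)),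
      (∀ I : HiWRAC.Instance, HiWRAC.IsCorrectOutput I (f I)) ∧
      Nonempty (Turing.TM2ComputableInPolyTime HiWRAC.encodeInstance HiWRAC.encodeOutput f) := by
  refine ⟨HiWRAC.answer, HiWRAC.isCorrectOutput_answer, HiWRAC.computable_of_polyTime _ _ _ ?_⟩
  simp only [HiWRAC.encodeOutput_answer]
  exact HiWRAC.polyTime_result
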